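/- Let $d\in\{2,3\}$, let $\Omega\subset\mathbb R^d$ be an open, bounded domain with piecewise smooth boundary $\Gamma=\partial\Omega$ (that is, $\Gamma$ has finite $(d-1)$-dimensional measure and, off a set of $(d-1)$-dimensional measure zero, is locally a $C^1$ hypersurface with $\Omega$ on one side) and outer unit normal $n$, and let $b\in[W^{1,\infty}(\Omega)]^d$ and $c\in L^\infty(\Omega)$ satisfy $$c_0:=\operatorname*{ess\,inf}_{x\in\Omega}\Bigl(c(x)-\tfrac12\nabla\cdot b(x)\Bigr)>0,\qquad \tau_c^{-1}:=\|c\|_{0,\infty,\Omega}+|b|_{1,\infty,\Omega},$$ where $|b|_{1,\infty,\Omega}$ is the $L^\infty$-norm over $\Omega$ of the Jacobian of $b$ (in the operator norm) and $b$ is represented by its continuous representative, extended continuously to the smooth part of $\Gamma$. Set $\Gamma^-=\{x\in\Gamma: b(x)\cdot n(x)<0\}$. Let $\widetilde{\mathcal T}_h$ be a finite conforming mesh of closed $d$-simplices covering $\overline\Omega$, which need not be fitted to $\Gamma$. Let $\mathcal T_h=\{T\in\widetilde{\mathcal T}_h: T\cap\Omega\ne\emptyset\}$ be the active mesh, $\mathcal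 F_h$ the set of facets $F=T^+\cap T^-$ shared by two distinct elements of $\mathcal T_h$, each with a chosen unit normal $n=n_F$, and $V_h=\bigoplus_{T\in\mathcal T_h}\mathbb P_p(T)$ with $p\ge 0$, where $\mathbb P_p(T)$ is the space of polynomials of total degree at most $p$. On a facet, $v^\pm(x)=\lim_{t\to0^+}v(x\mp t\,n_F)$, $[\![v]\!]=v^+-v^-$ and $\{v\}=\tfrac12(v^++v^-)$; on $\Gamma$, $v$ denotes the trace taken from inside $\Omega$. Inner products over $\mathcal T_h\cap\Omega$ and $\mathcal F_h\cap\Omega$ are sums of the $L^2$ inner products over the sets $T\cap\Omega$ and $F\cap\Omega$. For $v,w\in V_h$ define $$a_h(v,w)=(b\cdot\nabla v+cv,w)_{\mathcal T_h\cap\Omega}-(b\cdot n\,v,w)_{\Gamma^-}-(b\cdot n[\![v]\!],\{w\})_{\mathcal F_h\cap\Omega}+\tfrac12(|b\cdot n|[\![v]\!],[\![w]\!])_{\mathcal F_h\cap\Omega},$$ $$|||v|||_{\mathrm{up}}^2=\tau_c^{-1}\|v\|_\Omega^2+\tfrac12\||b\cdot n|^{1/2}v\|_\Gamma^2+\tfrac12\||b\cdot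 n|^{1/2}[\![v]\!]\|_{\mathcal F_h\cap\Omega}^2.$$ Let $g_h=g_c+g_b$, where the ghost penalties $g_c,g_b$ are symmetric positive semidefinite bilinear forms on $V_h$, and set $A_h=a_h+g_h$ and $|||v|||_{\mathrm{up},h}^2=|||v|||_{\mathrm{up}}^2+g_h(v,v)$. Then there is a constant $C>0$, depending only on $d$, such that for all $v\in V_h$ $$c_0\tau_c\,|||v|||_{\mathrm{up},h}^2\le C\,A_h(v,v).$$ The ghost penalty is not needed for coercivity in the upwind norm: with the same constant, $c_0\tau_c\,|||v|||_{\mathrm{up}}^2\le C\,a_h(v,v)$ for all $v\in V_h$. -/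

import Mathlib

open MeasureTheory Filter Topology
open scoped RealInnerProductSpace ENNReal

namespace CutDG

noncomputable section

/-- `ℝ^d` with the Euclidean norm and inner product. -/
abbrev E (d : ℕ) : Type := EuclideanSpace ℝ (Fin d)

/-! ### The domain -/

/-- `n` is the outer unit normal of `Ω` at the boundary point `x`: near `x`, the set `Ω` is the
sublevel set `{φ < 0}` of a `C¹` function `φ` with `φ x = 0` and `∇φ(x) ≠ 0`, and
`n = ∇φ(x) / |∇φ(x)|`. -/
def IsOuterNormal {d : ℕ} (Ω : Set (E d)) (x n : E d) : Prop :=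
  ∃ (U : Set (E d)) (φ : E d → ℝ), IsOpen U ∧ x ∈ U ∧ ContDiffOn ℝ 1 φ U ∧ φ x = 0 ∧
    gradient φ x ≠ 0 ∧ Ω ∩ U = {y ∈ U | φ y < 0} ∧ n = ‖gradient φ x‖⁻¹ • gradient φ x

/-- The boundary points near which `Γ = ∂Ω` is a smooth hypersurface with `Ω` on one side. -/
def regularBoundary {d : ℕ} (Ω : Set (E d)) : Set (E d) :=
  {x ∈ frontier Ω | ∃ n, IsOuterNormal Ω x n}

open Classical in
/-- The outer unit normal field `n_Γ`; it is set to `0` at the singular boundary points. -/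
def outerNormal {d : ℕ} (Ω : Set (E d)) (x : E d) : E d :=
  if h : ∃ n, IsOuterNormal Ω x n then h.choose else 0

/-- An open, bounded domain with piecewise smooth boundary: `Γ = ∂Ω` has finite
`(d-1)`-dimensional measure and is smooth away from a set of `(d-1)`-dimensional measure zero
(edges, corners, ...). `μHE[d-1]` is the Hausdorff measure normalised to surface measure. -/
structure IsPiecewiseSmoothDomain {d : ℕ} (Ω : Set (E d)) : Prop where
  isOpen : IsOpen Ω
  isConnected : IsConnected Ω
  isBounded : Bornology.IsBounded Ω
  boundary_finite : μHE[d - 1] (frontier Ω) < ∞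
  boundary_regular : μHE[d - 1] (frontier Ω \ regularBoundary Ω) = 0

/-! ### The coefficients -/

/-- `Db` is the weak derivative (Jacobian) of the vector field `b` in the open set `Ω`. -/
def HasWeakJacobian {d : ℕ} (Ω : Set (E d)) (b : E d → E d) (Db : E d → E d →L[ℝ] E d) : Prop :=
  ∀ φ : E d → ℝ, ContDiff ℝ (⊤ : ℕ∞) φ → HasCompactSupport φ → tsupport φ ⊆ Ω →
    ∀ e : E d, ∫ x in Ω, fderiv ℝ φ x e • b x = - ∫ x in Ω, φ x • Db x e

/-- `b ∈ [W^{1,∞}(Ω)]^d` with weak Jacobian `Db`. Point values of `b` on faces and on `Γ` are those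
of the (unique) representative that is continuous on `Ω` and up to the smooth part of `Γ`. -/
structure IsW1Infty {d : ℕ} (Ω : Set (E d)) (b : E d → E d) (Db : E d → E d →L[ℝ] E d) :
    Prop where
  memLp : MemLp b ∞ (volume.restrict Ω)
  memLp_jacobian : MemLp Db ∞ (volume.restrict Ω)
  hasWeakJacobian : HasWeakJacobian Ω b Db
  continuousOn : ContinuousOn b (Ω ∪ regularBoundary Ω)

/-- The divergence: the trace of the Jacobian. -/
def divergence {d : ℕ} (Db : E d → E d →L[ℝ] E d) (x : E d) : ℝ :=
  LinearMap.trace ℝ (E d) (Db x : E d →ₗ[ℝ] E d)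

/-- `c₀ = ess inf_Ω (c - ½ div b)`. -/
def c0 {d : ℕ} (Ω : Set (E d)) (Db : E d → E d →L[ℝ] E d) (c : E d → ℝ) : ℝ :=
  essInf (fun x => c x - 1 / 2 * divergence Db x) (volume.restrict Ω)

/-- The reference time: `τ_c⁻¹ = ‖c‖_{0,∞,Ω} + |b|_{1,∞,Ω}`. -/
def tauC {d : ℕ} (Ω : Set (E d)) (Db : E d → E d →L[ℝ] E d) (c : E d → ℝ) : ℝ :=
  ((eLpNorm c ∞ (volume.restrict Ω)).toReal + (eLpNorm Db ∞ (volume.restrict Ω)).toReal)⁻¹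

/-! ### The mesh -/

/-- A finite conforming simplicial mesh of `ℝ^d`. -/
structure Mesh (d : ℕ) extends Geometry.SimplicialComplex ℝ (E d) where
  finite_faces : faces.Finite

variable {d : ℕ}

/-- The closed simplex with vertex set `s`. -/
def simplex (s : Finset (E d)) : Set (E d) := convexHull ℝ (s : Set (E d))

open Classical in
/-- The elements: the `d`-dimensional simplices of the mesh, given by their vertex sets. -/
def Mesh.elements (𝒯 : Mesh d) : Finset (Finset (E d)) :=
  𝒯.finite_faces.toFinset.filter fun T => T.card = d + 1

/-- The mesh covers the closure of `Ω`. -/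
def Mesh.Covers (𝒯 : Mesh d) (Ω : Set (E d)) : Prop :=
  closure Ω ⊆ ⋃ T ∈ 𝒯.elements, simplex T

open Classical in
/-- The active mesh `𝒯_h`: the elements that meet the open set `Ω`. -/
def Mesh.active (𝒯 : Mesh d) (Ω : Set (E d)) : Finset (Finset (E d)) :=
  𝒯.elements.filter fun T => (simplex T ∩ Ω).Nonempty

open Classical in
/-- The interior faces `ℱ_h`: the common facets `F = T⁺ ∩ T⁻` of two distinct active elements,
given by their vertex sets. -/
def Mesh.interiorFaces (𝒯 : Mesh d) (Ω : Set (E d)) : Finset (Finset (E d)) :=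
  𝒯.finite_faces.toFinset.filter fun F => F.card = d ∧
    ∃ S ∈ 𝒯.active Ω, ∃ T ∈ 𝒯.active Ω, S ≠ T ∧ F = S ∩ T

/-- `ν` selects a unit normal `n_F` (of either sign) on every interior face. -/
def IsFaceNormal (𝒯 : Mesh d) (Ω : Set (E d)) (ν : Finset (E d) → E d) : Prop :=
  ∀ F ∈ 𝒯.interiorFaces Ω, ‖ν F‖ = 1 ∧ ∀ x ∈ F, ∀ y ∈ F, ⟪ν F, x - y⟫ = 0

/-! ### The broken polynomial space -/

/-- `V_h = ⊕_{T ∈ 𝒯_h} ℙ_p(T)`, with polynomials of total degree at most `p`. -/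
abbrev DGSpace (𝒯 : Mesh d) (Ω : Set (E d)) (p : ℕ) : Type :=
  ∀ _ : 𝒯.active Ω, MvPolynomial.restrictTotalDegree (Fin d) ℝ p

variable {𝒯 : Mesh d} {Ω : Set (E d)} {p : ℕ}

/-- The polynomial `v|_T` as a function. -/
def DGSpace.onElement (v : DGSpace 𝒯 Ω p) (T : 𝒯.active Ω) (x : E d) : ℝ :=
  MvPolynomial.eval (fun i => x i) (v T : MvPolynomial (Fin d) ℝ)

/-- The discontinuous function `v`, equal to `v|_T` inside each active element `T` (and `0`
elsewhere, in particular on the mesh skeleton, where `v` has no value of its own). -/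
def DGSpace.toFun (v : DGSpace 𝒯 Ω p) (x : E d) : ℝ :=
  ∑ T : 𝒯.active Ω, (interior (simplex (T : Finset (E d)))).indicator (v.onElement T) x

/-- One-sided trace `lim_{t → 0⁺} w(x - t n)`. -/
def sideTrace (w : E d → ℝ) (n x : E d) : ℝ :=
  limUnder (𝓝[>] (0 : ℝ)) fun t => w (x - t • n)

/-- Trace of `v` on `Γ`, taken from inside `Ω`. -/
def DGSpace.bdryTrace (v : DGSpace 𝒯 Ω p) (x : E d) : ℝ :=
  sideTrace v.toFun (outerNormal Ω x) x

/-- The jump `⟦v⟧ = v⁺ - v⁻` across a face with normal `n`, where `v^±(x) = lim v(x ∓ t n)`. -/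
def DGSpace.jump (v : DGSpace 𝒯 Ω p) (n x : E d) : ℝ :=
  sideTrace v.toFun n x - sideTrace v.toFun (-n) x

/-- The average `{v} = (v⁺ + v⁻) / 2` across a face with normal `n`. -/
def DGSpace.avg (v : DGSpace 𝒯 Ω p) (n x : E d) : ℝ :=
  (sideTrace v.toFun n x + sideTrace v.toFun (-n) x) / 2

/-! ### Discrete forms and norms -/

/-- The inflow boundary `Γ⁻ = {x ∈ Γ | b · n_Γ < 0}`. -/
def inflow (Ω : Set (E d)) (b : E d → E d) : Set (E d) :=
  {x ∈ frontier Ω | ⟪b x, outerNormal Ω x⟫ < 0}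

/-- The upwind discontinuous Galerkin form
`a_h(v,w) = (b·∇v + cv, w)_{𝒯_h∩Ω} - (b·n v, w)_{Γ⁻} - (b·n ⟦v⟧, {w})_{ℱ_h∩Ω}
  + ½ (|b·n| ⟦v⟧, ⟦w⟧)_{ℱ_h∩Ω}`. -/
def aForm (b : E d → E d) (c : E d → ℝ) (ν : Finset (E d) → E d) (v w : DGSpace 𝒯 Ω p) : ℝ :=
  (∑ T : 𝒯.active Ω, ∫ x in simplex (T : Finset (E d)) ∩ Ω,
      (⟪b x, gradient (v.onElement T) x⟫ + c x * v.onElement T x) * w.onElement T x)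
  - (∫ x in inflow Ω b, ⟪b x, outerNormal Ω x⟫ * v.bdryTrace x * w.bdryTrace x ∂μHE[d - 1])
  - (∑ F ∈ 𝒯.interiorFaces Ω, ∫ x in simplex F ∩ Ω,
      ⟪b x, ν F⟫ * v.jump (ν F) x * w.avg (ν F) x ∂μHE[d - 1])
  + 1 / 2 * ∑ F ∈ 𝒯.interiorFaces Ω, ∫ x in simplex F ∩ Ω,
      |⟪b x, ν F⟫| * v.jump (ν F) x * w.jump (ν F) x ∂μHE[d - 1]

/-- The square of the upwind norm,
`|||v|||_up² = τ_c⁻¹ ‖v‖_Ω² + ½ ‖|b·n|^{1/2} v‖_Γ² + ½ ‖|b·n|^{1/2} ⟦v⟧‖_{ℱ_h∩Ω}²`. -/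
def upNormSq (b : E d → E d) (Db : E d → E d →L[ℝ] E d) (c : E d → ℝ) (ν : Finset (E d) → E d)
    (v : DGSpace 𝒯 Ω p) : ℝ :=
  (tauC Ω Db c)⁻¹ * (∫ x in Ω, v.toFun x ^ 2)
  + 1 / 2 * (∫ x in frontier Ω, |⟪b x, outerNormal Ω x⟫| * v.bdryTrace x ^ 2 ∂μHE[d - 1])
  + 1 / 2 * ∑ F ∈ 𝒯.interiorFaces Ω, ∫ x in simplex F ∩ Ω,
      |⟪b x, ν F⟫| * v.jump (ν F) x ^ 2 ∂μHE[d - 1]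

/-- `A_h = a_h + g_h` with the ghost penalty `g_h = g_c + g_b`. -/
def AForm (b : E d → E d) (c : E d → ℝ) (ν : Finset (E d) → E d)
    (gc gb : LinearMap.BilinForm ℝ (DGSpace 𝒯 Ω p)) (v w : DGSpace 𝒯 Ω p) : ℝ :=
  aForm b c ν v w + (gc v w + gb v w)

/-- `|||v|||_{up,h}² = |||v|||_up² + |v|_{g_h}²`, where `|v|_{g_h}² = g_h(v,v)`. -/
def upNormHSq (b : E d → E d) (Db : E d → E d →L[ℝ] E d) (c : E d → ℝ) (ν : Finset (E d) → E d)
    (gc gb : LinearMap.BilinForm ℝ (DGSpace 𝒯 Ω p)) (v : DGSpace 𝒯 Ω p) : ℝ :=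
  upNormSq b Db c ν v + (gc v v + gb v v)

end

end CutDG

/-!
Coercivity rests on the energy identity (`CutDG.DGSpace.aForm_self`)

  `a_h(v, v) = ∫_Ω (c - ½ div b) v² + ½ ∫_Γ |b · n| v² + ½ ∑_F ∫_{F ∩ Ω} |b · n| ⟦v⟧²`.

Its first term is at least `c₀ ‖v‖²`, and the other two occur in the upwind norm. Since
`|div b| ≤ d |Db|`, one has `c₀ ≤ d τ_c⁻¹` (`CutDG.c0_le`), so that the constant `C = d` works. The
ghost penalty is nonnegative and enters both sides in the same way.

The energy identity is the divergence theorem for the broken vector field `v² b` on the cut elements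
`T ∩ Ω` (`CutDG.DGSpace.sum_integral_divergence`). The pieces `T ∩ Ω` need not be Lipschitz
domains, because `Γ` may cut the mesh in an arbitrary way, and `b` is differentiable only weakly. The
theorem is therefore proved for all elements at once, by slicing along the lines parallel to each
coordinate axis `i`:

* On almost every line the field `v² b_i` is, between the skeleton of the mesh and `Γ`, a primitive
  of its weak derivative (`CutDG.HasWeakPartial.ae_line`); the integral of the derivative over the
  line is then the sum of the jumps (`CutDG.integral_eq_finsum_jumps`,
  `CutDG.DGSpace.integral_line_eq`).
* The integral over all lines of a sum over intersection points with a hypersurface is the integral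
  over the hypersurface against `|n_i|` (`CutDG.IsTangentSurface.coarea`). This turns the jumps into
  the integrals of `b_i n_i v²` over `Γ` and of `b_i n_i (v₊² - v₋²)` over the faces
  (`CutDG.DGSpace.sum_integral_sqDeriv`).

The jumps are identified at generic points only. Generic lines avoid the faces of codimension two
(`CutDG.Mesh.euclideanHausdorffMeasure_lowSkeleton`), the singular part of `Γ`, and the set where a
facet crosses `Γ` transversally (`CutDG.Mesh.euclideanHausdorffMeasure_crossing`), as these sets
have zero `(d-1)`-dimensional measure. At all other points of `Γ` a single element fills the inner
side (`CutDG.Mesh.exists_active_of_mem_regularBoundary`), and at all other points of a face there is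
one element on each side (`CutDG.Mesh.exists_elements_of_mem_face`), so the one-sided traces are
polynomial values.
-/

namespace CutDG

noncomputable section

variable {n : ℕ}

/-! ### Lines parallel to a coordinate axis -/

/-- The `i`-th coordinate unit vector. -/
abbrev unitVec (i : Fin (n + 1)) : E (n + 1) := EuclideanSpace.single i (1 : ℝ)

/-- The orthogonal projection along the `i`-th coordinate axis, dropping the `i`-th coordinate. -/
def dropCoord (i : Fin (n + 1)) : E (n + 1) →L[ℝ] E n :=
  LinearMap.toContinuousLinearMap
    { toFun := fun x => WithLp.toLp 2 fun j => x (i.succAbove j)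
      map_add' := fun x y => by ext j; simp
      map_smul' := fun c x => by ext j; simp }

/-- The point with `i`-th coordinate `t` and remaining coordinates `y`. For fixed `y` it
parametrises a line parallel to the `i`-th coordinate axis. -/
def linePoint (i : Fin (n + 1)) (y : E n) (t : ℝ) : E (n + 1) :=
  WithLp.toLp 2 (i.insertNth (α := fun _ => ℝ) t fun j => y j)

@[simp] lemma dropCoord_apply (i : Fin (n + 1)) (x : E (n + 1)) (j : Fin n) :
    dropCoord i x j = x (i.succAbove j) := rfl

@[simp] lemma linePoint_same (i : Fin (n + 1)) (y : E n) (t : ℝ) : linePoint i y t i = t := by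
  simp [linePoint]

@[simp] lemma linePoint_succAbove (i : Fin (n + 1)) (y : E n) (t : ℝ) (j : Fin n) :
    linePoint i y t (i.succAbove j) = y j := by
  simp [linePoint]

@[simp] lemma linePoint_zero_succ (y : E n) (t : ℝ) (j : Fin n) :
    linePoint 0 y t j.succ = y j :=
  linePoint_succAbove 0 y t j

@[simp] lemma dropCoord_linePoint (i : Fin (n + 1)) (y : E n) (t : ℝ) :
    dropCoord i (linePoint i y t) = y := by
  ext j; simp

@[simp] lemma linePoint_dropCoord (i : Fin (n + 1)) (x : E (n + 1)) :
    linePoint i (dropCoord i x) (x i) = x := by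
  ext k
  rcases Fin.eq_self_or_eq_succAbove i k with rfl | ⟨j, rfl⟩ <;> simp

lemma inner_unitVec (x : E (n + 1)) (i : Fin (n + 1)) : ⟪x, unitVec i⟫ = x i := by
  simp [unitVec, EuclideanSpace.inner_single_right]

lemma linePoint_add (i : Fin (n + 1)) (y : E n) (t s : ℝ) :
    linePoint i y (t + s) = linePoint i y t + s • unitVec i := by
  ext k
  rcases Fin.eq_self_or_eq_succAbove i k with rfl | ⟨j, rfl⟩
  · simp
  · simp [Fin.succAbove_ne]

lemma linePoint_eq (i : Fin (n + 1)) (y : E n) (t : ℝ) :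
    linePoint i y t = linePoint i y 0 + t • unitVec i := by
  rw [← linePoint_add, zero_add]

lemma continuous_linePoint_prod (i : Fin (n + 1)) :
    Continuous fun p : ℝ × E n => linePoint i p.2 p.1 := by
  unfold linePoint
  refine (PiLp.continuous_toLp 2 _).comp ?_
  refine continuous_pi fun k => ?_
  rcases Fin.eq_self_or_eq_succAbove i k with rfl | ⟨j, rfl⟩
  · simpa using continuous_fst
  · simp only [Fin.insertNth_apply_succAbove]
    fun_prop

lemma continuous_linePoint (i : Fin (n + 1)) (y : E n) : Continuous (linePoint i y) :=
  (continuous_linePoint_prod i).comp (by fun_prop : Continuous fun t : ℝ => (t, y))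

lemma norm_sq_eq_dropCoord (i : Fin (n + 1)) (x : E (n + 1)) :
    ‖x‖ ^ 2 = x i ^ 2 + ‖dropCoord i x‖ ^ 2 := by
  rw [EuclideanSpace.norm_sq_eq, EuclideanSpace.norm_sq_eq, Fin.sum_univ_succAbove _ i]
  simp

lemma norm_dropCoord_le (i : Fin (n + 1)) (x : E (n + 1)) : ‖dropCoord i x‖ ≤ ‖x‖ := by
  have := norm_sq_eq_dropCoord i x
  refine abs_le_of_sq_le_sq' ?_ (norm_nonneg _) |>.2
  nlinarith [sq_nonneg (x i)]

lemma lipschitzWith_dropCoord (i : Fin (n + 1)) : LipschitzWith 1 (dropCoord i) :=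
  LipschitzWith.of_dist_le_mul fun x y => by
    rw [dist_eq_norm, dist_eq_norm, ← map_sub]
    simpa using norm_dropCoord_le i (x - y)

/-- Fubini coordinates along the `i`-th axis preserve volume. -/
lemma measurePreserving_linePoint (i : Fin (n + 1)) :
    MeasurePreserving (fun p : ℝ × E n => linePoint i p.2 p.1) (volume.prod volume) volume := by
  have h1 : MeasurePreserving (fun p : ℝ × E n => (p.1, WithLp.ofLp p.2))
      (volume.prod volume) (volume.prod volume) :=
    (MeasurePreserving.id _).prod (PiLp.volume_preserving_ofLp (Fin n))
  have h2 := (volume_preserving_piFinSuccAbove (fun _ : Fin (n + 1) => ℝ) i).symm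
  exact (PiLp.volume_preserving_toLp (Fin (n + 1))).comp (h2.comp h1)

lemma measurableEmbedding_linePoint (i : Fin (n + 1)) :
    MeasurableEmbedding (fun p : ℝ × E n => linePoint i p.2 p.1) := by
  refine (continuous_linePoint_prod i).measurableEmbedding fun p q h => ?_
  have h1 := congrArg (dropCoord i) h
  have h2 := congrArg (fun x : E (n + 1) => x i) h
  simp only [dropCoord_linePoint, linePoint_same] at h1 h2
  exact Prod.ext h2 h1

section

/-! ### Hypersurfaces and the area formula for coordinate projections -/

open scoped NNReal

lemma euclideanHausdorffMeasure_image_le_of_lipschitzOnWith {X Y : Type*} [EMetricSpace X]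
    [MeasurableSpace X] [BorelSpace X] [EMetricSpace Y] [MeasurableSpace Y] [BorelSpace Y]
    {K : ℝ≥0} {f : X → Y} {s : Set X} (h : LipschitzOnWith K f s) (m : ℕ) :
    μHE[m] (f '' s) ≤ (K : ℝ≥0∞) ^ m * μHE[m] s := by
  simp_rw [Measure.euclideanHausdorffMeasure_def, Measure.smul_apply]
  rw [mul_smul_comm]
  have := h.hausdorffMeasure_image_le (d := (m : ℝ)) (by positivity)
  rw [ENNReal.rpow_natCast] at this
  gcongr

/-- A frame adapted to a unit vector `u`: the tangential part `p`, the embedding `ι` of the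
parameter space onto `uᗮ`, and the Jacobian of the coordinate projection restricted to `uᗮ`. -/
lemma exists_adapted_frame (u : E (n + 1)) (hu : ‖u‖ = 1) (i : Fin (n + 1)) :
    ∃ (p : E (n + 1) →L[ℝ] E n) (ι : E n →L[ℝ] E (n + 1)),
      (∀ x, x = ⟪u, x⟫ • u + ι (p x)) ∧ (∀ x, ‖x‖ ^ 2 = ⟪u, x⟫ ^ 2 + ‖p x‖ ^ 2) ∧
      |((dropCoord i).comp ι).det| = |u i| := by
  obtain ⟨B, hB⟩ : ∃ B : OrthonormalBasis (Fin (n + 1)) ℝ (E (n + 1)), B 0 = u := by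
    have hv : Orthonormal ℝ (({0} : Set (Fin (n + 1))).domRestrict fun _ => u) := by
      refine ⟨fun _ => hu, fun a b hab => ?_⟩
      exact absurd (Subtype.ext (a.2.trans b.2.symm)) hab
    obtain ⟨B, hB⟩ := hv.exists_orthonormalBasis_extension_of_card_eq (by simp)
    exact ⟨B, hB 0 rfl⟩
  let L : E n →L[ℝ] E (n + 1) := LinearMap.toContinuousLinearMap
    { toFun := fun y => linePoint 0 y 0
      map_add' := fun x y => by
        ext k
        rcases Fin.eq_self_or_eq_succAbove 0 k with rfl | ⟨j, rfl⟩ <;> simp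
      map_smul' := fun c y => by
        ext k
        rcases Fin.eq_self_or_eq_succAbove 0 k with rfl | ⟨j, rfl⟩ <;> simp }
  have hL : ∀ y, L y = linePoint 0 y 0 := fun y => rfl
  let R := B.repr.toContinuousLinearEquiv
  refine ⟨(dropCoord 0).comp (R : E (n + 1) →L[ℝ] E (n + 1)),
    (R.symm : E (n + 1) →L[ℝ] E (n + 1)).comp L, ?_, ?_, ?_⟩
  · intro x
    apply B.repr.injective
    have h0 : B.repr u = unitVec 0 := by rw [← hB]; simp
    ext k
    have h1 : B.repr (((R.symm : E (n + 1) →L[ℝ] E (n + 1)).comp L)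
        (((dropCoord 0).comp (R : E (n + 1) →L[ℝ] E (n + 1))) x))
        = linePoint 0 (dropCoord 0 (B.repr x)) 0 := by
      exact B.repr.apply_symm_apply _
    rw [map_add, h1, map_smul, h0]
    rcases Fin.eq_self_or_eq_succAbove 0 k with rfl | ⟨j, rfl⟩
    · simp [B.repr_apply_apply, hB]
    · simp
  · intro x
    rw [← B.repr.norm_map x, norm_sq_eq_dropCoord 0, B.repr_apply_apply, hB]
    rfl
  -- the Jacobian is a minor of an orthogonal matrix, hence up to sign an entry of that matrix
  · let Q : Matrix (Fin (n + 1)) (Fin (n + 1)) ℝ := Matrix.of fun a b => B b a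
    have hQ : Q.transpose * Q = 1 := by
      ext a b
      rw [Matrix.mul_apply]
      have := (orthonormal_iff_ite.mp B.orthonormal) a b
      rw [PiLp.inner_apply] at this
      simp only [Matrix.transpose_apply, Matrix.one_apply, ← this]
      exact Finset.sum_congr rfl fun k _ => by simp [Q, mul_comm]
    have hdet : |Q.det| = 1 := by
      have := congrArg Matrix.det hQ
      rw [Matrix.det_mul, Matrix.det_transpose, Matrix.det_one] at this
      have h2 : |Q.det| * |Q.det| = 1 := by rw [abs_mul_abs_self, this]
      nlinarith [abs_nonneg Q.det]
    have hadj : Q.adjugate = Q.det • Q.transpose := by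
      calc Q.adjugate = (Q.transpose * Q) * Q.adjugate := by rw [hQ, one_mul]
        _ = Q.transpose * (Q * Q.adjugate) := by rw [Matrix.mul_assoc]
        _ = Q.det • Q.transpose := by rw [Matrix.mul_adjugate]; simp
    have hA : LinearMap.toMatrix (EuclideanSpace.basisFun (Fin n) ℝ).toBasis
        (EuclideanSpace.basisFun (Fin n) ℝ).toBasis
        (((dropCoord i).comp ((R.symm : E (n + 1) →L[ℝ] E (n + 1)).comp L) : E n →L[ℝ] E n) :
          E n →ₗ[ℝ] E n) = Q.submatrix i.succAbove (0 : Fin (n + 1)).succAbove := by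
      ext a b
      rw [LinearMap.toMatrix_apply]
      have h3 : L (EuclideanSpace.single b 1) = EuclideanSpace.single (b.succ) 1 := by
        rw [hL]
        ext k
        rcases Fin.eq_self_or_eq_succAbove 0 k with rfl | ⟨j, rfl⟩
        · simp
        · rw [linePoint_succAbove]
          simp
      simp only [OrthonormalBasis.coe_toBasis, EuclideanSpace.basisFun_apply,
        OrthonormalBasis.coe_toBasis_repr_apply, EuclideanSpace.basisFun_repr,
        ContinuousLinearMap.coe_coe, ContinuousLinearMap.comp_apply, h3, dropCoord_apply]
      have h4 : (R.symm : E (n + 1) →L[ℝ] E (n + 1)) (EuclideanSpace.single b.succ 1)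
          = B b.succ := B.repr_symm_single b.succ
      rw [h4]
      simp [Q]
    have h5 := Matrix.adjugate_fin_succ_eq_det_submatrix Q 0 i
    rw [hadj] at h5
    have h6 : |(Q.submatrix i.succAbove (0 : Fin (n + 1)).succAbove).det| = |u i| := by
      have h7 := congrArg abs h5
      rw [abs_mul, abs_pow, abs_neg, abs_one, one_pow, one_mul] at h7
      rw [← h7, Matrix.smul_apply, smul_eq_mul, abs_mul, hdet, one_mul, Matrix.transpose_apply]
      simp [Q, hB]
    rw [← h6, ← hA, LinearMap.det_toMatrix]

/-- A hypersurface with continuous unit normal field `N`, encoded by strict tangency: near each of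
its points all chords are almost orthogonal to the normal. -/
structure IsTangentSurface (M : Set (E (n + 1))) (N : E (n + 1) → E (n + 1)) : Prop where
  measurableSet : MeasurableSet M
  norm_eq_one : ∀ x ∈ M, ‖N x‖ = 1
  continuousOn : ContinuousOn N M
  tangent : ∀ x₀ ∈ M, ∀ δ > 0, ∃ r > 0, ∀ x ∈ M ∩ Metric.ball x₀ r, ∀ y ∈ M ∩ Metric.ball x₀ r,
    |⟪N x₀, x - y⟫| ≤ δ * ‖x - y‖

/-- Near a point of a hypersurface, the coordinate projection changes areas by a factor close to
the modulus of the corresponding component of the normal. -/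
lemma IsTangentSurface.area_local {M : Set (E (n + 1))} {N : E (n + 1) → E (n + 1)}
    (hM : IsTangentSurface M N) (i : Fin (n + 1)) {x₀ : E (n + 1)} (hx₀ : x₀ ∈ M) {ε : ℝ≥0}
    (hε : 0 < ε) :
    ∃ r > 0, ∀ S ⊆ M ∩ Metric.ball x₀ r,
      volume (dropCoord i '' S) ≤ (‖N x₀ i‖ₑ + ε) * μHE[n] S ∧
      ‖N x₀ i‖ₑ * μHE[n] S ≤ volume (dropCoord i '' S) + ε * μHE[n] S := by
  obtain ⟨p, ι, hdec, hnorm, hdet⟩ := exists_adapted_frame (N x₀) (hM.norm_eq_one x₀ hx₀) i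
  set A := (dropCoord i).comp ι with hA
  set a : ℝ≥0 := ‖N x₀ i‖₊ with ha
  have hAa : ENNReal.ofReal |A.det| = a := by
    rw [hdet, ← Real.norm_eq_abs, ofReal_norm]; rfl
  have ea : ‖N x₀ i‖ₑ = a := rfl
  -- the tolerance for the linear approximation
  have hup := addHaar_image_le_mul_of_det_lt (volume : Measure (E n)) A (m := a + ε)
    (by rw [hAa]; exact_mod_cast lt_add_of_pos_right a hε)
  have hlo : ∀ᶠ δ in 𝓝[>] (0 : ℝ≥0), ∀ (s : Set (E n)) (f : E n → E n),
      ApproximatesLinearOn f A s δ → ((a - ε / 2 : ℝ≥0) : ℝ≥0∞) * volume s ≤ volume (f '' s) := by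
    by_cases h : ε / 2 < a
    · refine mul_le_addHaar_image_of_lt_det (volume : Measure (E n)) A (m := a - ε / 2) ?_
      rw [hAa]
      exact_mod_cast tsub_lt_self (lt_trans (half_pos hε) h) (half_pos hε)
    · refine Eventually.of_forall fun δ s f _ => ?_
      rw [tsub_eq_zero_of_le (not_lt.mp h)]
      simp
  obtain ⟨δ₀, ⟨hδu, hδl⟩, hδ₀⟩ := ((hup.and hlo).and self_mem_nhdsWithin).exists
  -- the tangential projection is `(1 - δ)⁻¹`-antilipschitz on chords of slope `δ`
  have hK : ∃ δ : ℝ, 0 < δ ∧ δ < 1 ∧ δ * (1 - δ)⁻¹ ≤ δ₀ ∧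
      ((a - ε : ℝ≥0) : ℝ) * (1 - δ)⁻¹ ^ n ≤ ((a - ε / 2 : ℝ≥0) : ℝ) := by
    have hc : ContinuousAt (fun δ : ℝ => (1 - δ)⁻¹) 0 := by
      apply ContinuousAt.inv₀ (by fun_prop); norm_num
    have e1 : ∀ᶠ δ in 𝓝[>] (0 : ℝ), δ * (1 - δ)⁻¹ < (δ₀ : ℝ) := by
      have : ContinuousAt (fun δ : ℝ => δ * (1 - δ)⁻¹) 0 := continuousAt_id.mul hc
      refine nhdsWithin_le_nhds (this.eventually_lt continuousAt_const ?_)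
      simpa using hδ₀
    have e2 : ∀ᶠ δ in 𝓝[>] (0 : ℝ),
        ((a - ε : ℝ≥0) : ℝ) * (1 - δ)⁻¹ ^ n ≤ ((a - ε / 2 : ℝ≥0) : ℝ) := by
      by_cases h : a ≤ ε
      · refine Eventually.of_forall fun δ => ?_
        rw [tsub_eq_zero_of_le h]
        simp
      · have : ContinuousAt (fun δ : ℝ => ((a - ε : ℝ≥0) : ℝ) * (1 - δ)⁻¹ ^ n) 0 :=
          continuousAt_const.mul (hc.pow n)
        have h2 := this.eventually_lt (continuousAt_const (y := ((a - ε / 2 : ℝ≥0) : ℝ))) ?_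
        · exact Eventually.mono (nhdsWithin_le_nhds h2) fun δ h => h.le
        · have h3 : ε ≤ a := (not_le.mp h).le
          have h4 : ε / 2 ≤ a := (half_le_self (zero_le)).trans h3
          rw [NNReal.coe_sub h3, NNReal.coe_sub h4]
          have : (0 : ℝ) < ε := hε
          push_cast
          simp
          linarith
    have e3 : ∀ᶠ δ in 𝓝[>] (0 : ℝ), δ < 1 := nhdsWithin_le_nhds (eventually_lt_nhds one_pos)
    obtain ⟨δ, ⟨⟨h1, h2⟩, h3⟩, h4⟩ := (((e1.and e2).and e3).and self_mem_nhdsWithin).exists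
    exact ⟨δ, h4, h3, h1.le, h2⟩
  obtain ⟨δ, hδ, hδ1, hδa, hδb⟩ := hK
  obtain ⟨r, hr, htan⟩ := hM.tangent x₀ hx₀ δ hδ
  refine ⟨r, hr, fun S hS => ?_⟩
  have hK0 : (0 : ℝ) < 1 - δ := by linarith
  let K : ℝ≥0 := ⟨(1 - δ)⁻¹, (inv_pos.mpr hK0).le⟩
  have hanti : ∀ x ∈ S, ∀ y ∈ S, ‖x - y‖ ≤ K * ‖p x - p y‖ := by
    intro x hx y hy
    have h1 := htan x (hS hx) y (hS hy)
    have h2 := hnorm (x - y)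
    rw [map_sub] at h2
    have h3 : ‖x - y‖ ≤ |⟪N x₀, x - y⟫| + ‖p x - p y‖ := by
      refine abs_le_of_sq_le_sq' ?_ (by positivity) |>.2
      rw [h2, ← sq_abs ⟪N x₀, x - y⟫]
      nlinarith [abs_nonneg ⟪N x₀, x - y⟫, norm_nonneg (p x - p y)]
    change _ ≤ (1 - δ)⁻¹ * _
    rw [← div_eq_inv_mul, le_div_iff₀ hK0]
    nlinarith
  have hinj : Set.InjOn p S := by
    intro x hx y hy hxy
    have := hanti x hx y hy
    rw [hxy, sub_self, norm_zero, mul_zero] at this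
    exact sub_eq_zero.mp (norm_le_zero_iff.mp this)
  let g : E n → E (n + 1) := Function.invFunOn p S
  have hg : ∀ x ∈ S, g (p x) = x := fun x hx => hinj.leftInvOn_invFunOn hx
  -- parametrised by its tangential part, `S` is projected by `dropCoord i ∘ g`, a map close to `A`
  have himg : (dropCoord i ∘ g) '' (p '' S) = dropCoord i '' S := by
    rw [← Set.image_comp]
    exact Set.image_congr fun x hx => by simp [hg x hx]
  have happ : ApproximatesLinearOn (dropCoord i ∘ g) A (p '' S) δ₀ := by
    rintro _ ⟨x, hx, rfl⟩ _ ⟨y, hy, rfl⟩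
    simp only [Function.comp_apply, hg x hx, hg y hy]
    have h1 : dropCoord i x - dropCoord i y - A (p x - p y)
        = ⟪N x₀, x - y⟫ • dropCoord i (N x₀) := by
      rw [← map_sub, ← map_sub]
      conv_lhs => rw [hdec (x - y)]
      rw [map_add, map_smul, hA, ContinuousLinearMap.comp_apply]
      rw [← hdec (x - y)]
      abel
    rw [h1, norm_smul, Real.norm_eq_abs]
    have h2 : ‖dropCoord i (N x₀)‖ ≤ 1 :=
      (norm_dropCoord_le i _).trans (hM.norm_eq_one x₀ hx₀).le
    calc |⟪N x₀, x - y⟫| * ‖dropCoord i (N x₀)‖ ≤ |⟪N x₀, x - y⟫| * 1 := by gcongr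
      _ ≤ δ * ‖x - y‖ := by rw [mul_one]; exact htan x (hS hx) y (hS hy)
      _ ≤ δ * (K * ‖p x - p y‖) := by gcongr; exact hanti x hx y hy
      _ = (δ * (1 - δ)⁻¹) * ‖p x - p y‖ := by rw [← mul_assoc]; rfl
      _ ≤ δ₀ * ‖p x - p y‖ := by gcongr
  have hu := hδu _ _ happ
  have hl := hδl _ _ happ
  rw [himg] at hu hl
  have hp1 : volume (p '' S) ≤ μHE[n] S := by
    have hLip : LipschitzOnWith 1 p S := by
      refine LipschitzOnWith.of_dist_le_mul fun x _ y _ => ?_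
      rw [dist_eq_norm, dist_eq_norm, ← map_sub, NNReal.coe_one, one_mul]
      refine abs_le_of_sq_le_sq' ?_ (norm_nonneg _) |>.2
      nlinarith [hnorm (x - y), sq_nonneg ⟪N x₀, x - y⟫]
    have := euclideanHausdorffMeasure_image_le_of_lipschitzOnWith hLip n
    rwa [EuclideanSpace.euclideanHausdorffMeasure_eq_volume, ENNReal.coe_one, one_pow,
      one_mul] at this
  have hp2 : μHE[n] S ≤ (K : ℝ≥0∞) ^ n * volume (p '' S) := by
    have hLip : LipschitzOnWith K g (p '' S) := by
      refine LipschitzOnWith.of_dist_le_mul ?_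
      rintro _ ⟨x, hx, rfl⟩ _ ⟨y, hy, rfl⟩
      rw [dist_eq_norm, dist_eq_norm, hg x hx, hg y hy]
      exact hanti x hx y hy
    have := euclideanHausdorffMeasure_image_le_of_lipschitzOnWith hLip n
    rw [EuclideanSpace.euclideanHausdorffMeasure_eq_volume, ← Set.image_comp] at this
    rwa [Set.image_congr (g := id) (fun x hx => by simp [hg x hx]), Set.image_id] at this
  rw [ea]
  refine ⟨hu.trans ?_, ?_⟩
  · rw [ENNReal.coe_add]
    gcongr
  · have h1 : ((a - ε : ℝ≥0) : ℝ≥0∞) * μHE[n] S ≤ volume (dropCoord i '' S) := by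
      refine le_trans ?_ hl
      calc ((a - ε : ℝ≥0) : ℝ≥0∞) * μHE[n] S
          ≤ ((a - ε : ℝ≥0) : ℝ≥0∞) * ((K : ℝ≥0∞) ^ n * volume (p '' S)) := by gcongr
        _ = (((a - ε) * K ^ n : ℝ≥0) : ℝ≥0∞) * volume (p '' S) := by
            rw [← mul_assoc]; push_cast; rfl
        _ ≤ ((a - ε / 2 : ℝ≥0) : ℝ≥0∞) * volume (p '' S) := by
            gcongr
            exact_mod_cast hδb
    calc (a : ℝ≥0∞) * μHE[n] S ≤ ((a - ε : ℝ≥0) + ε : ℝ≥0∞) * μHE[n] S := by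
          gcongr
          exact_mod_cast le_tsub_add
      _ = ((a - ε : ℝ≥0) : ℝ≥0∞) * μHE[n] S + ε * μHE[n] S := add_mul _ _ _
      _ ≤ _ := by gcongr

end

section

open scoped NNReal

/-- A set locally covered by balls of a class closed under subsets is covered by countably many
pairwise disjoint Borel members of that class. -/
lemma exists_disjoint_cover {X : Type*} [PseudoMetricSpace X] [SecondCountableTopology X]
    [MeasurableSpace X] [BorelSpace X] {M : Set X} {Q : Set X → Prop} (hQ0 : Q ∅)
    (hQ : ∀ s t, s ⊆ t → Q t → Q s) (h : ∀ x ∈ M, ∃ r > 0, Q (Metric.ball x r)) :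
    ∃ D : ℕ → Set X, Pairwise (Function.onFun Disjoint D) ∧ (∀ k, MeasurableSet (D k)) ∧
      M ⊆ ⋃ k, D k ∧ ∀ k, Q (D k) := by
  choose! r hr hQr using h
  obtain ⟨t, htM, htc, hcov⟩ := TopologicalSpace.countable_cover_nhdsWithin (s := M)
    (f := fun x => Metric.ball x (r x))
    fun x hx => mem_nhdsWithin_of_mem_nhds (Metric.ball_mem_nhds x (hr x hx))
  rcases t.eq_empty_or_nonempty with rfl | hne
  · exact ⟨fun _ => ∅, fun _ _ _ => by simp [Function.onFun], fun _ => .empty,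
      by simpa using hcov, fun _ => hQ0⟩
  · obtain ⟨u, rfl⟩ := htc.exists_eq_range hne
    refine ⟨disjointed fun k => Metric.ball (u k) (r (u k)), disjoint_disjointed _,
      fun k => MeasurableSet.disjointed (fun _ => measurableSet_ball) k, ?_, fun k => ?_⟩
    · rw [iUnion_disjointed]
      simpa using hcov
    · exact hQ _ _ (disjointed_subset _ _) (hQr _ (htM ⟨k, rfl⟩))

variable {M : Set (E (n + 1))} {N : E (n + 1) → E (n + 1)}

lemma IsTangentSurface.continuousOn_apply (hM : IsTangentSurface M N) (i : Fin (n + 1)) :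
    ContinuousOn (fun x => N x i) M :=
  (EuclideanSpace.proj i : E (n + 1) →L[ℝ] ℝ).continuous.comp_continuousOn hM.continuousOn

/-- The local comparison of areas, with the normal evaluated at the running point. -/
lemma IsTangentSurface.area_local_lintegral (hM : IsTangentSurface M N) (i : Fin (n + 1))
    {ε : ℝ≥0} (hε : 0 < ε) {x₀ : E (n + 1)} (hx₀ : x₀ ∈ M) :
    ∃ r > 0, ∀ S ⊆ M ∩ Metric.ball x₀ r, MeasurableSet S →
      volume (dropCoord i '' S) ≤ (∫⁻ x in S, ‖N x i‖ₑ ∂μHE[n]) + ε * μHE[n] S ∧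
      ∫⁻ x in S, ‖N x i‖ₑ ∂μHE[n] ≤ volume (dropCoord i '' S) + ε * μHE[n] S := by
  obtain ⟨r₁, hr₁, h₁⟩ := hM.area_local i hx₀ (half_pos hε)
  obtain ⟨r₂, hr₂, h₂⟩ := Metric.continuousOn_iff.mp (hM.continuousOn_apply i) x₀ hx₀ (ε / 2)
    (half_pos (NNReal.coe_pos.mpr hε))
  have hclose : ∀ x ∈ M ∩ Metric.ball x₀ r₂, ‖N x i‖ₑ ≤ ‖N x₀ i‖ₑ + (ε / 2 : ℝ≥0) ∧
      ‖N x₀ i‖ₑ ≤ ‖N x i‖ₑ + (ε / 2 : ℝ≥0) := by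
    rintro x ⟨hx, hxr⟩
    have h := (h₂ x hx hxr).le
    rw [dist_eq_norm] at h
    have a1 : ‖N x i‖₊ ≤ ‖N x₀ i‖₊ + ε / 2 := by
      have : ‖N x i‖ ≤ ‖N x₀ i‖ + ε / 2 :=
        (norm_le_norm_add_norm_sub' _ _).trans (by gcongr)
      exact_mod_cast this
    have a2 : ‖N x₀ i‖₊ ≤ ‖N x i‖₊ + ε / 2 := by
      have : ‖N x₀ i‖ ≤ ‖N x i‖ + ε / 2 := by
        exact (norm_le_norm_add_norm_sub (N x i) (N x₀ i)).trans (by gcongr)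
      exact_mod_cast this
    rw [enorm_eq_nnnorm, enorm_eq_nnnorm]
    exact ⟨by exact_mod_cast a1, by exact_mod_cast a2⟩
  have hhalf : ((ε / 2 : ℝ≥0) : ℝ≥0∞) + (ε / 2 : ℝ≥0) = ε := by exact_mod_cast add_halves ε
  refine ⟨min r₁ r₂, lt_min hr₁ hr₂, fun S hS hSm => ?_⟩
  have hS1 : S ⊆ M ∩ Metric.ball x₀ r₁ := fun x hx =>
    ⟨(hS hx).1, Metric.ball_subset_ball (min_le_left _ _) (hS hx).2⟩
  have hS2 : S ⊆ M ∩ Metric.ball x₀ r₂ := fun x hx =>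
    ⟨(hS hx).1, Metric.ball_subset_ball (min_le_right _ _) (hS hx).2⟩
  obtain ⟨hu, hl⟩ := h₁ S hS1
  have hconst : ‖N x₀ i‖ₑ * μHE[n] S ≤
      (∫⁻ x in S, ‖N x i‖ₑ ∂μHE[n]) + (ε / 2 : ℝ≥0) * μHE[n] S := by
    calc ‖N x₀ i‖ₑ * μHE[n] S = ∫⁻ _ in S, ‖N x₀ i‖ₑ ∂μHE[n] := (setLIntegral_const _ _).symm
      _ ≤ ∫⁻ x in S, (‖N x i‖ₑ + (ε / 2 : ℝ≥0)) ∂μHE[n] :=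
          setLIntegral_mono' hSm fun x hx => (hclose x (hS2 hx)).2
      _ = _ := by rw [lintegral_add_right _ measurable_const, setLIntegral_const]
  have hconst' : ∫⁻ x in S, ‖N x i‖ₑ ∂μHE[n] ≤
      ‖N x₀ i‖ₑ * μHE[n] S + (ε / 2 : ℝ≥0) * μHE[n] S := by
    calc ∫⁻ x in S, ‖N x i‖ₑ ∂μHE[n] ≤ ∫⁻ _ in S, (‖N x₀ i‖ₑ + (ε / 2 : ℝ≥0)) ∂μHE[n] :=
          setLIntegral_mono' hSm fun x hx => (hclose x (hS2 hx)).1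
      _ = _ := by rw [setLIntegral_const, add_mul]
  constructor
  · calc volume (dropCoord i '' S) ≤ (‖N x₀ i‖ₑ + (ε / 2 : ℝ≥0)) * μHE[n] S := hu
      _ = ‖N x₀ i‖ₑ * μHE[n] S + (ε / 2 : ℝ≥0) * μHE[n] S := add_mul _ _ _
      _ ≤ (∫⁻ x in S, ‖N x i‖ₑ ∂μHE[n]) + (ε / 2 : ℝ≥0) * μHE[n] S
          + (ε / 2 : ℝ≥0) * μHE[n] S := by gcongr
      _ = _ := by rw [add_assoc, ← add_mul, hhalf]
  · calc ∫⁻ x in S, ‖N x i‖ₑ ∂μHE[n] ≤ ‖N x₀ i‖ₑ * μHE[n] S + (ε / 2 : ℝ≥0) * μHE[n] S := hconst'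
      _ ≤ (volume (dropCoord i '' S) + (ε / 2 : ℝ≥0) * μHE[n] S)
          + (ε / 2 : ℝ≥0) * μHE[n] S := by gcongr
      _ = _ := by rw [add_assoc, ← add_mul, hhalf]

/-- Splitting a piece of a hypersurface into small parts on which the projected area is, up to
`ε`, the integral of the normal component. -/
lemma IsTangentSurface.exists_area_partition (hM : IsTangentSurface M N) (i : Fin (n + 1))
    {ε : ℝ≥0} (hε : 0 < ε) {S : Set (E (n + 1))} (hS : S ⊆ M) (hSm : MeasurableSet S) :
    ∃ D : ℕ → Set (E (n + 1)), Pairwise (Function.onFun Disjoint D) ∧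
      (∀ k, MeasurableSet (D k)) ∧ S = ⋃ k, D k ∧ ∀ k,
      volume (dropCoord i '' (D k)) ≤ (∫⁻ x in D k, ‖N x i‖ₑ ∂μHE[n]) + ε * μHE[n] (D k) ∧
      ∫⁻ x in D k, ‖N x i‖ₑ ∂μHE[n] ≤ volume (dropCoord i '' (D k)) + ε * μHE[n] (D k) := by
  obtain ⟨D, hd, hm, hc, hQ⟩ := exists_disjoint_cover (M := M)
    (Q := fun B => ∀ S ⊆ M ∩ B, MeasurableSet S →
      volume (dropCoord i '' S) ≤ (∫⁻ x in S, ‖N x i‖ₑ ∂μHE[n]) + ε * μHE[n] S ∧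
      ∫⁻ x in S, ‖N x i‖ₑ ∂μHE[n] ≤ volume (dropCoord i '' S) + ε * μHE[n] S)
    (fun S hS _ => by
      rw [Set.inter_empty, Set.subset_empty_iff] at hS
      simp [hS])
    (fun s t hst h S hS => h S (hS.trans (Set.inter_subset_inter_right _ hst)))
    (fun x hx => hM.area_local_lintegral i hε hx)
  refine ⟨fun k => S ∩ D k, fun a b hab => ?_, fun k => hSm.inter (hm k), ?_, fun k => ?_⟩
  · exact (hd hab).mono Set.inter_subset_right Set.inter_subset_right
  · rw [← Set.inter_iUnion]
    exact (Set.inter_eq_left.mpr (hS.trans hc)).symm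
  · exact hQ k _ (Set.inter_subset_inter_left _ hS) (hSm.inter (hm k))

lemma IsTangentSurface.volume_image_le (hM : IsTangentSurface M N) (i : Fin (n + 1))
    {S : Set (E (n + 1))} (hS : S ⊆ M) (hSm : MeasurableSet S) (hfin : μHE[n] S < ∞) :
    volume (dropCoord i '' S) ≤ ∫⁻ x in S, ‖N x i‖ₑ ∂μHE[n] := by
  refine ENNReal.le_of_forall_pos_le_add fun η hη _ => ?_
  obtain ⟨ε, hε, hεη⟩ := ENNReal.exists_nnreal_pos_mul_lt hfin.ne (by exact_mod_cast hη.ne' :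
    (η : ℝ≥0∞) ≠ 0)
  obtain ⟨D, hd, hm, rfl, hD⟩ := hM.exists_area_partition i hε hS hSm
  rw [Set.image_iUnion]
  calc volume (⋃ k, dropCoord i '' D k) ≤ ∑' k, volume (dropCoord i '' D k) :=
        measure_iUnion_le _
    _ ≤ ∑' k, ((∫⁻ x in D k, ‖N x i‖ₑ ∂μHE[n]) + ε * μHE[n] (D k)) :=
        ENNReal.tsum_le_tsum fun k => (hD k).1
    _ = (∫⁻ x in ⋃ k, D k, ‖N x i‖ₑ ∂μHE[n]) + ε * μHE[n] (⋃ k, D k) := by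
        rw [ENNReal.tsum_add, ENNReal.tsum_mul_left, lintegral_iUnion hm hd,
          measure_iUnion hd hm]
    _ ≤ _ := by gcongr

/-- The area formula for coordinate projections: on a piece of hypersurface that projects
injectively, the projected area is the integral of the modulus of the normal component. -/
lemma IsTangentSurface.volume_image_eq (hM : IsTangentSurface M N) (i : Fin (n + 1))
    {S : Set (E (n + 1))} (hS : S ⊆ M) (hSm : MeasurableSet S) (hfin : μHE[n] S < ∞)
    (hinj : Set.InjOn (dropCoord i) S) :
    volume (dropCoord i '' S) = ∫⁻ x in S, ‖N x i‖ₑ ∂μHE[n] := by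
  refine le_antisymm (hM.volume_image_le i hS hSm hfin) ?_
  refine ENNReal.le_of_forall_pos_le_add fun η hη _ => ?_
  obtain ⟨ε, hε, hεη⟩ := ENNReal.exists_nnreal_pos_mul_lt hfin.ne (by exact_mod_cast hη.ne' :
    (η : ℝ≥0∞) ≠ 0)
  obtain ⟨D, hd, hm, rfl, hD⟩ := hM.exists_area_partition i hε hS hSm
  have hsub : ∀ k, D k ⊆ ⋃ k, D k := Set.subset_iUnion D
  have himg : volume (dropCoord i '' ⋃ k, D k) = ∑' k, volume (dropCoord i '' D k) := by
    rw [Set.image_iUnion]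
    refine measure_iUnion (fun a b hab => ?_) fun k =>
      (hm k).image_of_continuousOn_injOn (dropCoord i).continuous.continuousOn (hinj.mono (hsub k))
    exact Set.disjoint_image_image fun x hx y hy hxy =>
      Set.disjoint_left.mp (hd hab) hx (hinj (hsub a hx) (hsub b hy) hxy ▸ hy)
  rw [himg]
  calc ∫⁻ x in ⋃ k, D k, ‖N x i‖ₑ ∂μHE[n] = ∑' k, ∫⁻ x in D k, ‖N x i‖ₑ ∂μHE[n] :=
        lintegral_iUnion hm hd _
    _ ≤ ∑' k, (volume (dropCoord i '' D k) + ε * μHE[n] (D k)) :=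
        ENNReal.tsum_le_tsum fun k => (hD k).2
    _ = (∑' k, volume (dropCoord i '' D k)) + ε * μHE[n] (⋃ k, D k) := by
        rw [ENNReal.tsum_add, ENNReal.tsum_mul_left, measure_iUnion hd hm]
    _ ≤ _ := by gcongr

end

section

open scoped NNReal

/-! ### The coarea formula along coordinate lines -/

variable {M : Set (E (n + 1))} {N : E (n + 1) → E (n + 1)}

/-- The sum of `g` over the points of `M` on the line through `y` parallel to the `i`-th axis. -/
def lineSum (i : Fin (n + 1)) (M : Set (E (n + 1))) (g : E (n + 1) → ℝ) (y : E n) : ℝ :=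
  ∑ᶠ t : ℝ, M.indicator g (linePoint i y t)

lemma lineSum_dropCoord (i : Fin (n + 1)) {S : Set (E (n + 1))}
    (hinj : Set.InjOn (dropCoord i) S) (g : E (n + 1) → ℝ) {x : E (n + 1)} (hx : x ∈ S) :
    lineSum i S g (dropCoord i x) = g x := by
  rw [lineSum, finsum_eq_single _ (x i)]
  · rw [linePoint_dropCoord, Set.indicator_of_mem hx]
  · intro t ht
    refine Set.indicator_of_notMem (fun h => ht ?_) _
    have := hinj h hx (by simp)
    rw [← this, linePoint_same]

lemma lineSum_eq_zero (i : Fin (n + 1)) {S : Set (E (n + 1))} (g : E (n + 1) → ℝ) {y : E n}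
    (hy : y ∉ dropCoord i '' S) : lineSum i S g y = 0 := by
  refine finsum_eq_zero_of_forall_eq_zero fun t => Set.indicator_of_notMem (fun h => hy ?_) _
  exact ⟨_, h, dropCoord_linePoint i y t⟩

/-- Near a point where the `i`-th normal component does not vanish, lines parallel to the `i`-th
axis meet the hypersurface at most once. -/
lemma IsTangentSurface.exists_injOn (hM : IsTangentSurface M N) (i : Fin (n + 1))
    {x₀ : E (n + 1)} (hx₀ : x₀ ∈ M) (hN : N x₀ i ≠ 0) :
    ∃ r > 0, Set.InjOn (dropCoord i) (M ∩ Metric.ball x₀ r) := by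
  obtain ⟨r, hr, h⟩ := hM.tangent x₀ hx₀ (|N x₀ i| / 2) (half_pos (abs_pos.mpr hN))
  refine ⟨r, hr, fun x hx y hy hxy => ?_⟩
  have hdiff : x - y = (x i - y i) • unitVec i := by
    rw [← linePoint_dropCoord i x, ← linePoint_dropCoord i y, hxy]
    rw [linePoint_eq i _ (x i), linePoint_eq i _ (y i)]
    simp only [linePoint_same, PiLp.add_apply, PiLp.smul_apply]
    simp [sub_smul]
  have h1 := h x hx y hy
  rw [hdiff, inner_smul_right, norm_smul, PiLp.norm_single] at h1
  rw [inner_unitVec, abs_mul, norm_one, mul_one, Real.norm_eq_abs] at h1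
  have h3 := abs_pos.mpr hN
  have h4 : |x i - y i| = 0 := by
    by_contra hne
    have := lt_of_le_of_ne (abs_nonneg _) (Ne.symm hne)
    nlinarith
  rw [← sub_eq_zero, hdiff, abs_eq_zero.mp h4, zero_smul]

/-- The area formula as a change of variables, on a piece that projects injectively. -/
lemma IsTangentSurface.map_withDensity_eq (hM : IsTangentSurface M N) (i : Fin (n + 1))
    {S : Set (E (n + 1))} (hS : S ⊆ M) (hSm : MeasurableSet S) (hfin : μHE[n] S < ∞)
    (hinj : Set.InjOn (dropCoord i) S) :
    Measure.map (S.domRestrict (dropCoord i))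
      (Measure.comap (↑) ((μHE[n] : Measure (E (n + 1))).withDensity fun x => ‖N x i‖₊)) =
      volume.restrict (dropCoord i '' S) := by
  have hemb : Measurable (S.domRestrict (dropCoord i)) :=
    (dropCoord i).continuous.measurable.comp measurable_subtype_coe
  ext T hT
  rw [Measure.map_apply hemb hT,
    Measure.restrict_apply hT, comap_subtype_coe_apply hSm]
  have h1 : Subtype.val '' (S.domRestrict (dropCoord i) ⁻¹' T) = S ∩ dropCoord i ⁻¹' T := by
    ext x
    constructor
    · rintro ⟨z, hz, rfl⟩
      exact ⟨z.2, hz⟩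
    · rintro ⟨h, h'⟩
      exact ⟨⟨x, h⟩, h', rfl⟩
  have hm : MeasurableSet (S ∩ dropCoord i ⁻¹' T) :=
    hSm.inter ((dropCoord i).continuous.measurable hT)
  rw [h1, withDensity_apply _ hm]
  have h2 := hM.volume_image_eq i (Set.inter_subset_left.trans hS) hm
    (lt_of_le_of_lt (measure_mono Set.inter_subset_left) hfin) (hinj.mono Set.inter_subset_left)
  rw [Set.image_inter_preimage, Set.inter_comm] at h2
  exact h2.symm

lemma IsTangentSurface.aemeasurable_nnnorm (hM : IsTangentSurface M N) (i : Fin (n + 1))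
    {S : Set (E (n + 1))} (hS : S ⊆ M) (hSm : MeasurableSet S) :
    AEMeasurable (fun x => ‖N x i‖₊) ((μHE[n] : Measure (E (n + 1))).restrict S) :=
  (((hM.continuousOn_apply i).mono hS).nnnorm).aemeasurable hSm

lemma measurableEmbedding_domRestrict_dropCoord (i : Fin (n + 1)) {S : Set (E (n + 1))}
    (hSm : MeasurableSet S) (hinj : Set.InjOn (dropCoord i) S) :
    MeasurableEmbedding (S.domRestrict (dropCoord i)) := by
  have : StandardBorelSpace S := hSm.standardBorel
  exact Measurable.measurableEmbedding
    ((dropCoord i).continuous.measurable.comp measurable_subtype_coe) hinj.injective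

lemma IsTangentSurface.integrable_lineSum_iff_of_injOn (hM : IsTangentSurface M N)
    (i : Fin (n + 1)) {S : Set (E (n + 1))} (hS : S ⊆ M) (hSm : MeasurableSet S)
    (hfin : μHE[n] S < ∞) (hinj : Set.InjOn (dropCoord i) S) (g : E (n + 1) → ℝ) :
    Integrable (lineSum i S g) ↔
      IntegrableOn (fun x => |N x i| * g x) S (μHE[n] : Measure (E (n + 1))) := by
  have himg : MeasurableSet (dropCoord i '' S) :=
    hSm.image_of_continuousOn_injOn (dropCoord i).continuous.continuousOn hinj
  rw [← integrableOn_iff_integrable_of_support_subset (s := dropCoord i '' S)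
    (fun y hy => by_contra fun h => hy (lineSum_eq_zero i g h)), IntegrableOn,
    ← hM.map_withDensity_eq i hS hSm hfin hinj,
    (measurableEmbedding_domRestrict_dropCoord i hSm hinj).integrable_map_iff]
  have h1 : lineSum i S g ∘ S.domRestrict (dropCoord i) = g ∘ Subtype.val := by
    ext x
    exact lineSum_dropCoord i hinj g x.2
  rw [h1, ← (MeasurableEmbedding.subtype_coe hSm).integrable_map_iff, map_comap_subtype_coe hSm,
    restrict_withDensity hSm, integrable_withDensity_iff_integrable_coe_smul₀
      (hM.aemeasurable_nnnorm i hS hSm)]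
  rfl

lemma IsTangentSurface.integral_lineSum_of_injOn (hM : IsTangentSurface M N)
    (i : Fin (n + 1)) {S : Set (E (n + 1))} (hS : S ⊆ M) (hSm : MeasurableSet S)
    (hfin : μHE[n] S < ∞) (hinj : Set.InjOn (dropCoord i) S) (g : E (n + 1) → ℝ) :
    ∫ y, lineSum i S g y = ∫ x in S, |N x i| * g x ∂μHE[n] := by
  have himg : MeasurableSet (dropCoord i '' S) :=
    hSm.image_of_continuousOn_injOn (dropCoord i).continuous.continuousOn hinj
  rw [← setIntegral_eq_integral_of_forall_compl_eq_zero (s := dropCoord i '' S)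
    (fun y hy => lineSum_eq_zero i g hy),
    ← hM.map_withDensity_eq i hS hSm hfin hinj,
    (measurableEmbedding_domRestrict_dropCoord i hSm hinj).integral_map]
  have h1 : ∀ x : S, lineSum i S g (S.domRestrict (dropCoord i) x) = g x := fun x =>
    lineSum_dropCoord i hinj g x.2
  simp_rw [h1]
  rw [← (MeasurableEmbedding.subtype_coe hSm).integral_map, map_comap_subtype_coe hSm,
    restrict_withDensity hSm, integral_withDensity_eq_integral_smul₀
      (hM.aemeasurable_nnnorm i hS hSm)]
  rfl

lemma integrable_tsum_of_summable_integral_norm {α : Type*} [MeasurableSpace α] {μ : Measure α}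
    {F : ℕ → α → ℝ} (hF : ∀ k, Integrable (F k) μ) (hs : Summable fun k => ∫ a, ‖F k a‖ ∂μ)
    (hp : ∀ᵐ a ∂μ, Summable fun k => F k a) : Integrable (fun a => ∑' k, F k a) μ := by
  refine ⟨aestronglyMeasurable_of_tendsto_ae atTop
    (f := fun m a => ∑ k ∈ Finset.range m, F k a)
    (fun m => Finset.aestronglyMeasurable_fun_sum _ fun k _ => (hF k).1)
    (hp.mono fun a ha => ha.hasSum.tendsto_sum_nat), ?_⟩
  calc ∫⁻ a, ‖∑' k, F k a‖ₑ ∂μ ≤ ∫⁻ a, ∑' k, ‖F k a‖ₑ ∂μ :=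
        lintegral_mono fun a => enorm_tsum_le_tsum_enorm
    _ = ∑' k, ∫⁻ a, ‖F k a‖ₑ ∂μ := lintegral_tsum fun k => (hF k).1.enorm
    _ = ∑' k, ENNReal.ofReal (∫ a, ‖F k a‖ ∂μ) := by
        congr 1 with k
        rw [ofReal_integral_norm_eq_lintegral_enorm (hF k)]
    _ < ∞ := by
        rw [← ENNReal.ofReal_tsum_of_nonneg (fun k => integral_nonneg fun a => norm_nonneg _) hs]
        exact ENNReal.ofReal_lt_top

/-- The coarea formula for coordinate projections of a hypersurface of finite area: almost every
line parallel to the `i`-th axis meets `M` in finitely many points, all of them transversally,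
and summing over these points is integrating against `|N i|`. -/
theorem IsTangentSurface.coarea (hM : IsTangentSurface M N) (hfin : μHE[n] M < ∞)
    (i : Fin (n + 1)) {g : E (n + 1) → ℝ}
    (hg : IntegrableOn g M (μHE[n] : Measure (E (n + 1)))) :
    (∀ᵐ y : E n, {t | linePoint i y t ∈ M}.Finite ∧
      ∀ t, linePoint i y t ∈ M → N (linePoint i y t) i ≠ 0) ∧
    Integrable (lineSum i M g) ∧ ∫ y, lineSum i M g y = ∫ x in M, |N x i| * g x ∂μHE[n] := by
  have hNc := hM.continuousOn_apply i
  obtain ⟨M₁, hM₁def, hM₁m⟩ : ∃ M₁ : Set (E (n + 1)), M₁ = {x ∈ M | N x i ≠ 0} ∧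
      MeasurableSet M₁ := by
    obtain ⟨u, hu, hu'⟩ := (continuousOn_iff'.mp hNc) {0}ᶜ isOpen_compl_singleton
    refine ⟨_, rfl, ?_⟩
    have : {x ∈ M | N x i ≠ 0} = u ∩ M := by
      rw [← hu']
      ext x
      simp [and_comm]
    rw [this]
    exact hu.measurableSet.inter hM.measurableSet
  have hM₁M : M₁ ⊆ M := by rw [hM₁def]; exact fun x hx => hx.1
  -- the tangential part projects to a null set
  have hnull : volume (dropCoord i '' (M \ M₁)) = 0 := by
    have hle := hM.volume_image_le i Set.sdiff_subset (hM.measurableSet.diff hM₁m)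
      (lt_of_le_of_lt (measure_mono Set.sdiff_subset) hfin)
    refine le_antisymm (hle.trans_eq ?_) zero_le
    rw [setLIntegral_congr_fun (g := fun _ => 0) (hM.measurableSet.diff hM₁m), lintegral_zero]
    intro x hx
    have : N x i = 0 := by
      by_contra h
      exact hx.2 (hM₁def ▸ ⟨hx.1, h⟩)
    simp [this]
  -- the transversal part splits into pieces that project injectively
  obtain ⟨D, hd, hDm, hcov, hQ⟩ := exists_disjoint_cover (M := M₁)
    (Q := fun B => Set.InjOn (dropCoord i) (M ∩ B)) (by simp)
    (fun s t hst h => h.mono (Set.inter_subset_inter_right _ hst))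
    (fun x hx => by
      rw [hM₁def] at hx
      exact hM.exists_injOn i hx.1 hx.2)
  let P : ℕ → Set (E (n + 1)) := fun k => M₁ ∩ D k
  have hPm : ∀ k, MeasurableSet (P k) := fun k => hM₁m.inter (hDm k)
  have hPd : Pairwise (Function.onFun Disjoint P) := fun a b hab =>
    (hd hab).mono Set.inter_subset_right Set.inter_subset_right
  have hPU : ⋃ k, P k = M₁ := by
    rw [← Set.inter_iUnion]
    exact Set.inter_eq_left.mpr hcov
  have hPM : ∀ k, P k ⊆ M := fun k => Set.inter_subset_left.trans hM₁M
  have hPinj : ∀ k, Set.InjOn (dropCoord i) (P k) := fun k =>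
    (hQ k).mono (Set.inter_subset_inter_left _ hM₁M)
  have hPfin : ∀ k, μHE[n] (P k) < ∞ := fun k => lt_of_le_of_lt (measure_mono (hPM k)) hfin
  have hN1 : ∀ x ∈ M, |N x i| ≤ 1 := fun x hx => by
    rw [← hM.norm_eq_one x hx]
    exact PiLp.norm_apply_le (N x) i
  have hint : IntegrableOn (fun x => |N x i| * g x) M (μHE[n] : Measure (E (n + 1))) := by
    refine Integrable.bdd_mul (c := 1) hg
      (hNc.abs.aestronglyMeasurable hM.measurableSet) ?_
    refine (ae_restrict_mem hM.measurableSet).mono fun x hx => ?_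
    rw [Real.norm_eq_abs, abs_abs]
    exact hN1 x hx
  have hvol : ∑' k, volume (dropCoord i '' P k) ≠ ∞ := by
    have h1 : ∑' k, volume (dropCoord i '' P k) ≤ ∑' k, μHE[n] (P k) := by
      refine ENNReal.tsum_le_tsum fun k => ?_
      have := euclideanHausdorffMeasure_image_le_of_lipschitzOnWith
        ((lipschitzWith_dropCoord i).lipschitzOnWith (s := P k)) n
      rwa [EuclideanSpace.euclideanHausdorffMeasure_eq_volume, ENNReal.coe_one, one_pow,
        one_mul] at this
    rw [← measure_iUnion hPd hPm, hPU] at h1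
    exact ne_top_of_le_ne_top hfin.ne (h1.trans (measure_mono hM₁M))
  -- generic lines
  have hgen : ∀ᵐ y : E n, {k | y ∈ dropCoord i '' P k}.Finite ∧ y ∉ dropCoord i '' (M \ M₁) :=
    (ae_finite_setOfPred_mem hvol).and (measure_eq_zero_iff_ae_notMem.mp hnull)
  have htrans : ∀ y : E n, y ∉ dropCoord i '' (M \ M₁) → ∀ t, linePoint i y t ∈ M →
      linePoint i y t ∈ M₁ := fun y hy t ht =>
    by_contra fun h => hy ⟨_, ⟨ht, h⟩, dropCoord_linePoint i y t⟩
  have hfinite : ∀ᵐ y : E n, {t | linePoint i y t ∈ M}.Finite := by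
    filter_upwards [hgen] with y ⟨hy1, hy2⟩
    have hsub : {t | linePoint i y t ∈ M} ⊆
        ⋃ k ∈ {k | y ∈ dropCoord i '' P k}, {t | linePoint i y t ∈ P k} := by
      intro t ht
      have h1 := htrans y hy2 t ht
      rw [← hPU] at h1
      obtain ⟨k, hk⟩ := Set.mem_iUnion.mp h1
      exact Set.mem_biUnion (x := k) ⟨_, hk, dropCoord_linePoint i y t⟩ hk
    refine (hy1.biUnion fun k _ => Set.Subsingleton.finite fun s hs t ht => ?_).subset hsub
    have := hPinj k hs ht (by simp)
    simpa using congrArg (fun x : E (n + 1) => x i) this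
  have hzero : ∀ y : E n, ∀ k, y ∉ dropCoord i '' P k → lineSum i (P k) g y = 0 :=
    fun y k hk => lineSum_eq_zero i g hk
  have hsplit : ∀ᵐ y : E n, lineSum i M g y = ∑' k, lineSum i (P k) g y := by
    filter_upwards [hgen, hfinite] with y ⟨hy1, hy2⟩ hy3
    rw [tsum_eq_sum (s := hy1.toFinset) fun k hk => hzero y k (by simpa using hk)]
    simp only [lineSum]
    rw [← finsum_sum_comm]
    · refine finsum_congr fun t => ?_
      by_cases ht : linePoint i y t ∈ M
      · have h1 := htrans y hy2 t ht
        rw [← hPU] at h1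
        obtain ⟨k, hk⟩ := Set.mem_iUnion.mp h1
        rw [Finset.sum_eq_single k]
        · rw [Set.indicator_of_mem ht, Set.indicator_of_mem hk]
        · intro l _ hlk
          exact Set.indicator_of_notMem (fun hl => Set.disjoint_left.mp (hPd hlk) hl hk) _
        · intro hk'
          exact absurd (show k ∈ hy1.toFinset from
            hy1.mem_toFinset.mpr ⟨_, hk, dropCoord_linePoint i y t⟩) hk'
      · rw [Set.indicator_of_notMem ht, Finset.sum_eq_zero]
        exact fun k _ => Set.indicator_of_notMem (fun h => ht (hPM k h)) _
    · intro k _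
      refine hy3.subset fun t ht => hPM k ?_
      exact Set.mem_of_indicator_ne_zero ht
  have hFint : ∀ k, Integrable (lineSum i (P k) g) := fun k =>
    (hM.integrable_lineSum_iff_of_injOn i (hPM k) (hPm k) (hPfin k) (hPinj k) g).mpr
      (hint.mono_set (hPM k))
  have hnorm : ∀ k, ∫ y, ‖lineSum i (P k) g y‖ = ∫ x in P k, ‖|N x i| * g x‖ ∂μHE[n] := by
    intro k
    have h1 : ∀ y, ‖lineSum i (P k) g y‖ = lineSum i (P k) (fun x => |g x|) y := by
      intro y
      by_cases hy : y ∈ dropCoord i '' P k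
      · obtain ⟨x, hx, rfl⟩ := hy
        rw [lineSum_dropCoord i (hPinj k) g hx, lineSum_dropCoord i (hPinj k) _ hx,
          Real.norm_eq_abs]
      · rw [lineSum_eq_zero i g hy, lineSum_eq_zero i _ hy, norm_zero]
    simp_rw [h1]
    rw [hM.integral_lineSum_of_injOn i (hPM k) (hPm k) (hPfin k) (hPinj k)]
    simp_rw [norm_mul, Real.norm_eq_abs, abs_abs]
  have hsum : Summable fun k => ∫ y, ‖lineSum i (P k) g y‖ := by
    simp_rw [hnorm]
    exact (hasSum_integral_iUnion hPm hPd
      ((hint.mono_set (by rw [hPU]; exact hM₁M)).norm)).summable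
  have hval : ∫ y, ∑' k, lineSum i (P k) g y = ∫ x in M, |N x i| * g x ∂μHE[n] := by
    rw [← (hasSum_integral_of_summable_integral_norm hFint hsum).tsum_eq]
    simp_rw [fun k => hM.integral_lineSum_of_injOn i (hPM k) (hPm k) (hPfin k) (hPinj k) g]
    rw [← integral_iUnion hPm hPd (hint.mono_set (by rw [hPU]; exact hM₁M)), hPU]
    symm
    refine setIntegral_eq_of_subset_of_forall_sdiff_eq_zero hM.measurableSet hM₁M fun x hx => ?_
    have : N x i = 0 := by
      by_contra h
      exact hx.2 (hM₁def ▸ ⟨hx.1, h⟩)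
    simp [this]
  refine ⟨?_, ?_, ?_⟩
  · filter_upwards [hgen, hfinite] with y hy1 hy2
    refine ⟨hy2, fun t ht => ?_⟩
    have := htrans y hy1.2 t ht
    rw [hM₁def] at this
    exact this.2
  · refine (integrable_congr hsplit).mpr
      (integrable_tsum_of_summable_integral_norm hFint hsum ?_)
    filter_upwards [hgen] with y hy
    exact summable_of_ne_finset_zero (s := hy.1.toFinset)
      fun k hk => hzero y k (by simpa using hk)
  · rw [integral_congr_ae hsplit, hval]

end

/-! ### Functions on the line with finitely many jumps -/

/-- The fundamental theorem of calculus for a compactly supported function on the line with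
finitely many jumps: the integral of the derivative is minus the sum of the jumps. Here `l` and `r`
are the one-sided limits of `G`, and `D` its derivative between the jumps. -/
theorem integral_eq_finsum_jumps {G D l r : ℝ → ℝ} (hD : Integrable D) {K : Set ℝ}
    (hKfin : K.Finite)
    (hleft : ∀ t₀, ∀ᶠ t in 𝓝[<] t₀, G t + ∫ s in t..t₀, D s = l t₀)
    (hright : ∀ t₀, ∀ᶠ t in 𝓝[>] t₀, G t = r t₀ + ∫ s in t₀..t, D s)
    (hK : ∀ t ∉ K, l t = G t ∧ r t = G t) {R : ℝ} (hR : ∀ t, R < |t| → G t = 0) :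
    ∫ t, D t = ∑ᶠ t, (l t - r t) := by
  classical
  set F := hKfin.toFinset with hF
  have hFK : ∀ t, t ∉ F → l t = G t ∧ r t = G t := fun t ht =>
    hK t fun h => ht (hKfin.mem_toFinset.mpr h)
  have hDi : ∀ a b, IntervalIntegrable D volume a b := fun a b => hD.intervalIntegrable
  -- `G` with its primitive subtracted and its jumps removed, a locally constant function
  let Q : ℝ → ℝ := fun t => l t - (∫ s in (0 : ℝ)..t, D s) + ∑ k ∈ F, if k < t then l k - r k else 0
  have hpunct : ∀ t₀, ∀ᶠ t in 𝓝[≠] t₀, t ∉ F := by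
    intro t₀
    have h1 : ((F : Set ℝ) \ {t₀})ᶜ ∈ 𝓝 t₀ :=
      (F.finite_toSet.sdiff).isClosed.isOpen_compl.mem_nhds (by simp)
    filter_upwards [mem_nhdsWithin_of_mem_nhds h1, self_mem_nhdsWithin] with t ht ht' h
    exact ht ⟨h, ht'⟩
  have hQ : IsLocallyConstant Q := by
    rw [IsLocallyConstant.iff_eventually_eq]
    intro t₀
    rw [← nhdsLT_sup_nhdsGE, eventually_sup]
    have hother : ∀ᶠ t in 𝓝 t₀, ∀ k ∈ F, k ≠ t₀ → (k < t ↔ k < t₀) := by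
      rw [eventually_all_finset]
      intro k _
      rcases lt_trichotomy k t₀ with h | h | h
      · filter_upwards [lt_mem_nhds h] with t ht _
        exact ⟨fun _ => h, fun _ => ht⟩
      · exact Eventually.of_forall fun t h' => absurd h h'
      · filter_upwards [gt_mem_nhds h] with t ht _
        exact ⟨fun h' => absurd h' ht.not_gt, fun h' => absurd h' h.not_gt⟩
    constructor
    · filter_upwards [hleft t₀, nhdsWithin_le_nhds hother,
        (hpunct t₀).filter_mono (nhdsWithin_mono _ fun _ h => ne_of_lt h),
        self_mem_nhdsWithin] with t h1 h2 h3 h4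
      have e1 : (∫ s in (0 : ℝ)..t, D s) + ∫ s in t..t₀, D s = ∫ s in (0 : ℝ)..t₀, D s :=
        intervalIntegral.integral_add_adjacent_intervals (hDi _ _) (hDi _ _)
      have e2 : (∑ k ∈ F, if k < t then l k - r k else 0)
          = ∑ k ∈ F, if k < t₀ then l k - r k else 0 := by
        refine Finset.sum_congr rfl fun k hk => ?_
        by_cases hkt : k = t₀
        · subst hkt
          rw [if_neg (not_lt.mpr (le_of_lt h4)), if_neg (lt_irrefl _)]
        · simp only [h2 k hk hkt]
      simp only [Q, e2, (hFK t h3).1]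
      linarith
    · rw [← Set.Ioi_insert, nhdsWithin_insert, eventually_sup]
      refine ⟨by simp, ?_⟩
      filter_upwards [hright t₀, nhdsWithin_le_nhds hother,
        (hpunct t₀).filter_mono (nhdsWithin_mono _ fun _ h => ne_of_gt h),
        self_mem_nhdsWithin] with t h1 h2 h3 h4
      have e1 : (∫ s in (0 : ℝ)..t₀, D s) + ∫ s in t₀..t, D s = ∫ s in (0 : ℝ)..t, D s :=
        intervalIntegral.integral_add_adjacent_intervals (hDi _ _) (hDi _ _)
      have e2 : (∑ k ∈ F, if k < t then l k - r k else 0)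
          = (∑ k ∈ F, if k < t₀ then l k - r k else 0) + (l t₀ - r t₀) := by
        have : ∀ k ∈ F, (if k < t then l k - r k else 0)
            = (if k < t₀ then l k - r k else 0) + if k = t₀ then l k - r k else 0 := by
          intro k hk
          by_cases hkt : k = t₀
          · subst hkt
            rw [if_pos (Set.mem_Ioi.mp h4), if_neg (lt_irrefl _), if_pos rfl, zero_add]
          · simp only [h2 k hk hkt, if_neg hkt, add_zero]
        rw [Finset.sum_congr rfl this, Finset.sum_add_distrib, Finset.sum_ite_eq']
        by_cases h : t₀ ∈ F
        · rw [if_pos h]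
        · rw [if_neg h, (hFK t₀ h).1, (hFK t₀ h).2, sub_self]
      simp only [Q, e2, (hFK t h3).1]
      linarith
  obtain ⟨B, hB⟩ : ∃ B, ∀ k ∈ F, |k| < B := by
    obtain ⟨B, hB⟩ := (F.finite_toSet.image fun k => |k|).bddAbove
    exact ⟨B + 1, fun k hk => lt_of_le_of_lt (hB ⟨k, hk, rfl⟩) (lt_add_one B)⟩
  have hsum : ∑ᶠ t, (l t - r t) = ∑ k ∈ F, (l k - r k) := by
    refine finsum_eq_sum_of_support_subset _ fun t ht => ?_
    by_contra h
    exact ht (by simp [hFK t h])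
  have hev : ∀ᶠ b : ℝ in atTop, ∫ s in (-b)..b, D s = ∑ k ∈ F, (l k - r k) := by
    filter_upwards [eventually_gt_atTop (max (max R B) 0)] with b hb
    have hbR : R < b := lt_of_le_of_lt ((le_max_left _ _).trans (le_max_left _ _)) hb
    have hbB : B < b := lt_of_le_of_lt ((le_max_right _ _).trans (le_max_left _ _)) hb
    have hb0 : 0 < b := lt_of_le_of_lt (le_max_right _ _) hb
    have hnF : ∀ t, |t| = b → t ∉ F := fun t ht h => by
      have := hB t h
      rw [ht] at this
      exact absurd this hbB.not_gt
    have h0 : ∀ t, |t| = b → l t = 0 := fun t ht => by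
      rw [(hFK t (hnF t ht)).1, hR t (by rwa [ht])]
    have hconst := hQ.apply_eq_of_preconnectedSpace b (-b)
    have s1 : (∑ k ∈ F, if k < b then l k - r k else 0) = ∑ k ∈ F, (l k - r k) :=
      Finset.sum_congr rfl fun k hk => if_pos (lt_of_le_of_lt (le_abs_self k) ((hB k hk).trans hbB))
    have s2 : (∑ k ∈ F, if k < -b then l k - r k else 0) = 0 :=
      Finset.sum_eq_zero fun k hk => if_neg (by
        have := (abs_lt.mp ((hB k hk).trans hbB)).1
        exact this.not_gt)
    simp only [Q, s1, s2, h0 b (abs_of_pos hb0), h0 (-b) (by rw [abs_neg, abs_of_pos hb0])]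
      at hconst
    have e1 : (∫ s in (-b)..0, D s) + ∫ s in (0 : ℝ)..b, D s = ∫ s in (-b)..b, D s :=
      intervalIntegral.integral_add_adjacent_intervals (hDi _ _) (hDi _ _)
    rw [intervalIntegral.integral_symm] at e1
    linarith
  rw [hsum]
  exact tendsto_nhds_unique
    (intervalIntegral_tendsto_integral hD tendsto_neg_atTop_atBot tendsto_id)
    (tendsto_const_nhds.congr' (hev.mono fun b hb => hb.symm))

/-! ### Weak partial derivatives on lines -/

/-- `g` is the weak `i`-th partial derivative of the function `f` in the open set `Ω`. -/
def HasWeakPartial (Ω : Set (E (n + 1))) (i : Fin (n + 1)) (f g : E (n + 1) → ℝ) : Prop :=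
  ∀ φ : E (n + 1) → ℝ, ContDiff ℝ (⊤ : ℕ∞) φ → HasCompactSupport φ → tsupport φ ⊆ Ω →
    ∫ x in Ω, fderiv ℝ φ x (unitVec i) * f x = - ∫ x in Ω, φ x * g x

/-- The product rule for a weak partial derivative and a smooth factor. -/
lemma HasWeakPartial.smooth_mul {Ω : Set (E (n + 1))} {i : Fin (n + 1)} {f g : E (n + 1) → ℝ}
    (h : HasWeakPartial Ω i f g) (hf : IntegrableOn f Ω) (hg : IntegrableOn g Ω)
    {ψ : E (n + 1) → ℝ} (hψ : ContDiff ℝ (⊤ : ℕ∞) ψ) :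
    HasWeakPartial Ω i (fun x => ψ x * f x)
      fun x => fderiv ℝ ψ x (unitVec i) * f x + ψ x * g x := by
  intro φ hφ hc hs
  have hψd : Differentiable ℝ ψ := hψ.differentiable (by simp)
  have hφd : Differentiable ℝ φ := hφ.differentiable (by simp)
  have h1 := h (fun x => φ x * ψ x) (hφ.mul hψ) hc.mul_right
    ((tsupport_mul_subset_left).trans hs)
  have hψ' : Continuous fun x => fderiv ℝ ψ x (unitVec i) :=
    (hψ.continuous_fderiv (by simp)).clm_apply continuous_const
  have hφ' : Continuous fun x => fderiv ℝ φ x (unitVec i) :=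
    (hφ.continuous_fderiv (by simp)).clm_apply continuous_const
  have hcφ' : HasCompactSupport fun x => fderiv ℝ φ x (unitVec i) :=
    hc.fderiv_apply (𝕜 := ℝ) (unitVec i)
  have key : ∀ {u : E (n + 1) → ℝ}, Continuous u → HasCompactSupport u →
      ∀ {w : E (n + 1) → ℝ}, IntegrableOn w Ω → IntegrableOn (fun x => u x * w x) Ω := by
    intro u hu huc w hw
    obtain ⟨C, hC⟩ := hu.bounded_above_of_compact_support huc
    exact Integrable.bdd_mul (c := C) hw hu.aestronglyMeasurable (Eventually.of_forall hC)
  have i1 : IntegrableOn (fun x => (φ x * fderiv ℝ ψ x (unitVec i)) * f x) Ω :=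
    key (hφ.continuous.mul hψ') hc.mul_right hf
  have i2 : IntegrableOn (fun x => (fderiv ℝ φ x (unitVec i) * ψ x) * f x) Ω :=
    key (hφ'.mul hψ.continuous) hcφ'.mul_right hf
  have i3 : IntegrableOn (fun x => (φ x * ψ x) * g x) Ω :=
    key (hφ.continuous.mul hψ.continuous) hc.mul_right hg
  have e1 : ∀ x, fderiv ℝ (fun x => φ x * ψ x) x (unitVec i) * f x
      = (φ x * fderiv ℝ ψ x (unitVec i)) * f x + (fderiv ℝ φ x (unitVec i) * ψ x) * f x := by
    intro x
    rw [fderiv_fun_mul (hφd x) (hψd x)]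
    simp only [add_apply, smul_apply, smul_eq_mul]
    ring
  simp_rw [e1] at h1
  rw [integral_add i1 i2] at h1
  have e2 : ∀ x, φ x * (fderiv ℝ ψ x (unitVec i) * f x + ψ x * g x)
      = (φ x * fderiv ℝ ψ x (unitVec i)) * f x + (φ x * ψ x) * g x := fun x => by ring
  simp_rw [e2]
  rw [integral_add i1 i3]
  simp_rw [← mul_assoc]
  linarith

open scoped Convolution in
/-- The average of a test function over segments of direction `e` is smooth, being a convolution
with a finite measure. -/
lemma contDiff_segment_integral {V : Type*} [NormedAddCommGroup V] [NormedSpace ℝ V]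
    [FiniteDimensional ℝ V] (e : V) (h : ℝ) {φ : V → ℝ} (hφ : ContDiff ℝ (⊤ : ℕ∞) φ)
    (hc : HasCompactSupport φ) :
    ContDiff ℝ (⊤ : ℕ∞) fun x => ∫ s in Set.Ioc 0 h, φ (x - s • e) := by
  borelize V
  let μ : Measure V := (volume.restrict (Set.Ioc 0 h)).map fun s : ℝ => s • e
  have hmeas : Measurable fun s : ℝ => s • e := by fun_prop
  have : IsFiniteMeasure μ := Measure.isFiniteMeasure_map _ _
  have h1 : ContDiff ℝ (⊤ : ℕ∞) ((fun _ : V => (1 : ℝ)) ⋆[ContinuousLinearMap.mul ℝ ℝ, μ] φ) :=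
    hc.contDiff_convolution_right _ (integrable_const 1).locallyIntegrable hφ
  convert h1 using 1
  ext x
  have hcont : Continuous fun t => φ (x - t) := hφ.continuous.comp (by fun_prop)
  rw [convolution_def, integral_map hmeas.aemeasurable]
  · simp
  · simp only [ContinuousLinearMap.mul_apply', one_mul]
    exact hcont.aestronglyMeasurable

/-- The derivative of a segment average in the direction of the segments is a difference of end
point values. -/
lemma fderiv_segment_integral {V : Type*} [NormedAddCommGroup V] [NormedSpace ℝ V]
    [FiniteDimensional ℝ V] (e : V) {h : ℝ} (hh : 0 ≤ h) {φ : V → ℝ}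
    (hφ : ContDiff ℝ (⊤ : ℕ∞) φ) (hc : HasCompactSupport φ) (x : V) :
    fderiv ℝ (fun x => ∫ s in Set.Ioc 0 h, φ (x - s • e)) x e = φ x - φ (x - h • e) := by
  set Φ : V → ℝ := fun x => ∫ s in Set.Ioc 0 h, φ (x - s • e)
  have hΦ : DifferentiableAt ℝ Φ x :=
    (contDiff_segment_integral e h hφ hc).differentiable (by simp) x
  let ψ : ℝ → ℝ := fun u => φ (x + u • e)
  have hψ : Continuous ψ := hφ.continuous.comp (by fun_prop)
  have hline : ∀ t, Φ (x + t • e) = (∫ u in (0 : ℝ)..t, ψ u) - ∫ u in (0 : ℝ)..(t - h), ψ u := by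
    intro t
    have h1 : Φ (x + t • e) = ∫ s in (0 : ℝ)..h, ψ (t - s) := by
      rw [intervalIntegral.integral_of_le hh]
      refine integral_congr_ae (Eventually.of_forall fun s => ?_)
      simp only [ψ]
      congr 1
      rw [sub_smul]
      abel
    rw [h1, intervalIntegral.integral_comp_sub_left, sub_zero,
      intervalIntegral.integral_interval_sub_left (hψ.intervalIntegrable _ _)
        (hψ.intervalIntegrable _ _)]
  have hd1 : HasDerivAt (fun t : ℝ => Φ (x + t • e)) (ψ 0 - ψ (0 - h)) 0 := by
    simp_rw [hline]
    refine (hψ.integral_hasStrictDerivAt 0 0).hasDerivAt.sub ?_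
    have h2 := (hψ.integral_hasStrictDerivAt 0 (0 - h)).hasDerivAt
    simpa using h2.comp_sub_const 0 h
  have hd2 : HasDerivAt (fun t : ℝ => Φ (x + t • e)) (fderiv ℝ Φ x e) 0 := by
    have h3 : HasDerivAt (fun t : ℝ => x + t • e) e 0 := by
      simpa using ((hasDerivAt_id (0 : ℝ)).smul_const e).const_add x
    have h4 : HasFDerivAt Φ (fderiv ℝ Φ x) (x + (0 : ℝ) • e) := by
      simpa using hΦ.hasFDerivAt
    exact h4.comp_hasDerivAt 0 h3
  rw [hd2.unique hd1]
  simp [ψ, sub_eq_add_neg]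

lemma measurePreserving_shear (i : Fin (n + 1)) (h : ℝ) :
    MeasurePreserving (fun p : ℝ × E (n + 1) => (p.1, p.2 + p.1 • unitVec i))
      ((volume.restrict (Set.Ioc 0 h)).prod volume)
      ((volume.restrict (Set.Ioc 0 h)).prod volume) := by
  refine (MeasurePreserving.id (volume.restrict (Set.Ioc 0 h))).skew_product
    (g := fun s x => x + s • unitVec i) (by fun_prop) ?_
  exact Eventually.of_forall fun s => (measurePreserving_add_right volume _).map_eq

/-- The fundamental theorem of calculus along segments, for a weak derivative: it holds for almost
every starting point of a segment of fixed length contained in `Ω`. Averages of test functions over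
segments are themselves test functions, which gives the identity integrated against any `φ`. -/
lemma HasWeakPartial.ae_sub_eq_integral {Ω : Set (E (n + 1))} (hΩ : IsOpen Ω) {i : Fin (n + 1)}
    {f g : E (n + 1) → ℝ} (hw : HasWeakPartial Ω i f g) (hf : IntegrableOn f Ω)
    (hg : IntegrableOn g Ω) {h : ℝ} (hh : 0 ≤ h) :
    ∀ᵐ x : E (n + 1), (∀ s ∈ Set.Icc 0 h, x + s • unitVec i ∈ Ω) →
      f (x + h • unitVec i) - f x = ∫ s in (0 : ℝ)..h, g (x + s • unitVec i) := by
  set e : E (n + 1) := unitVec i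
  set f' := Ω.indicator f
  set g' := Ω.indicator g
  have hf' : Integrable f' := hf.integrable_indicator hΩ.measurableSet
  have hg' : Integrable g' := hg.integrable_indicator hΩ.measurableSet
  let U : Set (E (n + 1)) := {x | ∀ s ∈ Set.Icc 0 h, x + s • e ∈ Ω}
  have hU : IsOpen U := by
    have hclosed : IsClosed Uᶜ := by
      have : Uᶜ = Prod.snd '' ((fun p : ℝ × E (n + 1) => p.2 + p.1 • e) ⁻¹' Ωᶜ ∩
          (Set.Icc 0 h ×ˢ Set.univ)) := by
        ext x
        simp only [U, Set.mem_compl_iff, Set.mem_ofPred_eq, Set.mem_image, Set.mem_inter_iff,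
          Set.mem_preimage, Set.mem_prod, Set.mem_univ, and_true, Prod.exists]
        push Not
        constructor
        · rintro ⟨s, hs, hx⟩
          exact ⟨s, x, ⟨hx, hs⟩, rfl⟩
        · rintro ⟨s, y, ⟨hx, hs⟩, rfl⟩
          exact ⟨s, hs, hx⟩
      rw [this, Set.inter_comm]
      have hcomp : IsCompact (Set.Icc (0 : ℝ) h) := isCompact_Icc
      have h2 := isClosedMap_snd_of_compactSpace (X := Set.Icc (0 : ℝ) h) (Y := E (n + 1))
      have hcl : IsClosed ((fun p : Set.Icc (0 : ℝ) h × E (n + 1) => p.2 + (p.1 : ℝ) • e) ⁻¹' Ωᶜ) :=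
        hΩ.isClosed_compl.preimage (by fun_prop)
      convert h2 _ hcl using 1
      ext x
      constructor
      · rintro ⟨⟨s, y⟩, ⟨⟨hs, _⟩, hx⟩, rfl⟩
        exact ⟨(⟨s, hs⟩, y), hx, rfl⟩
      · rintro ⟨⟨s, y⟩, hx, rfl⟩
        exact ⟨(s.1, y), ⟨⟨s.2, trivial⟩, hx⟩, rfl⟩
    exact isClosed_compl_iff.mp hclosed
  -- the function of the starting point which has to vanish
  have hshear : Integrable (fun p : ℝ × E (n + 1) => g' (p.2 + p.1 • e))
      ((volume.restrict (Set.Ioc 0 h)).prod volume) := by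
    have h1 : Integrable (fun p : ℝ × E (n + 1) => g' p.2)
        ((volume.restrict (Set.Ioc 0 h)).prod volume) := hg'.comp_snd _
    exact (measurePreserving_shear i h).integrable_comp_of_integrable h1
  let I : E (n + 1) → ℝ := fun x => ∫ s in Set.Ioc 0 h, g' (x + s • e)
  have hI : Integrable I := hshear.integral_prod_right
  have hfs : Integrable fun x => f' (x + h • e) := hf'.comp_add_right _
  have hF : Integrable fun x => f' (x + h • e) - f' x - I x := (hfs.sub hf').sub hI
  have hae := hU.ae_eq_zero_of_integral_contDiff_smul_eq_zero
    (μ := (volume : Measure (E (n + 1)))) (hF.locallyIntegrable.locallyIntegrableOn U) ?_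
  · filter_upwards [hae] with x hx hxU
    have h0 := hx hxU
    have h1 : f' (x + h • e) = f (x + h • e) :=
      Set.indicator_of_mem (hxU h ⟨hh, le_rfl⟩) f
    have h2 : f' x = f x := Set.indicator_of_mem (by simpa using hxU 0 ⟨le_rfl, hh⟩) f
    have h3 : I x = ∫ s in (0 : ℝ)..h, g (x + s • e) := by
      rw [intervalIntegral.integral_of_le hh]
      exact setIntegral_congr_fun measurableSet_Ioc fun s hs =>
        Set.indicator_of_mem (hxU s ⟨hs.1.le, hs.2⟩) g
    rw [h1, h2, h3] at h0
    linarith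
  · intro φ hφ hc hs
    have hφ0 : ContDiff ℝ (⊤ : ℕ∞) φ := hφ
    obtain ⟨C, hC⟩ := hφ.continuous.bounded_above_of_compact_support hc
    have key : ∀ {u : E (n + 1) → ℝ} (a : E (n + 1)), Integrable u →
        Integrable fun x => φ (x - a) * u x := by
      intro u a hu
      exact Integrable.bdd_mul (c := C) hu
        (hφ.continuous.comp (by fun_prop : Continuous fun x => x - a)).aestronglyMeasurable
        (Eventually.of_forall fun x => hC _)
    have key0 : ∀ {u : E (n + 1) → ℝ}, Integrable u → Integrable fun x => φ x * u x := by
      intro u hu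
      simpa using key 0 hu
    set Φ : E (n + 1) → ℝ := fun x => ∫ s in Set.Ioc 0 h, φ (x - s • e) with hΦ
    -- the support of the averaged test function
    have hcompact : IsCompact ((fun p : ℝ × E (n + 1) => p.2 + p.1 • e) ''
        (Set.Icc 0 h ×ˢ tsupport φ)) :=
      (isCompact_Icc.prod hc).image (by fun_prop)
    have hzero : ∀ x ∉ (fun p : ℝ × E (n + 1) => p.2 + p.1 • e) '' (Set.Icc 0 h ×ˢ tsupport φ),
        Φ x = 0 := by
      intro x hx
      rw [hΦ]
      refine setIntegral_eq_zero_of_forall_eq_zero fun s hs => ?_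
      by_contra hne
      exact hx ⟨(s, x - s • e), ⟨⟨hs.1.le, hs.2⟩, subset_tsupport _ hne⟩, by simp⟩
    have hΦc : HasCompactSupport Φ := HasCompactSupport.intro hcompact hzero
    have hΦs : tsupport Φ ⊆ Ω := by
      have h1 : tsupport Φ ⊆ (fun p : ℝ × E (n + 1) => p.2 + p.1 • e) ''
          (Set.Icc 0 h ×ˢ tsupport φ) :=
        closure_minimal (fun x hx => by_contra fun h' => hx (hzero x h')) hcompact.isClosed
      refine h1.trans ?_
      rintro _ ⟨⟨s, y⟩, ⟨hs', hy⟩, rfl⟩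
      exact hs hy s hs'
    have hweak := hw Φ (contDiff_segment_integral e h hφ0 hc) hΦc hΦs
    have hind : ∀ (u v : E (n + 1) → ℝ), ∫ x in Ω, u x * v x = ∫ x, u x * Ω.indicator v x := by
      intro u v
      rw [← integral_indicator hΩ.measurableSet]
      congr 1 with x
      by_cases hx : x ∈ Ω <;> simp [hx]
    rw [hind, hind] at hweak
    have hder : ∀ x, fderiv ℝ Φ x (unitVec i) = φ x - φ (x - h • e) :=
      fderiv_segment_integral e hh hφ0 hc
    simp_rw [hder, sub_mul] at hweak
    rw [integral_sub (key0 hf') (key (h • e) hf')] at hweak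
    have t1 : ∫ x, φ (x - h • e) * f' x = ∫ x, φ x * f' (x + h • e) := by
      rw [← integral_add_right_eq_self (fun x => φ (x - h • e) * f' x) (h • e)]
      simp
    have t2 : ∫ x, Φ x * g' x = ∫ x, φ x * I x := by
      change ∫ x, (∫ s in Set.Ioc 0 h, φ (x - s • e)) * g' x = _
      simp_rw [I, ← integral_mul_const, ← integral_const_mul]
      have hp1 : Integrable (Function.uncurry fun (s : ℝ) (x : E (n + 1)) => φ (x - s • e) * g' x)
          ((volume.restrict (Set.Ioc 0 h)).prod volume) := by
        refine Integrable.bdd_mul (c := C) (hg'.comp_snd _) ?_ (Eventually.of_forall fun p => hC _)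
        exact (hφ.continuous.comp (by fun_prop : Continuous fun p : ℝ × E (n + 1) =>
          p.2 - p.1 • e)).aestronglyMeasurable
      have hp2 : Integrable (Function.uncurry fun (s : ℝ) (x : E (n + 1)) => φ x * g' (x + s • e))
          ((volume.restrict (Set.Ioc 0 h)).prod volume) := by
        refine Integrable.bdd_mul (c := C) hshear ?_ (Eventually.of_forall fun p => hC _)
        exact (hφ.continuous.comp continuous_snd).aestronglyMeasurable
      rw [← integral_integral_swap hp1, ← integral_integral_swap hp2]
      congr 1 with s
      rw [← integral_add_right_eq_self (fun x => φ (x - s • e) * g' x) (s • e)]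
      simp
    rw [t1, t2] at hweak
    have t3 : ∫ x, φ x • (f' (x + h • e) - f' x - I x)
        = (∫ x, φ x * f' (x + h • e)) - (∫ x, φ x * f' x) - ∫ x, φ x * I x := by
      have h1 : Integrable fun x => φ x * f' (x + h • e) - φ x * f' x := (key0 hfs).sub (key0 hf')
      simp_rw [smul_eq_mul, mul_sub]
      rw [integral_sub h1 (key0 hI), integral_sub (key0 hfs) (key0 hf')]
    rw [t3]
    linarith

/-- A function that is continuous in an open set `Ω` and up to a part `B` of its boundary, and has
an integrable weak derivative in `Ω`, is the primitive of that derivative on almost every line, along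
all segments with interior in `Ω` and end points in `Ω ∪ B`. -/
theorem HasWeakPartial.ae_line {Ω B : Set (E (n + 1))} (hΩ : IsOpen Ω) {i : Fin (n + 1)}
    {f g : E (n + 1) → ℝ} (hw : HasWeakPartial Ω i f g) (hf : IntegrableOn f Ω)
    (hg : IntegrableOn g Ω) (hfc : ContinuousOn f (Ω ∪ B)) :
    ∀ᵐ y : E n, ∀ a b, a < b → linePoint i y a ∈ Ω ∪ B → linePoint i y b ∈ Ω ∪ B →
      (∀ t ∈ Set.Ioo a b, linePoint i y t ∈ Ω) →
      f (linePoint i y b) - f (linePoint i y a) =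
        ∫ t in a..b, Ω.indicator g (linePoint i y t) := by
  have hg' : Integrable (Ω.indicator g) := hg.integrable_indicator hΩ.measurableSet
  have h1 : ∀ᵐ x : E (n + 1), ∀ q : ℚ, 0 ≤ q →
      (∀ s ∈ Set.Icc 0 (q : ℝ), x + s • unitVec i ∈ Ω) →
      f (x + (q : ℝ) • unitVec i) - f x = ∫ s in (0 : ℝ)..q, g (x + s • unitVec i) := by
    refine ae_all_iff.mpr fun q => ?_
    by_cases hq : 0 ≤ q
    · filter_upwards [hw.ae_sub_eq_integral hΩ hf hg (h := (q : ℝ)) (by exact_mod_cast hq)]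
        with x hx _ using hx
    · exact Eventually.of_forall fun x h => absurd h hq
  have h2 : ∀ᵐ p ∂((volume : Measure ℝ).prod (volume : Measure (E n))), ∀ q : ℚ, 0 ≤ q →
      (∀ s ∈ Set.Icc 0 (q : ℝ), linePoint i p.2 p.1 + s • unitVec i ∈ Ω) →
      f (linePoint i p.2 p.1 + (q : ℝ) • unitVec i) - f (linePoint i p.2 p.1)
        = ∫ s in (0 : ℝ)..q, g (linePoint i p.2 p.1 + s • unitVec i) :=
    (measurePreserving_linePoint i).quasiMeasurePreserving.ae h1
  have h3 : ∀ᵐ y : E n, ∀ᵐ t : ℝ, ∀ q : ℚ, 0 ≤ q →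
      (∀ s ∈ Set.Icc 0 (q : ℝ), linePoint i y t + s • unitVec i ∈ Ω) →
      f (linePoint i y t + (q : ℝ) • unitVec i) - f (linePoint i y t)
        = ∫ s in (0 : ℝ)..q, g (linePoint i y t + s • unitVec i) := Measure.ae_ae_of_ae_prod
    (Measure.measurePreserving_swap.quasiMeasurePreserving.ae h2)
  have h4 : ∀ᵐ y : E n, Integrable fun t => Ω.indicator g (linePoint i y t) := by
    have := (measurePreserving_linePoint i).integrable_comp_of_integrable hg'
    exact this.prod_left_ae
  filter_upwards [h3, h4] with y hy hgi a b hab ha hb hΩ'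
  by_contra hne
  have hline : Continuous (linePoint i y) := continuous_linePoint i y
  have hmem : ∀ t ∈ Set.Icc a b, linePoint i y t ∈ Ω ∪ B := by
    intro t ht
    rcases eq_or_lt_of_le ht.1 with rfl | h1
    · exact ha
    · rcases eq_or_lt_of_le ht.2 with rfl | h2
      · exact hb
      · exact Or.inl (hΩ' t ⟨h1, h2⟩)
  have hfl : ContinuousOn (fun t => f (linePoint i y t)) (Set.Icc a b) :=
    hfc.comp hline.continuousOn hmem
  have hprim : Continuous fun t => ∫ s in (0 : ℝ)..t, Ω.indicator g (linePoint i y s) :=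
    intervalIntegral.continuous_primitive (fun _ _ => hgi.intervalIntegrable) 0
  -- the defect of the identity is a continuous difference `W b - W a`
  set W : ℝ → ℝ := fun t =>
    f (linePoint i y t) - ∫ s in (0 : ℝ)..t, Ω.indicator g (linePoint i y s) with hW
  have hWc : ContinuousOn W (Set.Icc a b) := hfl.sub hprim.continuousOn
  have hdiff : ∀ s t, W t - W s = f (linePoint i y t) - f (linePoint i y s)
      - ∫ u in s..t, Ω.indicator g (linePoint i y u) := by
    intro s t
    have := intervalIntegral.integral_interval_sub_left
      (hgi.intervalIntegrable (a := 0) (b := t)) (hgi.intervalIntegrable (a := 0) (b := s))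
    simp only [hW]
    linarith
  have hWne : W b ≠ W a := fun h => hne (by
    have := hdiff a b
    rw [h, sub_self] at this
    linarith)
  obtain ⟨u, v, hu, hv, hbu, hav, huv⟩ := t2_separation hWne
  have hmid : a < (a + b) / 2 ∧ (a + b) / 2 < b := ⟨by linarith, by linarith⟩
  have hWa : ∀ᶠ t in 𝓝[>] a, W t ∈ v ∧ t < (a + b) / 2 := by
    have h5 : Tendsto W (𝓝[>] a) (𝓝 (W a)) := by
      rw [← nhdsWithin_Ioo_eq_nhdsGT hab]
      exact (hWc a ⟨le_rfl, hab.le⟩).mono_left (nhdsWithin_mono _ Set.Ioo_subset_Icc_self)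
    exact (h5.eventually_mem (hv.mem_nhds hav)).and
      (nhdsWithin_le_nhds (gt_mem_nhds hmid.1))
  have hWb : ∀ᶠ t in 𝓝[<] b, W t ∈ u ∧ (a + b) / 2 < t := by
    have h5 : Tendsto W (𝓝[<] b) (𝓝 (W b)) := by
      rw [← nhdsWithin_Ioo_eq_nhdsLT hab]
      exact (hWc b ⟨hab.le, le_rfl⟩).mono_left (nhdsWithin_mono _ Set.Ioo_subset_Icc_self)
    exact (h5.eventually_mem (hu.mem_nhds hbu)).and
      (nhdsWithin_le_nhds (lt_mem_nhds hmid.2))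
  obtain ⟨a', ha', hWa'⟩ := mem_nhdsGT_iff_exists_Ioo_subset.mp hWa
  obtain ⟨b', hb', hWb'⟩ := mem_nhdsLT_iff_exists_Ioo_subset.mp hWb
  -- a generic starting point near `a`, and an end point near `b` at rational distance
  have hne' : (ae (volume.restrict (Set.Ioo a a'))).NeBot := by
    rw [ae_neBot, Ne, Measure.restrict_eq_zero, Real.volume_Ioo, ENNReal.ofReal_eq_zero, not_le]
    exact sub_pos.mpr ha'
  obtain ⟨s, hsgood, hs1, hs2⟩ :=
    ((ae_restrict_of_ae (s := Set.Ioo a a') hy).and (ae_restrict_mem measurableSet_Ioo)).exists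
  obtain ⟨q, hq1, hq2⟩ := exists_rat_btwn (show b' - s < b - s by
    have : b' < b := hb'
    linarith)
  have hWs := hWa' ⟨hs1, hs2⟩
  have hWt := hWb' (show s + q ∈ Set.Ioo b' b from ⟨by linarith, by linarith⟩)
  have hq0 : (0 : ℝ) ≤ q := by
    have h6 := hWs.2
    have h7 := hWt.2
    linarith
  have h8 := hsgood q (by exact_mod_cast hq0) (fun τ hτ => by
    rw [← linePoint_add]
    exact hΩ' _ ⟨by linarith [hτ.1], by linarith [hτ.2]⟩)
  have h9 : W (s + q) - W s = 0 := by
    rw [hdiff, linePoint_add, h8, sub_eq_zero]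
    have h10 : ∫ t in s..(s + q), Ω.indicator g (linePoint i y t)
        = ∫ t in (0 : ℝ)..q, Ω.indicator g (linePoint i y (s + t)) := by
      rw [intervalIntegral.integral_comp_add_left (fun t => Ω.indicator g (linePoint i y t)) s,
        add_zero]
    rw [h10]
    refine intervalIntegral.integral_congr fun t ht => ?_
    rw [Set.uIcc_of_le hq0] at ht
    rw [Set.indicator_of_mem, linePoint_add]
    exact hΩ' _ ⟨by linarith [ht.1], by linarith [ht.2]⟩
  exact Set.disjoint_left.mp huv hWt.1 (by rw [sub_eq_zero.mp h9]; exact hWs.1)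

/-! ### Simplices and barycentric coordinates -/

/-- The vertex sets of nondegenerate `(n+1)`-simplices of `ℝ^(n+1)`. -/
structure IsFullSimplex (T : Finset (E (n + 1))) : Prop where
  indep : AffineIndependent ℝ ((↑) : T → E (n + 1))
  card_eq : T.card = n + 1 + 1

/-- The vertices of a full simplex as an affine basis. -/
def IsFullSimplex.basis {T : Finset (E (n + 1))} (hT : IsFullSimplex T) :
    AffineBasis T ℝ (E (n + 1)) :=
  ⟨(↑), hT.indep, by
    rw [hT.indep.affineSpan_eq_top_iff_card_eq_finrank_add_one]
    simp [hT.card_eq]⟩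

open Classical in
/-- The barycentric coordinate of a full simplex `T` belonging to the vertex `v`; it is set to `0`
if `T` is not a full simplex or `v` not a vertex of `T`. -/
def bary (T : Finset (E (n + 1))) (v : E (n + 1)) : E (n + 1) →ᵃ[ℝ] ℝ :=
  if h : IsFullSimplex T ∧ v ∈ T then h.1.basis.coord ⟨v, h.2⟩ else 0

/-- The gradient of the barycentric coordinate belonging to `v`: an inward normal, not normalised,
of the facet opposite to `v`. -/
def facetNormal (T : Finset (E (n + 1))) (v : E (n + 1)) : E (n + 1) :=
  (InnerProductSpace.toDual ℝ (E (n + 1))).symm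
    (LinearMap.toContinuousLinearMap (bary T v).linear)

lemma bary_add (T : Finset (E (n + 1))) (v x u : E (n + 1)) :
    bary T v (x + u) = bary T v x + ⟪facetNormal T v, u⟫ := by
  have h := (bary T v).map_vadd x u
  rw [vadd_eq_add, vadd_eq_add, add_comm u x] at h
  rw [facetNormal, InnerProductSpace.toDual_symm_apply, h, add_comm]
  rfl

lemma bary_sub (T : Finset (E (n + 1))) (v x y : E (n + 1)) :
    bary T v y - bary T v x = ⟪facetNormal T v, y - x⟫ := by
  have := bary_add T v x (y - x)
  rw [add_sub_cancel] at this
  rw [this, add_sub_cancel_left]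

lemma continuous_bary (T : Finset (E (n + 1))) (v : E (n + 1)) : Continuous (bary T v) :=
  AffineMap.continuous_of_finiteDimensional _

namespace IsFullSimplex

variable {T : Finset (E (n + 1))}

lemma bary_eq (hT : IsFullSimplex T) (v : T) : bary T v = hT.basis.coord v := by
  rw [bary, dif_pos ⟨hT, v.2⟩]

lemma bary_self (hT : IsFullSimplex T) {v : E (n + 1)} (hv : v ∈ T) : bary T v v = 1 := by
  rw [hT.bary_eq ⟨v, hv⟩]
  exact hT.basis.coord_apply_eq ⟨v, hv⟩

lemma bary_ne (hT : IsFullSimplex T) {v w : E (n + 1)} (hv : v ∈ T) (hw : w ∈ T) (h : v ≠ w) :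
    bary T v w = 0 := by
  rw [hT.bary_eq ⟨v, hv⟩]
  exact hT.basis.coord_apply_ne (i := ⟨v, hv⟩) (j := ⟨w, hw⟩)
    fun e => h (congrArg Subtype.val e)

lemma range_basis (hT : IsFullSimplex T) : Set.range hT.basis = (T : Set (E (n + 1))) :=
  Subtype.range_coe

lemma mem_simplex_iff (hT : IsFullSimplex T) {x : E (n + 1)} :
    x ∈ simplex T ↔ ∀ v ∈ T, 0 ≤ bary T v x := by
  rw [simplex, ← hT.range_basis, hT.basis.convexHull_eq_nonneg_coord]
  constructor
  · intro h v hv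
    rw [hT.bary_eq ⟨v, hv⟩]
    exact h ⟨v, hv⟩
  · intro h v
    rw [← hT.bary_eq v]
    exact h v v.2

lemma mem_interior_iff (hT : IsFullSimplex T) {x : E (n + 1)} :
    x ∈ interior (simplex T) ↔ ∀ v ∈ T, 0 < bary T v x := by
  rw [simplex, ← hT.range_basis, hT.basis.interior_convexHull]
  constructor
  · intro h v hv
    rw [hT.bary_eq ⟨v, hv⟩]
    exact h ⟨v, hv⟩
  · intro h v
    rw [← hT.bary_eq v]
    exact h v v.2

lemma bary_eq_zero_of_mem_face (hT : IsFullSimplex T) {S : Set (E (n + 1))}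
    (hS : S ⊆ (T : Set (E (n + 1)))) {x : E (n + 1)} (hx : x ∈ convexHull ℝ S) {v : E (n + 1)}
    (hv : v ∈ T) (hvS : v ∉ S) : bary T v x = 0 := by
  have hconv : Convex ℝ {y | bary T v y = 0} :=
    (convex_singleton (0 : ℝ)).affine_preimage (bary T v)
  refine convexHull_min (fun w hw => ?_) hconv hx
  exact hT.bary_ne hv (hS hw) fun h => hvS (h ▸ hw)

lemma mem_face (hT : IsFullSimplex T) {S : Finset (E (n + 1))} {x : E (n + 1)}
    (hx : x ∈ simplex T) (h : ∀ v ∈ T, v ∉ S → bary T v x = 0) : x ∈ simplex S := by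
  classical
  have h1 := hT.basis.linear_combination_coord_eq_self x
  have h2 := hT.basis.sum_coord_apply_eq_one x
  have hb : ∀ v : T, hT.basis v = (v : E (n + 1)) := fun v => rfl
  simp_rw [← hT.bary_eq] at h1 h2
  rw [← h1]
  have h3 : ∑ v : T, bary T v x • hT.basis v = ∑ v ∈ T.filter (· ∈ S), bary T v x • v := by
    rw [Finset.sum_filter]
    simp_rw [hb]
    rw [Finset.sum_coe_sort T fun v => bary T v x • v]
    refine Finset.sum_congr rfl fun v hv => ?_
    split_ifs with hvS
    · rfl
    · rw [h v hv hvS, zero_smul]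
  have h4 : ∑ v ∈ T.filter (· ∈ S), bary T v x = 1 := by
    rw [← h2, Finset.sum_coe_sort T fun v => bary T v x, Finset.sum_filter]
    refine Finset.sum_congr rfl fun v hv => ?_
    split_ifs with hvS
    · rfl
    · rw [h v hv hvS]
  rw [h3]
  refine (convex_convexHull ℝ (S : Set (E (n + 1)))).sum_mem (fun v hv => ?_) h4 fun v hv => ?_
  · exact hT.mem_simplex_iff.mp hx v (Finset.mem_filter.mp hv).1
  · exact subset_convexHull ℝ _ (Finset.mem_filter.mp hv).2

lemma facetNormal_ne_zero (hT : IsFullSimplex T) {v : E (n + 1)} (hv : v ∈ T) :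
    facetNormal T v ≠ 0 := by
  intro h
  obtain ⟨w, hw, hwv⟩ : ∃ w ∈ T, w ≠ v := by
    refine Finset.exists_mem_ne ?_ v
    rw [hT.card_eq]
    omega
  have h1 := bary_sub T v w v
  rw [h, inner_zero_left, hT.bary_self hv, hT.bary_ne hv hw hwv.symm] at h1
  norm_num at h1

end IsFullSimplex

lemma isClosed_simplex (s : Finset (E (n + 1))) : IsClosed (simplex s) :=
  s.finite_toSet.isClosed_convexHull ℝ

lemma isCompact_simplex (s : Finset (E (n + 1))) : IsCompact (simplex s) :=
  s.finite_toSet.isCompact_convexHull ℝ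

lemma euclideanHausdorffMeasure_submodule_eq_zero (V : Submodule ℝ (E (n + 1))) {m : ℕ}
    (hV : Module.finrank ℝ V < m) : μHE[m] (V : Set (E (n + 1))) = 0 := by
  rw [Measure.euclideanHausdorffMeasure_def, Measure.smul_apply]
  have h1 : dimH (V : Set (E (n + 1))) < (m : NNReal) := by
    have h2 : dimH (Subtype.val '' (Set.univ : Set V)) = dimH (Set.univ : Set V) :=
      isometry_subtype_coe.dimH_image _
    rw [Set.image_univ, Subtype.range_coe_subtype] at h2
    rw [show (V : Set (E (n + 1))) = {x | x ∈ V} from rfl, h2, Real.dimH_univ_eq_finrank]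
    exact_mod_cast hV
  have := hausdorffMeasure_of_dimH_lt h1
  simp only [NNReal.coe_natCast] at this
  rw [this, smul_zero]

lemma simplex_subset_image_vectorSpan {s : Finset (E (n + 1))} {p : E (n + 1)} (hp : p ∈ s) :
    simplex s ⊆ (fun v => p + v) '' (vectorSpan ℝ (s : Set (E (n + 1))) : Set (E (n + 1))) := by
  intro x hx
  refine ⟨x - p, ?_, by simp⟩
  rw [SetLike.mem_coe, ← direction_affineSpan]
  exact AffineSubspace.vsub_mem_direction (convexHull_subset_affineSpan _ hx)
    (subset_affineSpan ℝ _ hp)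

/-! ### The local structure of the mesh -/

namespace Mesh

variable (𝒯 : Mesh (n + 1))

/-- The union of the faces of codimension at least two of a mesh, those with at most `n` vertices
in `ℝ^(n+1)`. -/
def lowSkeleton : Set (E (n + 1)) :=
  ⋃ s ∈ {s | s ∈ 𝒯.faces ∧ s.card ≤ n}, simplex s

lemma euclideanHausdorffMeasure_lowSkeleton : μHE[n] 𝒯.lowSkeleton = 0 := by
  rw [lowSkeleton, measure_biUnion_null_iff
    (𝒯.finite_faces.subset fun s hs => hs.1).countable]
  rintro s ⟨hs, hc⟩
  obtain ⟨p, hp⟩ := 𝒯.nonempty_of_mem_faces hs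
  have hpos : 0 < s.card := Finset.card_pos.mpr ⟨p, hp⟩
  refine measure_mono_null (simplex_subset_image_vectorSpan hp) ?_
  have hiso : Isometry fun v : E (n + 1) => p + v := isometry_add_left p
  rw [hiso.euclideanHausdorffMeasure_image]
  refine euclideanHausdorffMeasure_submodule_eq_zero _ ?_
  have h1 := (𝒯.indep hs).finrank_vectorSpan (n := s.card - 1) (by
    rw [Fintype.card_coe]; omega)
  rw [Subtype.range_coe_subtype] at h1
  have h2 : {x | x ∈ s} = (s : Set (E (n + 1))) := rfl
  rw [h2] at h1
  omega

variable {𝒯}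

lemma mem_elements {T : Finset (E (n + 1))} :
    T ∈ 𝒯.elements ↔ T ∈ 𝒯.faces ∧ T.card = n + 1 + 1 := by
  simp [elements]

lemma isFullSimplex {T : Finset (E (n + 1))} (hT : T ∈ 𝒯.elements) : IsFullSimplex T :=
  ⟨𝒯.indep (mem_elements.mp hT).1, (mem_elements.mp hT).2⟩

lemma mem_active {Ω : Set (E (n + 1))} {T : Finset (E (n + 1))} :
    T ∈ 𝒯.active Ω ↔ T ∈ 𝒯.elements ∧ (simplex T ∩ Ω).Nonempty := by
  simp [active]

open Classical in
lemma mem_interiorFaces {Ω : Set (E (n + 1))} {F : Finset (E (n + 1))} :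
    F ∈ 𝒯.interiorFaces Ω ↔ F ∈ 𝒯.faces ∧ F.card = n + 1 ∧
      ∃ S ∈ 𝒯.active Ω, ∃ T ∈ 𝒯.active Ω, S ≠ T ∧ F = S ∩ T := by
  simp only [interiorFaces, Finset.mem_filter, Set.Finite.mem_toFinset]

/-- Off the low-dimensional skeleton at most one barycentric coordinate vanishes: locally a simplex
is the whole space or a half space. -/
lemma bary_pos_of_notMem_lowSkeleton {T : Finset (E (n + 1))} (hT : T ∈ 𝒯.elements)
    {x : E (n + 1)} (hx : x ∈ simplex T) (hZ : x ∉ 𝒯.lowSkeleton) {v w : E (n + 1)} (hv : v ∈ T)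
    (hw : w ∈ T) (hvw : v ≠ w) (hv0 : bary T v x = 0) : 0 < bary T w x := by
  classical
  have hF := isFullSimplex hT
  refine lt_of_le_of_ne (hF.mem_simplex_iff.mp hx w hw) fun h0 => hZ ?_
  have hmem : x ∈ simplex ((T.erase v).erase w) := hF.mem_face hx fun u hu hu' => by
    simp only [Finset.mem_erase, not_and] at hu'
    by_cases h1 : u = w
    · rw [h1, h0]
    · by_cases h2 : u = v
      · rw [h2, hv0]
      · exact absurd hu (hu' h1 h2)
  have hne : ((T.erase v).erase w).Nonempty := by
    rw [Finset.nonempty_iff_ne_empty]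
    intro he
    rw [he, simplex, Finset.coe_empty, convexHull_empty] at hmem
    exact hmem
  have hcard : ((T.erase v).erase w).card ≤ n := by
    rw [Finset.card_erase_of_mem (Finset.mem_erase.mpr ⟨hvw.symm, hw⟩),
      Finset.card_erase_of_mem hv, hF.card_eq]
    omega
  exact Set.mem_biUnion (x := (T.erase v).erase w)
    ⟨𝒯.down_closed (mem_elements.mp hT).1
      ((Finset.erase_subset _ _).trans (Finset.erase_subset _ _)) hne, hcard⟩ hmem

/-- A direction that points into the half space in which an element lies enters the element. -/
lemma eventually_mem_interior {T : Finset (E (n + 1))} (hT : T ∈ 𝒯.elements)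
    {x : E (n + 1)} (hx : x ∈ simplex T) {u : E (n + 1)}
    (hu : ∀ v ∈ T, bary T v x = 0 → 0 < ⟪facetNormal T v, u⟫) :
    ∀ᶠ t in 𝓝[>] (0 : ℝ), x + t • u ∈ interior (simplex T) := by
  have hF := isFullSimplex hT
  simp_rw [hF.mem_interior_iff]
  rw [eventually_all_finset]
  intro v hv
  rcases eq_or_lt_of_le (hF.mem_simplex_iff.mp hx v hv) with h0 | hpos
  · filter_upwards [self_mem_nhdsWithin] with t ht
    rw [bary_add, ← h0, zero_add, inner_smul_right]
    exact mul_pos ht (hu v hv h0.symm)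
  · have hc : ContinuousAt (fun t : ℝ => bary T v (x + t • u)) 0 :=
      ((continuous_bary T v).comp (by fun_prop)).continuousAt
    refine nhdsWithin_le_nhds (hc.eventually_mem (Ioi_mem_nhds ?_))
    simpa using hpos

/-- Different elements have disjoint interiors. -/
lemma eq_of_mem_interior {S T : Finset (E (n + 1))} (hS : S ∈ 𝒯.elements) (hT : T ∈ 𝒯.elements)
    {x : E (n + 1)} (hxS : x ∈ simplex S) (hxT : x ∈ interior (simplex T)) : S = T := by
  have hF := isFullSimplex hT
  have hmem := 𝒯.inter_subset_convexHull (mem_elements.mp hS).1 (mem_elements.mp hT).1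
    ⟨hxS, interior_subset hxT⟩
  have hsub : T ⊆ S := by
    intro v hv
    by_contra hvS
    have h0 := hF.bary_eq_zero_of_mem_face Set.inter_subset_right hmem hv fun h => hvS h.1
    exact (hF.mem_interior_iff.mp hxT v hv).ne' h0
  exact (Finset.eq_of_subset_of_card_le hsub
    (by rw [(mem_elements.mp hS).2, (mem_elements.mp hT).2])).symm

/-- If the points `x + t u` are covered by the mesh for small `t > 0`, some element containing `x`
contains points of the form `x + t u` with `t` arbitrarily small. -/
lemma exists_element_frequently {x u : E (n + 1)}
    (hcov : ∀ᶠ t in 𝓝[>] (0 : ℝ), x + t • u ∈ ⋃ T ∈ 𝒯.elements, simplex T) :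
    ∃ T ∈ 𝒯.elements, x ∈ simplex T ∧ ∃ᶠ t in 𝓝[>] (0 : ℝ), x + t • u ∈ simplex T := by
  have h1 : ∃ᶠ t in 𝓝[>] (0 : ℝ), ∃ T ∈ 𝒯.elements, x + t • u ∈ simplex T := by
    refine (hcov.mono fun t ht => ?_).frequently
    simpa using ht
  by_contra hno
  push Not at hno
  refine h1 ?_
  have h2 : ∀ T ∈ 𝒯.elements, ∀ᶠ t in 𝓝[>] (0 : ℝ), x + t • u ∉ simplex T := by
    intro T hT
    by_cases hxT : x ∈ simplex T
    · exact hno T hT hxT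
    · have hc : ContinuousAt (fun t : ℝ => x + t • u) 0 := by fun_prop
      refine nhdsWithin_le_nhds (hc.eventually_mem ((isClosed_simplex T).isOpen_compl.mem_nhds ?_))
      simpa using hxT
  filter_upwards [(eventually_all_finset 𝒯.elements).mpr h2] with t ht
  push Not
  exact ht

/-- A direction transversal to all facets at `x` enters an element. -/
lemma exists_element_entering {x u : E (n + 1)}
    (hcov : ∀ᶠ t in 𝓝[>] (0 : ℝ), x + t • u ∈ ⋃ T ∈ 𝒯.elements, simplex T)
    (htrans : ∀ T ∈ 𝒯.elements, x ∈ simplex T → ∀ v ∈ T, bary T v x = 0 →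
      ⟪facetNormal T v, u⟫ ≠ 0) :
    ∃ T ∈ 𝒯.elements, x ∈ simplex T ∧ ∀ v ∈ T, bary T v x = 0 → 0 < ⟪facetNormal T v, u⟫ := by
  obtain ⟨T, hT, hxT, hfr⟩ := exists_element_frequently hcov
  refine ⟨T, hT, hxT, fun v hv hv0 => lt_of_le_of_ne ?_ (htrans T hT hxT v hv hv0).symm⟩
  obtain ⟨t, ht, ht0⟩ := (hfr.and_eventually self_mem_nhdsWithin).exists
  have h1 := (isFullSimplex hT).mem_simplex_iff.mp ht v hv
  rw [bary_add, hv0, zero_add, inner_smul_right] at h1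
  exact nonneg_of_mul_nonneg_right h1 ht0

end Mesh

namespace Mesh

variable {𝒯 : Mesh (n + 1)} {Ω : Set (E (n + 1))}

lemma inner_eq_of_mem_simplex {F : Finset (E (n + 1))} {ν : E (n + 1)}
    (hν : ∀ x ∈ F, ∀ y ∈ F, ⟪ν, x - y⟫ = 0) {x y : E (n + 1)} (hx : x ∈ simplex F)
    (hy : y ∈ simplex F) : ⟪ν, x - y⟫ = 0 := by
  obtain ⟨p, hp⟩ : F.Nonempty := by
    rw [Finset.nonempty_iff_ne_empty]
    rintro rfl
    simp [simplex] at hx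
  have hconv : Convex ℝ {z : E (n + 1) | ⟪ν, z⟫ = ⟪ν, p⟫} :=
    (convex_singleton ⟪ν, p⟫).linear_preimage (innerSL ℝ ν).toLinearMap
  have hsub : simplex F ⊆ {z : E (n + 1) | ⟪ν, z⟫ = ⟪ν, p⟫} := by
    refine convexHull_min (fun z hz => ?_) hconv
    have := hν z hz p hp
    rwa [inner_sub_right, sub_eq_zero] at this
  rw [inner_sub_right, sub_eq_zero, hsub hx, hsub hy]

/-- The normal direction of a facet is unique up to scaling. -/
lemma exists_smul_eq_of_orthogonal {F : Finset (E (n + 1))} (hF : F ∈ 𝒯.faces)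
    (hc : F.card = n + 1) {ν g : E (n + 1)} (hν0 : ν ≠ 0)
    (hν : ∀ x ∈ F, ∀ y ∈ F, ⟪ν, x - y⟫ = 0) (hg : ∀ x ∈ F, ∀ y ∈ F, ⟪g, x - y⟫ = 0) :
    ∃ a : ℝ, a • ν = g := by
  have key : ∀ w : E (n + 1), (∀ x ∈ F, ∀ y ∈ F, ⟪w, x - y⟫ = 0) →
      w ∈ (vectorSpan ℝ (F : Set (E (n + 1))))ᗮ := by
    intro w hw
    rw [Submodule.mem_orthogonal']
    intro u hu
    rw [vectorSpan_def] at hu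
    induction hu using Submodule.span_induction with
    | mem z hz =>
      obtain ⟨x, hx, y, hy, rfl⟩ := Set.mem_vsub.mp hz
      exact hw x hx y hy
    | zero => simp
    | add a b _ _ ha hb => rw [inner_add_right, ha, hb, add_zero]
    | smul a b _ hb => rw [inner_smul_right, hb, mul_zero]
  have h1 : Module.finrank ℝ (vectorSpan ℝ (F : Set (E (n + 1)))) = n := by
    have h2 := (𝒯.indep hF).finrank_vectorSpan (n := n) (by rw [Fintype.card_coe, hc])
    rw [Subtype.range_coe_subtype] at h2
    exact h2
  have h3 : Module.finrank ℝ (vectorSpan ℝ (F : Set (E (n + 1))))ᗮ = 1 :=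
    Submodule.finrank_add_finrank_orthogonal' (by rw [h1]; simp)
  obtain ⟨a, ha⟩ := (finrank_eq_one_iff_of_nonzero'
    (⟨ν, key ν hν⟩ : (vectorSpan ℝ (F : Set (E (n + 1))))ᗮ)
    (fun h => hν0 (congrArg Subtype.val h))).mp h3 ⟨g, key g hg⟩
  exact ⟨a, congrArg Subtype.val ha⟩

lemma exists_eq_erase_of_card_eq {S F : Finset (E (n + 1))} [DecidableEq (E (n + 1))]
    (hS : S.card = n + 1 + 1) (hFS : F ⊆ S) (hF : F.card = n + 1) :
    ∃ v ∈ S, F = S.erase v := by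
  have h1 : (S \ F).card = 1 := by
    rw [Finset.card_sdiff_of_subset hFS, hS, hF]
    omega
  obtain ⟨v, hv⟩ := Finset.card_eq_one.mp h1
  have hvm : v ∈ S \ F := hv ▸ Finset.mem_singleton_self v
  refine ⟨v, (Finset.mem_sdiff.mp hvm).1, ?_⟩
  rw [← Finset.sdiff_singleton_eq_erase, ← hv, Finset.sdiff_sdiff_eq_self hFS]

/-- An element lies locally on one side of each of its facets: with respect to a unit normal `ν`
of the facet the side is given by the sign of a nonzero number `a`. -/
lemma exists_side {F S : Finset (E (n + 1))} (hS : S ∈ 𝒯.elements) (hF : F ∈ 𝒯.faces)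
    (hFc : F.card = n + 1) (hFS : F ⊆ S) {ν : E (n + 1)} (hν1 : ‖ν‖ = 1)
    (hν : ∀ x ∈ F, ∀ y ∈ F, ⟪ν, x - y⟫ = 0) {x : E (n + 1)} (hx : x ∈ simplex F)
    (hZ : x ∉ 𝒯.lowSkeleton) :
    ∃ a : ℝ, a ≠ 0 ∧ ∀ u : E (n + 1), 0 < a * ⟪ν, u⟫ →
      ∀ v ∈ S, bary S v x = 0 → 0 < ⟪facetNormal S v, u⟫ := by
  classical
  have hFull := isFullSimplex hS
  obtain ⟨v, hv, rfl⟩ := exists_eq_erase_of_card_eq hFull.card_eq hFS hFc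
  have hxS : x ∈ simplex S := convexHull_mono (by exact_mod_cast hFS) hx
  have hv0 : bary S v x = 0 :=
    hFull.bary_eq_zero_of_mem_face (by exact_mod_cast hFS) hx hv (by simp)
  have hg : ∀ y ∈ S.erase v, ∀ z ∈ S.erase v, ⟪facetNormal S v, y - z⟫ = 0 := by
    intro y hy z hz
    rw [← bary_sub, hFull.bary_ne hv (Finset.mem_of_mem_erase hy) (Finset.ne_of_mem_erase hy).symm,
      hFull.bary_ne hv (Finset.mem_of_mem_erase hz) (Finset.ne_of_mem_erase hz).symm, sub_zero]
  have hν0 : ν ≠ 0 := by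
    rintro rfl
    simp at hν1
  obtain ⟨a, ha⟩ := exists_smul_eq_of_orthogonal hF hFc hν0 hν hg
  refine ⟨a, ?_, fun u hu w hw hw0 => ?_⟩
  · rintro rfl
    rw [zero_smul] at ha
    exact hFull.facetNormal_ne_zero hv ha.symm
  · by_cases hvw : v = w
    · subst hvw
      rw [← ha, inner_smul_left]
      exact hu
    · exact absurd hw0 (bary_pos_of_notMem_lowSkeleton hS hxS hZ hv hw hvw hv0).ne'

/-- At a point of an interior face off the low-dimensional skeleton there is one element on each
side. -/
lemma exists_elements_of_mem_face {F : Finset (E (n + 1))} (hF : F ∈ 𝒯.interiorFaces Ω)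
    {ν : E (n + 1)} (hν1 : ‖ν‖ = 1) (hν : ∀ x ∈ F, ∀ y ∈ F, ⟪ν, x - y⟫ = 0) {x : E (n + 1)}
    (hx : x ∈ simplex F) (hZ : x ∉ 𝒯.lowSkeleton) :
    ∃ P ∈ 𝒯.active Ω, ∃ M ∈ 𝒯.active Ω,
      (∀ u, ⟪ν, u⟫ < 0 → ∀ᶠ t in 𝓝[>] (0 : ℝ), x + t • u ∈ interior (simplex P)) ∧
      (∀ u, 0 < ⟪ν, u⟫ → ∀ᶠ t in 𝓝[>] (0 : ℝ), x + t • u ∈ interior (simplex M)) := by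
  classical
  obtain ⟨hFf, hFc, S, hS, T, hT, hST, hFeq⟩ := mem_interiorFaces.mp hF
  have hSe := (mem_active.mp hS).1
  have hTe := (mem_active.mp hT).1
  have hFS : F ⊆ S := hFeq ▸ Finset.inter_subset_left
  have hFT : F ⊆ T := hFeq ▸ Finset.inter_subset_right
  have hxS : x ∈ simplex S := convexHull_mono (by exact_mod_cast hFS) hx
  have hxT : x ∈ simplex T := convexHull_mono (by exact_mod_cast hFT) hx
  obtain ⟨a, ha0, ha⟩ := exists_side hSe hFf hFc hFS hν1 hν hx hZ
  obtain ⟨a', ha0', ha'⟩ := exists_side hTe hFf hFc hFT hν1 hν hx hZ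
  have hS' : ∀ u, 0 < a * ⟪ν, u⟫ → ∀ᶠ t in 𝓝[>] (0 : ℝ), x + t • u ∈ interior (simplex S) :=
    fun u hu => eventually_mem_interior hSe hxS (ha u hu)
  have hT' : ∀ u, 0 < a' * ⟪ν, u⟫ → ∀ᶠ t in 𝓝[>] (0 : ℝ), x + t • u ∈ interior (simplex T) :=
    fun u hu => eventually_mem_interior hTe hxT (ha' u hu)
  -- no direction enters both elements
  have hopp : ∀ u, ¬ (0 < a * ⟪ν, u⟫ ∧ 0 < a' * ⟪ν, u⟫) := by
    rintro u ⟨h1, h2⟩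
    obtain ⟨t, ht1, ht2⟩ := ((hS' u h1).and (hT' u h2)).exists
    exact hST (eq_of_mem_interior hSe hTe (interior_subset ht1) ht2)
  have hνν : ⟪ν, ν⟫ = (1 : ℝ) := by rw [real_inner_self_eq_norm_sq, hν1, one_pow]
  rcases lt_or_gt_of_ne ha0 with hneg | hpos
  · have hpos' : 0 < a' := by
      refine lt_of_le_of_ne (not_lt.mp fun h => hopp (-ν) ?_) ha0'.symm
      rw [inner_neg_right, hνν]
      exact ⟨by linarith, by linarith⟩
    exact ⟨S, hS, T, hT, fun u hu => hS' u (mul_pos_of_neg_of_neg hneg hu),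
      fun u hu => hT' u (mul_pos hpos' hu)⟩
  · have hneg' : a' < 0 := by
      refine lt_of_le_of_ne (not_lt.mp fun h => hopp ν ?_) ha0'
      rw [hνν]
      exact ⟨by linarith, by linarith⟩
    exact ⟨T, hT, S, hS, fun u hu => hT' u (mul_pos_of_neg_of_neg hneg' hu),
      fun u hu => hS' u (mul_pos hpos hu)⟩

/-- Every point of `Ω` off the low-dimensional skeleton lies in the interior of an active element
or on an interior face. -/
lemma mem_interior_or_mem_face (hΩ : IsOpen Ω) (hcov : 𝒯.Covers Ω) {x : E (n + 1)}
    (hx : x ∈ Ω) (hZ : x ∉ 𝒯.lowSkeleton) :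
    (∃ T ∈ 𝒯.active Ω, x ∈ interior (simplex T)) ∨ ∃ F ∈ 𝒯.interiorFaces Ω, x ∈ simplex F := by
  classical
  obtain ⟨T, hT, hxT⟩ : ∃ T ∈ 𝒯.elements, x ∈ simplex T := by
    have := hcov (subset_closure hx)
    simpa using this
  have hFull := isFullSimplex hT
  have hTa : T ∈ 𝒯.active Ω := mem_active.mpr ⟨hT, x, hxT, hx⟩
  by_cases hint : x ∈ interior (simplex T)
  · exact Or.inl ⟨T, hTa, hint⟩
  right
  obtain ⟨v, hv, hv0⟩ : ∃ v ∈ T, bary T v x = 0 := by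
    rw [hFull.mem_interior_iff] at hint
    push Not at hint
    obtain ⟨v, hv, hle⟩ := hint
    exact ⟨v, hv, le_antisymm hle (hFull.mem_simplex_iff.mp hxT v hv)⟩
  -- look at the other side of the facet
  set u : E (n + 1) := -facetNormal T v with hu
  have hcont : ContinuousAt (fun t : ℝ => x + t • u) 0 := by fun_prop
  have hcov' : ∀ᶠ t in 𝓝[>] (0 : ℝ), x + t • u ∈ ⋃ T ∈ 𝒯.elements, simplex T := by
    refine nhdsWithin_le_nhds ((hcont.eventually_mem (hΩ.mem_nhds (by simpa using hx))).mono ?_)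
    exact fun t ht => hcov (subset_closure ht)
  obtain ⟨S, hS, hxS, hfr⟩ := exists_element_frequently hcov'
  have hST : S ≠ T := by
    rintro rfl
    obtain ⟨t, ht, ht0⟩ := (hfr.and_eventually self_mem_nhdsWithin).exists
    have h1 := hFull.mem_simplex_iff.mp ht v hv
    rw [bary_add, hv0, zero_add, inner_smul_right, hu, inner_neg_right,
      real_inner_self_eq_norm_sq] at h1
    have h2 : 0 < ‖facetNormal S v‖ := norm_pos_iff.mpr (hFull.facetNormal_ne_zero hv)
    have h3 : 0 < t := ht0
    have h4 : 0 < t * ‖facetNormal S v‖ ^ 2 := by positivity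
    linarith
  have hmem := 𝒯.inter_subset_convexHull (mem_elements.mp hS).1 (mem_elements.mp hT).1 ⟨hxS, hxT⟩
  have hsub : T.erase v ⊆ S := by
    intro w hw
    by_contra hwS
    have h0 := hFull.bary_eq_zero_of_mem_face Set.inter_subset_right hmem
      (Finset.mem_of_mem_erase hw) fun h => hwS h.1
    exact (bary_pos_of_notMem_lowSkeleton hT hxT hZ hv (Finset.mem_of_mem_erase hw)
      (Finset.ne_of_mem_erase hw).symm hv0).ne' h0
  have hvS : v ∉ S := by
    intro hvS
    refine hST (Finset.eq_of_subset_of_card_le (fun w hw => ?_) ?_).symm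
    · by_cases h : w = v
      · exact h ▸ hvS
      · exact hsub (Finset.mem_erase.mpr ⟨h, hw⟩)
    · rw [(mem_elements.mp hS).2, (mem_elements.mp hT).2]
  have hcard : (T.erase v).card = n + 1 := by
    rw [Finset.card_erase_of_mem hv, hFull.card_eq]
    omega
  refine ⟨T.erase v, mem_interiorFaces.mpr ⟨𝒯.down_closed (mem_elements.mp hT).1
    (Finset.erase_subset _ _) (Finset.card_pos.mp (by omega)), hcard, S,
    mem_active.mpr ⟨hS, x, hxS, hx⟩, T, hTa, hST, ?_⟩, ?_⟩
  · ext w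
    simp only [Finset.mem_erase, Finset.mem_inter]
    constructor
    · rintro ⟨h1, h2⟩
      exact ⟨hsub (Finset.mem_erase.mpr ⟨h1, h2⟩), h2⟩
    · rintro ⟨h1, h2⟩
      exact ⟨fun h => hvS (h ▸ h1), h2⟩
  · refine hFull.mem_face hxT fun w hw hw' => ?_
    have : w = v := by
      by_contra h
      exact hw' (Finset.mem_erase.mpr ⟨h, hw⟩)
    rw [this, hv0]

lemma euclideanHausdorffMeasure_simplex_lt_top {F : Finset (E (n + 1))} (hF : F ∈ 𝒯.faces)
    (hFc : F.card = n + 1) : μHE[n] (simplex F) < ∞ := by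
  obtain ⟨p, hp⟩ := 𝒯.nonempty_of_mem_faces hF
  set V := vectorSpan ℝ (F : Set (E (n + 1))) with hV
  have hrank : Module.finrank ℝ V = n := by
    have h2 := (𝒯.indep hF).finrank_vectorSpan (n := n) (by rw [Fintype.card_coe, hFc])
    rw [Subtype.range_coe_subtype] at h2
    exact h2
  let f : V → E (n + 1) := fun v => p + v
  have hf : Isometry f := (isometry_add_left p).comp isometry_subtype_coe
  have himg : simplex F = f '' (f ⁻¹' simplex F) := by
    refine (Set.image_preimage_eq_of_subset ?_).symm
    intro x hx
    obtain ⟨v, hv, rfl⟩ := simplex_subset_image_vectorSpan hp hx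
    exact ⟨⟨v, hv⟩, rfl⟩
  rw [himg, hf.euclideanHausdorffMeasure_image]
  have hcomp : IsCompact (f ⁻¹' simplex F) :=
    hf.isClosedEmbedding.isCompact_preimage (isCompact_simplex F)
  have : (μHE[n] : Measure V) = volume := by
    rw [← InnerProductSpace.euclideanHausdorffMeasure_eq_volume, hrank]
  rw [this]
  exact hcomp.measure_lt_top

lemma isTangentSurface_face (hΩ : IsOpen Ω) {F : Finset (E (n + 1))} {ν : E (n + 1)}
    (hν1 : ‖ν‖ = 1) (hν : ∀ x ∈ F, ∀ y ∈ F, ⟪ν, x - y⟫ = 0) :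
    IsTangentSurface (simplex F ∩ Ω) fun _ => ν where
  measurableSet := (isClosed_simplex F).measurableSet.inter hΩ.measurableSet
  norm_eq_one _ _ := hν1
  continuousOn := continuousOn_const
  tangent _ _ δ hδ := ⟨1, one_pos, fun x hx y hy => by
    rw [inner_eq_of_mem_simplex hν hx.1.1 hy.1.1, abs_zero]
    positivity⟩

end Mesh

/-! ### The regular part of the boundary -/

section Normal

variable {Ω : Set (E (n + 1))} {x N N' : E (n + 1)}

lemma fderiv_apply_eq_inner_gradient (φ : E (n + 1) → ℝ) (x u : E (n + 1)) :
    fderiv ℝ φ x u = ⟪gradient φ x, u⟫ := by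
  rw [gradient, InnerProductSpace.toDual_symm_apply]

/-- A defining function has the sign of `⟪∇φ(x), u⟫` along the ray in the direction `u`. -/
lemma eventually_mul_pos_of_inner_gradient_ne_zero {φ : E (n + 1) → ℝ} {x u : E (n + 1)}
    (hφ : DifferentiableAt ℝ φ x) (h0 : φ x = 0) (hu : ⟪gradient φ x, u⟫ ≠ 0) :
    ∀ᶠ t in 𝓝[>] (0 : ℝ), 0 < φ (x + t • u) * ⟪gradient φ x, u⟫ := by
  have h1 : HasDerivAt (fun t : ℝ => x + t • u) u 0 := by
    simpa using ((hasDerivAt_id (0 : ℝ)).smul_const u).const_add x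
  have h2 : HasDerivAt (fun t : ℝ => φ (x + t • u)) ⟪gradient φ x, u⟫ 0 := by
    rw [← fderiv_apply_eq_inner_gradient]
    have h3 : HasFDerivAt φ (fderiv ℝ φ x) (x + (0 : ℝ) • u) := by
      simpa using hφ.hasFDerivAt
    exact h3.comp_hasDerivAt (0 : ℝ) h1
  have h4 := (hasDerivAt_iff_tendsto_slope.mp h2).mono_left
    (nhdsWithin_mono (0 : ℝ) fun t (ht : 0 < t) => ht.ne')
  have h5 := (h4.mul_const ⟪gradient φ x, u⟫).eventually_const_lt (mul_self_pos.mpr hu)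
  filter_upwards [h5, self_mem_nhdsWithin] with t ht ht0
  have ht0' : (0 : ℝ) < t := ht0
  rw [slope_def_field, sub_zero, zero_smul, add_zero, h0, sub_zero, div_mul_eq_mul_div] at ht
  exact (div_pos_iff_of_pos_right ht0').mp ht

namespace IsOuterNormal

lemma norm_eq_one (h : IsOuterNormal Ω x N) : ‖N‖ = 1 := by
  obtain ⟨U, φ, -, -, -, -, hg, -, rfl⟩ := h
  rw [norm_smul, norm_inv, norm_norm, inv_mul_cancel₀ (norm_ne_zero_iff.mpr hg)]

/-- Directions at an obtuse angle with the outer normal point into `Ω`. -/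
lemma eventually_mem (h : IsOuterNormal Ω x N) {u : E (n + 1)} (hu : ⟪N, u⟫ < 0) :
    ∀ᶠ t in 𝓝[>] (0 : ℝ), x + t • u ∈ Ω := by
  obtain ⟨U, φ, hU, hxU, hφ, h0, hg, hΩ, rfl⟩ := h
  have hg' : 0 < ‖gradient φ x‖⁻¹ := inv_pos.mpr (norm_pos_iff.mpr hg)
  rw [real_inner_smul_left] at hu
  have hneg : ⟪gradient φ x, u⟫ < 0 := (pos_iff_neg_of_mul_neg hu).mp hg'
  have hd := (hφ.differentiableOn one_ne_zero).differentiableAt (hU.mem_nhds hxU)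
  have hc : ContinuousAt (fun t : ℝ => x + t • u) 0 := by fun_prop
  filter_upwards [eventually_mul_pos_of_inner_gradient_ne_zero hd h0 hneg.ne,
    nhdsWithin_le_nhds (hc.eventually_mem (hU.mem_nhds (by simpa using hxU)))] with t h1 h2
  have : x + t • u ∈ Ω ∩ U := hΩ ▸ ⟨h2, by nlinarith⟩
  exact this.1

/-- Directions at an acute angle with the outer normal point out of `Ω`. -/
lemma eventually_notMem (h : IsOuterNormal Ω x N) {u : E (n + 1)} (hu : 0 < ⟪N, u⟫) :
    ∀ᶠ t in 𝓝[>] (0 : ℝ), x + t • u ∉ Ω := by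
  obtain ⟨U, φ, hU, hxU, hφ, h0, hg, hΩ, rfl⟩ := h
  have hg' : 0 < ‖gradient φ x‖⁻¹ := inv_pos.mpr (norm_pos_iff.mpr hg)
  rw [real_inner_smul_left] at hu
  have hpos : 0 < ⟪gradient φ x, u⟫ := pos_of_mul_pos_right hu hg'.le
  have hd := (hφ.differentiableOn one_ne_zero).differentiableAt (hU.mem_nhds hxU)
  have hc : ContinuousAt (fun t : ℝ => x + t • u) 0 := by fun_prop
  filter_upwards [eventually_mul_pos_of_inner_gradient_ne_zero hd h0 hpos.ne',
    nhdsWithin_le_nhds (hc.eventually_mem (hU.mem_nhds (by simpa using hxU)))] with t h1 h2 h3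
  have : x + t • u ∈ {y ∈ U | φ y < 0} := hΩ ▸ ⟨h3, h2⟩
  nlinarith [this.2]

/-- The outer normal is unique: the direction `N' - N` would point into `Ω` for `N` and out of `Ω`
for `N'`. -/
lemma unique (h : IsOuterNormal Ω x N) (h' : IsOuterNormal Ω x N') : N = N' := by
  by_contra hne
  have h1 := (inner_lt_one_iff_real_of_norm_eq_one h.norm_eq_one h'.norm_eq_one).mpr hne
  have h2 : ⟪N, N' - N⟫ < 0 := by
    rw [inner_sub_right, real_inner_self_eq_norm_sq, h.norm_eq_one]
    linarith
  have h3 : 0 < ⟪N', N' - N⟫ := by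
    rw [inner_sub_right, real_inner_self_eq_norm_sq, h'.norm_eq_one, real_inner_comm]
    linarith
  obtain ⟨t, ht1, ht2⟩ := ((h.eventually_mem h2).and (h'.eventually_notMem h3)).exists
  exact ht2 ht1

lemma outerNormal_eq (h : IsOuterNormal Ω x N) : outerNormal Ω x = N := by
  have hex : ∃ m, IsOuterNormal Ω x m := ⟨N, h⟩
  rw [outerNormal, dif_pos hex]
  exact hex.choose_spec.unique h

/-- Near a point with an outer normal, one defining function describes `Ω`, `∂Ω` and the normal. -/
lemma exists_defining_function (hΩ : IsOpen Ω) (h : IsOuterNormal Ω x N) :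
    ∃ (V : Set (E (n + 1))) (φ : E (n + 1) → ℝ), IsOpen V ∧ x ∈ V ∧ ContDiffOn ℝ 1 φ V ∧
      (∀ y ∈ V, gradient φ y ≠ 0) ∧ ContinuousOn (gradient φ) V ∧
      ∀ y ∈ frontier Ω ∩ V, φ y = 0 ∧
        IsOuterNormal Ω y (‖gradient φ y‖⁻¹ • gradient φ y) := by
  obtain ⟨U, φ, hU, hxU, hφ, h0, hg, hset, -⟩ := h
  have hcont : ContinuousOn (gradient φ) U :=
    (InnerProductSpace.toDual ℝ (E (n + 1))).symm.continuous.comp_continuousOn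
      (hφ.continuousOn_fderiv_of_isOpen hU le_rfl)
  have hV : IsOpen (U ∩ gradient φ ⁻¹' {0}ᶜ) := hcont.isOpen_inter_preimage hU isOpen_compl_singleton
  refine ⟨U ∩ gradient φ ⁻¹' {0}ᶜ, φ, hV, ⟨hxU, hg⟩, hφ.mono Set.inter_subset_left,
    fun y hy => hy.2, hcont.mono Set.inter_subset_left, ?_⟩
  rintro y ⟨hyf, hyU, hyg⟩
  have hy0 : φ y = 0 := by
    refine le_antisymm (not_lt.mp fun hpos => ?_) (not_lt.mp fun hneg => ?_)
    · have hopen : IsOpen (U ∩ φ ⁻¹' Set.Ioi 0) :=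
        hφ.continuousOn.isOpen_inter_preimage hU isOpen_Ioi
      obtain ⟨z, ⟨hz1, hz2⟩, hz3⟩ := mem_closure_iff.mp (frontier_subset_closure hyf) _ hopen
        ⟨hyU, hpos⟩
      have hz4 : z ∈ {y ∈ U | φ y < 0} := hset ▸ ⟨hz3, hz1⟩
      exact lt_asymm hz4.2 hz2
    · have hy1 : y ∈ Ω ∩ U := hset ▸ ⟨hyU, hneg⟩
      rw [hΩ.frontier_eq] at hyf
      exact hyf.2 hy1.1
  exact ⟨hy0, U, φ, hU, hyU, hφ, hy0, hyg, hset, rfl⟩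

end IsOuterNormal

lemma isOuterNormal_outerNormal (hx : x ∈ regularBoundary Ω) :
    IsOuterNormal Ω x (outerNormal Ω x) := by
  obtain ⟨-, N, hN⟩ := hx
  rwa [hN.outerNormal_eq]

/-- The regular part of the boundary is relatively open in the boundary. -/
lemma measurableSet_regularBoundary (hΩ : IsOpen Ω) : MeasurableSet (regularBoundary Ω) := by
  have : regularBoundary Ω =
      frontier Ω ∩ ⋃₀ {V | IsOpen V ∧ frontier Ω ∩ V ⊆ regularBoundary Ω} := by
    ext x
    constructor
    · rintro ⟨hx, N, hN⟩
      obtain ⟨V, φ, hV, hxV, -, -, -, h⟩ := hN.exists_defining_function hΩ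
      exact ⟨hx, V, ⟨hV, fun y hy => ⟨hy.1, _, (h y hy).2⟩⟩, hxV⟩
    · rintro ⟨hx, V, ⟨-, hV⟩, hxV⟩
      exact hV ⟨hx, hxV⟩
  rw [this]
  exact isClosed_frontier.measurableSet.inter
    (isOpen_sUnion fun V hV => hV.1).measurableSet

/-- The regular part of the boundary is a hypersurface with continuous normal and, by strict
differentiability of the defining functions, uniformly tangent to its tangent planes. -/
lemma isTangentSurface_regularBoundary (hΩ : IsOpen Ω) :
    IsTangentSurface (regularBoundary Ω) (outerNormal Ω) where
  measurableSet := measurableSet_regularBoundary hΩ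
  norm_eq_one x hx := (isOuterNormal_outerNormal hx).norm_eq_one
  continuousOn x hx := by
    obtain ⟨N, hN⟩ := hx.2
    obtain ⟨V, φ, hV, hxV, -, hg, hc, h⟩ := hN.exists_defining_function hΩ
    have hca : ContinuousAt (fun y => ‖gradient φ y‖⁻¹ • gradient φ y) x := by
      have h1 : ContinuousAt (gradient φ) x := hc.continuousAt (hV.mem_nhds hxV)
      exact (h1.norm.inv₀ (norm_ne_zero_iff.mpr (hg x hxV))).smul h1
    refine hca.continuousWithinAt.congr_of_eventuallyEq_of_mem ?_ hx
    filter_upwards [self_mem_nhdsWithin, nhdsWithin_le_nhds (hV.mem_nhds hxV)] with y hy hyV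
    exact (h y ⟨hy.1, hyV⟩).2.outerNormal_eq
  tangent x hx δ hδ := by
    obtain ⟨N, hN⟩ := hx.2
    obtain ⟨V, φ, hV, hxV, hφ, hg, hc, h⟩ := hN.exists_defining_function hΩ
    have hpos : 0 < ‖gradient φ x‖ := norm_pos_iff.mpr (hg x hxV)
    have hstrict : HasStrictFDerivAt φ (fderiv ℝ φ x) x :=
      (hφ.contDiffAt (hV.mem_nhds hxV)).hasStrictFDerivAt one_ne_zero
    have hev := hstrict.isLittleO.def (mul_pos hδ hpos)
    rw [nhds_prod_eq, Metric.nhds_basis_ball.prod_self.eventually_iff] at hev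
    obtain ⟨r₁, hr₁, hr₁'⟩ := hev
    obtain ⟨r₂, hr₂, hr₂'⟩ := Metric.isOpen_iff.mp hV x hxV
    refine ⟨min r₁ r₂, lt_min hr₁ hr₂, fun y hy z hz => ?_⟩
    have hyV : y ∈ V := hr₂' (Metric.ball_subset_ball (min_le_right _ _) hy.2)
    have hzV : z ∈ V := hr₂' (Metric.ball_subset_ball (min_le_right _ _) hz.2)
    have h1 := hr₁' (x := (y, z)) ⟨Metric.ball_subset_ball (min_le_left _ _) hy.2,
      Metric.ball_subset_ball (min_le_left _ _) hz.2⟩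
    simp only [(h y ⟨hy.1.1, hyV⟩).1, (h z ⟨hz.1.1, hzV⟩).1, sub_zero, zero_sub, norm_neg,
      fderiv_apply_eq_inner_gradient, Real.norm_eq_abs] at h1
    have hx' : x ∈ frontier Ω ∩ V := ⟨hx.1, hxV⟩
    rw [(h x hx').2.outerNormal_eq, real_inner_smul_left, abs_mul, abs_inv, abs_norm,
      inv_mul_le_iff₀ hpos]
    linarith

/-- The set where a hypersurface meets a hyperplane transversally has lower dimension: locally it
projects injectively, with Lipschitz inverse, to the orthogonal complement of both normals. -/
lemma IsTangentSurface.null_of_inner_eq_const {M : Set (E (n + 1))}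
    {N : E (n + 1) → E (n + 1)} (hM : IsTangentSurface M N) {g : E (n + 1)} (hg : g ≠ 0) (c : ℝ) :
    μHE[n] {x ∈ M | ⟪g, x⟫ = c ∧ ∀ a : ℝ, a • g ≠ N x} = 0 := by
  refine measure_null_of_locally_null _ fun x₀ hx₀ => ?_
  set S := {x ∈ M | ⟪g, x⟫ = c ∧ ∀ a : ℝ, a • g ≠ N x} with hS
  set V := Submodule.span ℝ (Set.range ![g, N x₀]) with hV
  have hrank : Module.finrank ℝ Vᗮ < n := by
    have hli : LinearIndependent ℝ ![g, N x₀] :=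
      (LinearIndependent.pair_iff' hg).mpr hx₀.2.2
    have h1 : Module.finrank ℝ V = 2 := by simpa using finrank_span_eq_card hli
    have h2 := V.finrank_add_finrank_orthogonal
    rw [h1, finrank_euclideanSpace_fin] at h2
    omega
  let P : E (n + 1) →L[ℝ] E (n + 1) := Vᗮ.starProjection
  let L : E (n + 1) →ₗ[ℝ] E (n + 1) × ℝ × ℝ :=
    P.toLinearMap.prod ((innerSL ℝ g).toLinearMap.prod (innerSL ℝ (N x₀)).toLinearMap)
  have hker : LinearMap.ker L = ⊥ := by
    rw [LinearMap.ker_eq_bot']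
    intro u hu
    obtain ⟨h1, h2, h3⟩ : P u = 0 ∧ ⟪g, u⟫ = (0 : ℝ) ∧ ⟪N x₀, u⟫ = (0 : ℝ) := by
      simpa [L] using hu
    have hu1 : u ∈ Vᗮ := by
      rw [hV, Submodule.mem_orthogonal]
      intro w hw
      induction hw using Submodule.span_induction with
      | mem z hz =>
        obtain ⟨i, rfl⟩ := hz
        fin_cases i
        · exact h2
        · exact h3
      | zero => simp
      | add a b _ _ ha hb => rw [inner_add_left, ha, hb, add_zero]
      | smul a b _ hb => rw [inner_smul_left, hb, mul_zero]
    rwa [Submodule.starProjection_eq_self_iff.mpr hu1] at h1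
  obtain ⟨K, hK, hL⟩ := L.exists_antilipschitzWith hker
  have hK' : (0 : ℝ) < K := hK
  obtain ⟨r, hr, htan⟩ := hM.tangent x₀ hx₀.1 (1 / (2 * K)) (by positivity)
  refine ⟨S ∩ Metric.ball x₀ r, inter_mem self_mem_nhdsWithin
    (nhdsWithin_le_nhds (Metric.ball_mem_nhds x₀ hr)), ?_⟩
  -- chords of `S` are orthogonal to `g` and almost orthogonal to `N x₀`
  have hanti : ∀ x ∈ S ∩ Metric.ball x₀ r, ∀ y ∈ S ∩ Metric.ball x₀ r,
      ‖x - y‖ ≤ K * ‖P x - P y‖ := by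
    intro x hx y hy
    have h1 := htan x ⟨hx.1.1, hx.2⟩ y ⟨hy.1.1, hy.2⟩
    have h2 := hL.le_mul_dist x y
    rw [dist_eq_norm, dist_eq_norm, ← map_sub] at h2
    have h3 : ⟪g, x - y⟫ = 0 := by rw [inner_sub_right, hx.1.2.1, hy.1.2.1, sub_self]
    have h4 : L (x - y) = (P x - P y, 0, ⟪N x₀, x - y⟫) := by
      simp [L, h3]
    have h5 : ‖L (x - y)‖ = max ‖P x - P y‖ |⟪N x₀, x - y⟫| := by
      rw [h4, Prod.norm_def, Prod.norm_def]
      simp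
    rw [h5] at h2
    rcases le_total ‖P x - P y‖ |⟪N x₀, x - y⟫| with h6 | h6
    · rw [max_eq_right h6] at h2
      have h9 : (K : ℝ) * |⟪N x₀, x - y⟫| ≤ K * (1 / (2 * K) * ‖x - y‖) := by gcongr
      have h7 : (K : ℝ) * (1 / (2 * K) * ‖x - y‖) = ‖x - y‖ / 2 := by field_simp
      have h8 : ‖x - y‖ ≤ 0 := by linarith
      exact h8.trans (by positivity)
    · rwa [max_eq_left h6] at h2
  have hinj : Set.InjOn P (S ∩ Metric.ball x₀ r) := by
    intro x hx y hy hxy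
    have := hanti x hx y hy
    rw [hxy, sub_self, norm_zero, mul_zero] at this
    exact sub_eq_zero.mp (norm_le_zero_iff.mp this)
  have hLip : LipschitzOnWith K (Function.invFunOn P (S ∩ Metric.ball x₀ r))
      (P '' (S ∩ Metric.ball x₀ r)) := by
    refine LipschitzOnWith.of_dist_le_mul ?_
    rintro _ ⟨x, hx, rfl⟩ _ ⟨y, hy, rfl⟩
    rw [hinj.leftInvOn_invFunOn hx, hinj.leftInvOn_invFunOn hy, dist_eq_norm, dist_eq_norm]
    exact hanti x hx y hy
  have himg := euclideanHausdorffMeasure_image_le_of_lipschitzOnWith hLip n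
  rw [hinj.leftInvOn_invFunOn.image_image] at himg
  have h0 : μHE[n] (P '' (S ∩ Metric.ball x₀ r)) = 0 := by
    refine measure_mono_null ?_ (euclideanHausdorffMeasure_submodule_eq_zero Vᗮ hrank)
    rintro _ ⟨x, -, rfl⟩
    exact Submodule.starProjection_apply_mem _ _
  rw [h0, mul_zero] at himg
  exact le_antisymm himg (zero_le)

end Normal

/-! ### The mesh at the boundary, and one-sided traces -/

namespace Mesh

variable {𝒯 : Mesh (n + 1)} {Ω : Set (E (n + 1))} {x : E (n + 1)}

/-- The exceptional boundary points: those where a facet of the mesh crosses `Γ` transversally, so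
that the trace from inside `Ω` may depend on the direction. -/
def crossing (𝒯 : Mesh (n + 1)) (Ω : Set (E (n + 1))) : Set (E (n + 1)) :=
  ⋃ T ∈ 𝒯.elements, ⋃ v ∈ T,
    {x ∈ regularBoundary Ω | bary T v x = 0 ∧ ∀ a : ℝ, a • facetNormal T v ≠ outerNormal Ω x}

lemma euclideanHausdorffMeasure_crossing (hΩ : IsOpen Ω) : μHE[n] (𝒯.crossing Ω) = 0 := by
  refine (measure_biUnion_null_iff 𝒯.elements.countable_toSet).mpr fun T hT => ?_
  refine (measure_biUnion_null_iff T.countable_toSet).mpr fun v hv => ?_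
  refine measure_mono_null ?_ ((isTangentSurface_regularBoundary hΩ).null_of_inner_eq_const
    ((isFullSimplex hT).facetNormal_ne_zero hv) (-bary T v 0))
  rintro x ⟨hx, hb, ha⟩
  refine ⟨hx, ?_, ha⟩
  have h := bary_add T v 0 x
  rw [zero_add, hb] at h
  linarith

/-- At a boundary point that is not exceptional, one active element fills the inner side. -/
lemma exists_active_of_mem_regularBoundary (hcov : 𝒯.Covers Ω) (hx : x ∈ regularBoundary Ω)
    (hx' : x ∉ 𝒯.crossing Ω) :
    ∃ T ∈ 𝒯.active Ω, x ∈ simplex T ∧ ∀ u, ⟪outerNormal Ω x, u⟫ < 0 →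
      ∀ᶠ t in 𝓝[>] (0 : ℝ), x + t • u ∈ interior (simplex T) := by
  have hN := isOuterNormal_outerNormal hx
  set N := outerNormal Ω x with hNdef
  have hNN : ⟪N, N⟫ = (1 : ℝ) := by rw [real_inner_self_eq_norm_sq, hN.norm_eq_one, one_pow]
  have hpar : ∀ T ∈ 𝒯.elements, ∀ v ∈ T, bary T v x = 0 → ∃ a : ℝ, a • facetNormal T v = N := by
    intro T hT v hv hb
    by_contra hne
    push Not at hne
    refine hx' ?_
    rw [crossing, Set.mem_iUnion₂]
    refine ⟨T, hT, ?_⟩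
    rw [Set.mem_iUnion₂]
    exact ⟨v, hv, hx, hb, hne⟩
  have hin : ∀ᶠ t in 𝓝[>] (0 : ℝ), x + t • (-N) ∈ Ω :=
    hN.eventually_mem (by rw [inner_neg_right, hNN]; norm_num)
  obtain ⟨T, hT, hxT, hent⟩ := exists_element_entering (𝒯 := 𝒯) (x := x) (u := -N)
    (hin.mono fun t ht => hcov (subset_closure ht)) (by
      intro T hT hxT v hv hb h0
      obtain ⟨a, ha⟩ := hpar T hT v hv hb
      rw [inner_neg_right, neg_eq_zero] at h0
      have h1 : ⟪N, N⟫ = a * ⟪facetNormal T v, N⟫ := by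
        nth_rw 1 [← ha]
        rw [real_inner_smul_left]
      rw [h0, mul_zero, hNN] at h1
      exact one_ne_zero h1)
  have hall : ∀ u, ⟪N, u⟫ < 0 → ∀ᶠ t in 𝓝[>] (0 : ℝ), x + t • u ∈ interior (simplex T) := by
    intro u hu
    refine eventually_mem_interior hT hxT fun v hv hb => ?_
    obtain ⟨a, ha⟩ := hpar T hT v hv hb
    have h0 := hent v hv hb
    rw [inner_neg_right] at h0
    have h1 : ⟪N, N⟫ = a * ⟪facetNormal T v, N⟫ := by
      nth_rw 1 [← ha]
      rw [real_inner_smul_left]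
    rw [hNN] at h1
    have ha0 : a < 0 := by nlinarith
    rw [← ha, real_inner_smul_left] at hu
    exact (neg_iff_pos_of_mul_neg hu).mp ha0
  obtain ⟨t, ht1, ht2⟩ :=
    (hin.and (hall (-N) (by rw [inner_neg_right, hNN]; norm_num))).exists
  exact ⟨T, mem_active.mpr ⟨hT, _, interior_subset ht2, ht1⟩, hxT, hall⟩

end Mesh

namespace DGSpace

variable {𝒯 : Mesh (n + 1)} {Ω : Set (E (n + 1))} {p : ℕ} (v : DGSpace 𝒯 Ω p)

lemma continuous_onElement (T : 𝒯.active Ω) : Continuous (v.onElement T) := by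
  unfold onElement
  exact (MvPolynomial.continuous_eval _).comp (by fun_prop)

lemma toFun_eq_of_mem_interior (T : 𝒯.active Ω) {x : E (n + 1)}
    (hx : x ∈ interior (simplex (T : Finset (E (n + 1))))) : v.toFun x = v.onElement T x := by
  rw [toFun, Finset.sum_eq_single T, Set.indicator_of_mem hx]
  · intro S _ hST
    refine Set.indicator_of_notMem (fun hxS => hST (Subtype.ext ?_)) _
    exact Mesh.eq_of_mem_interior (Mesh.mem_active.mp S.2).1 (Mesh.mem_active.mp T.2).1
      (interior_subset hxS) hx
  · exact fun h => absurd (Finset.mem_univ T) h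

lemma sideTrace_toFun_eq (T : 𝒯.active Ω) {ν x : E (n + 1)}
    (h : ∀ᶠ t in 𝓝[>] (0 : ℝ), x + t • (-ν) ∈ interior (simplex (T : Finset (E (n + 1))))) :
    sideTrace v.toFun ν x = v.onElement T x := by
  refine Tendsto.limUnder_eq ?_
  have hc : ContinuousAt (fun t : ℝ => v.onElement T (x - t • ν)) 0 :=
    ((v.continuous_onElement T).comp (by fun_prop)).continuousAt
  have hc' : Tendsto (fun t : ℝ => v.onElement T (x - t • ν)) (𝓝[>] 0) (𝓝 (v.onElement T x)) := by
    have := hc.tendsto.mono_left (nhdsWithin_le_nhds (s := Set.Ioi 0))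
    simpa using this
  refine hc'.congr' (h.mono fun t ht => ?_)
  rw [smul_neg, ← sub_eq_add_neg] at ht
  exact (v.toFun_eq_of_mem_interior T ht).symm

end DGSpace

/-! ### The fundamental theorem of calculus for broken functions on a line -/

lemma eventually_linePoint_right {P : E (n + 1) → Prop} {i : Fin (n + 1)} {y : E n} {t₀ : ℝ}
    (h : ∀ᶠ t in 𝓝[>] (0 : ℝ), P (linePoint i y t₀ + t • unitVec i)) :
    ∀ᶠ t in 𝓝[>] t₀, P (linePoint i y t) := by
  have h1 : Tendsto (fun t => t - t₀) (𝓝[>] t₀) (𝓝[>] 0) := by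
    refine tendsto_nhdsWithin_of_tendsto_nhds_of_eventually_within _ ?_ ?_
    · have : Tendsto (fun t => t - t₀) (𝓝 t₀) (𝓝 (t₀ - t₀)) := tendsto_id.sub_const t₀
      rw [sub_self] at this
      exact this.mono_left nhdsWithin_le_nhds
    · filter_upwards [self_mem_nhdsWithin] with t ht
      exact Set.mem_Ioi.mpr (sub_pos.mpr (Set.mem_Ioi.mp ht))
  filter_upwards [h1.eventually h] with t ht
  rwa [← linePoint_add, add_sub_cancel] at ht

lemma eventually_linePoint_left {P : E (n + 1) → Prop} {i : Fin (n + 1)} {y : E n} {t₀ : ℝ}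
    (h : ∀ᶠ t in 𝓝[>] (0 : ℝ), P (linePoint i y t₀ + t • (-unitVec i))) :
    ∀ᶠ t in 𝓝[<] t₀, P (linePoint i y t) := by
  have h1 : Tendsto (fun t => t₀ - t) (𝓝[<] t₀) (𝓝[>] 0) := by
    refine tendsto_nhdsWithin_of_tendsto_nhds_of_eventually_within _ ?_ ?_
    · have : Tendsto (fun t => t₀ - t) (𝓝 t₀) (𝓝 (t₀ - t₀)) := tendsto_id.const_sub t₀
      rw [sub_self] at this
      exact this.mono_left nhdsWithin_le_nhds
    · filter_upwards [self_mem_nhdsWithin] with t ht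
      exact Set.mem_Ioi.mpr (sub_pos.mpr (Set.mem_Iio.mp ht))
  filter_upwards [h1.eventually h] with t ht
  rwa [smul_neg, ← neg_smul, neg_sub, ← linePoint_add, add_sub_cancel] at ht

/-- The function equal to `f T` on `T ∩ Ω` for every active element `T`; it is `0` on the mesh
skeleton and outside `Ω`. -/
def brokenFun (𝒯 : Mesh (n + 1)) (Ω : Set (E (n + 1))) (f : 𝒯.active Ω → E (n + 1) → ℝ)
    (x : E (n + 1)) : ℝ :=
  ∑ T : 𝒯.active Ω, (interior (simplex (T : Finset (E (n + 1)))) ∩ Ω).indicator (f T) x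

section Broken

variable {𝒯 : Mesh (n + 1)} {Ω : Set (E (n + 1))} {f D : 𝒯.active Ω → E (n + 1) → ℝ}

lemma brokenFun_eq (T : 𝒯.active Ω) {x : E (n + 1)}
    (hx : x ∈ interior (simplex (T : Finset (E (n + 1))))) (hxΩ : x ∈ Ω) :
    brokenFun 𝒯 Ω f x = f T x := by
  rw [brokenFun, Finset.sum_eq_single T, Set.indicator_of_mem (Set.mem_inter hx hxΩ)]
  · intro S _ hST
    refine Set.indicator_of_notMem (fun hxS => hST (Subtype.ext ?_)) _
    exact Mesh.eq_of_mem_interior (Mesh.mem_active.mp S.2).1 (Mesh.mem_active.mp T.2).1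
      (interior_subset hxS.1) hx
  · exact fun h => absurd (Finset.mem_univ T) h

lemma brokenFun_eq_zero {x : E (n + 1)} (hx : x ∉ Ω) : brokenFun 𝒯 Ω f x = 0 :=
  Finset.sum_eq_zero fun _ _ => Set.indicator_of_notMem (fun h => hx h.2) _

/-- Fundamental theorem of calculus for `f T` on the segments of a line that run in `Ω`, with end
points in `Ω ∪ B`. -/
def HasLineDeriv (𝒯 : Mesh (n + 1)) (Ω B : Set (E (n + 1))) (f D : 𝒯.active Ω → E (n + 1) → ℝ)
    (i : Fin (n + 1)) (y : E n) : Prop :=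
  ∀ T : 𝒯.active Ω, ∀ a b, a < b → linePoint i y a ∈ Ω ∪ B → linePoint i y b ∈ Ω ∪ B →
    (∀ t ∈ Set.Ioo a b, linePoint i y t ∈ Ω) →
    f T (linePoint i y b) - f T (linePoint i y a) =
      ∫ t in a..b, Ω.indicator (D T) (linePoint i y t)

variable {B : Set (E (n + 1))} {i : Fin (n + 1)} {y : E n}

/-- If the line enters the element `T` behind the parameter `t₀`, the broken function has the
one-sided limit `f T` there; the limit is stated in integrated form. -/
lemma HasLineDeriv.eventually_right (h : HasLineDeriv 𝒯 Ω B f D i y) (T : 𝒯.active Ω) {t₀ : ℝ}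
    (ht₀ : linePoint i y t₀ ∈ Ω ∪ B)
    (hT : ∀ᶠ t in 𝓝[>] t₀, linePoint i y t ∈ interior (simplex (T : Finset (E (n + 1)))))
    (hΩ : ∀ᶠ t in 𝓝[>] t₀, linePoint i y t ∈ Ω) :
    ∀ᶠ t in 𝓝[>] t₀, brokenFun 𝒯 Ω f (linePoint i y t) =
      f T (linePoint i y t₀) + ∫ s in t₀..t, brokenFun 𝒯 Ω D (linePoint i y s) := by
  obtain ⟨c, hc, hcsub⟩ := mem_nhdsGT_iff_exists_Ioo_subset.mp (hT.and hΩ)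
  filter_upwards [Ioo_mem_nhdsGT hc] with t ht
  have h1 := h T t₀ t ht.1 ht₀ (Or.inl (hcsub ht).2)
    fun s hs => (hcsub ⟨hs.1, hs.2.trans ht.2⟩).2
  rw [brokenFun_eq T (hcsub ht).1 (hcsub ht).2, ← sub_eq_iff_eq_add', h1]
  refine intervalIntegral.integral_congr_ae (ae_of_all _ fun s hs => ?_)
  rw [Set.uIoc_of_le ht.1.le] at hs
  have hs' := hcsub ⟨hs.1, hs.2.trans_lt ht.2⟩
  rw [brokenFun_eq T hs'.1 hs'.2, Set.indicator_of_mem hs'.2]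

lemma HasLineDeriv.eventually_left (h : HasLineDeriv 𝒯 Ω B f D i y) (T : 𝒯.active Ω) {t₀ : ℝ}
    (ht₀ : linePoint i y t₀ ∈ Ω ∪ B)
    (hT : ∀ᶠ t in 𝓝[<] t₀, linePoint i y t ∈ interior (simplex (T : Finset (E (n + 1)))))
    (hΩ : ∀ᶠ t in 𝓝[<] t₀, linePoint i y t ∈ Ω) :
    ∀ᶠ t in 𝓝[<] t₀, brokenFun 𝒯 Ω f (linePoint i y t) +
      ∫ s in t..t₀, brokenFun 𝒯 Ω D (linePoint i y s) = f T (linePoint i y t₀) := by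
  obtain ⟨c, hc, hcsub⟩ := mem_nhdsLT_iff_exists_Ioo_subset.mp (hT.and hΩ)
  filter_upwards [Ioo_mem_nhdsLT hc] with t ht
  have h1 := h T t t₀ ht.2 (Or.inl (hcsub ht).2) ht₀
    fun s hs => (hcsub ⟨ht.1.trans hs.1, hs.2⟩).2
  rw [brokenFun_eq T (hcsub ht).1 (hcsub ht).2, ← eq_sub_iff_add_eq', h1]
  refine intervalIntegral.integral_congr_ae ?_
  filter_upwards [Measure.ae_ne volume t₀] with s hst hs
  rw [Set.uIoc_of_le ht.2.le] at hs
  have hs' := hcsub ⟨ht.1.trans hs.1, lt_of_le_of_ne hs.2 hst⟩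
  rw [brokenFun_eq T hs'.1 hs'.2, Set.indicator_of_mem hs'.2]

lemma eventually_right_of_notMem {t₀ : ℝ} (h : ∀ᶠ t in 𝓝[>] t₀, linePoint i y t ∉ Ω) :
    ∀ᶠ t in 𝓝[>] t₀, brokenFun 𝒯 Ω f (linePoint i y t) =
      0 + ∫ s in t₀..t, brokenFun 𝒯 Ω D (linePoint i y s) := by
  obtain ⟨c, hc, hcsub⟩ := mem_nhdsGT_iff_exists_Ioo_subset.mp h
  filter_upwards [Ioo_mem_nhdsGT hc] with t ht
  rw [brokenFun_eq_zero (hcsub ht), zero_add, eq_comm]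
  refine intervalIntegral.integral_zero_ae (ae_of_all _ fun s hs => ?_)
  rw [Set.uIoc_of_le ht.1.le] at hs
  exact brokenFun_eq_zero (hcsub ⟨hs.1, hs.2.trans_lt ht.2⟩)

lemma eventually_left_of_notMem {t₀ : ℝ} (h : ∀ᶠ t in 𝓝[<] t₀, linePoint i y t ∉ Ω) :
    ∀ᶠ t in 𝓝[<] t₀, brokenFun 𝒯 Ω f (linePoint i y t) +
      ∫ s in t..t₀, brokenFun 𝒯 Ω D (linePoint i y s) = 0 := by
  obtain ⟨c, hc, hcsub⟩ := mem_nhdsLT_iff_exists_Ioo_subset.mp h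
  filter_upwards [Ioo_mem_nhdsLT hc] with t ht
  rw [brokenFun_eq_zero (hcsub ht), zero_add]
  refine intervalIntegral.integral_zero_ae ?_
  filter_upwards [Measure.ae_ne volume t₀] with s hst hs
  rw [Set.uIoc_of_le ht.2.le] at hs
  exact brokenFun_eq_zero (hcsub ⟨ht.1.trans hs.1, lt_of_le_of_ne hs.2 hst⟩)

end Broken

namespace Mesh

variable {𝒯 : Mesh (n + 1)} {Ω : Set (E (n + 1))} {x : E (n + 1)}

/-- Two distinct interior faces meet in a face of codimension at least two. -/
lemma interiorFace_unique {F F' : Finset (E (n + 1))} (hF : F ∈ 𝒯.interiorFaces Ω)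
    (hF' : F' ∈ 𝒯.interiorFaces Ω) (hx : x ∈ simplex F) (hx' : x ∈ simplex F')
    (hZ : x ∉ 𝒯.lowSkeleton) : F = F' := by
  classical
  have h1 := mem_interiorFaces.mp hF
  have h1' := mem_interiorFaces.mp hF'
  by_contra hne
  refine hZ ?_
  have hmem := 𝒯.inter_subset_convexHull h1.1 h1'.1 ⟨hx, hx'⟩
  rw [← Finset.coe_inter] at hmem
  have hlt : (F ∩ F').card < F.card := by
    refine Finset.card_lt_card (Finset.inter_subset_left.ssubset_of_ne fun h => hne ?_)
    exact Finset.eq_of_subset_of_card_le (Finset.inter_eq_left.mp h) (by rw [h1.2.1, h1'.2.1])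
  have hne' : (F ∩ F').Nonempty := by
    rw [Finset.nonempty_iff_ne_empty]
    intro h
    rw [h] at hmem
    simp at hmem
  rw [lowSkeleton, Set.mem_iUnion₂]
  refine ⟨F ∩ F', ⟨𝒯.down_closed h1.1 Finset.inter_subset_left hne', ?_⟩, hmem⟩
  have := h1.2.1
  omega

end Mesh

namespace DGSpace

variable {𝒯 : Mesh (n + 1)} {Ω : Set (E (n + 1))} {p : ℕ}

/-- The jump of `β v²`, extended by zero outside `Ω`, along lines in the coordinate direction `i`
across `Γ`: the limit from below minus the limit from above. -/
def bdryJump (v : DGSpace 𝒯 Ω p) (β : E (n + 1) → ℝ) (i : Fin (n + 1)) (x : E (n + 1)) : ℝ :=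
  SignType.sign (outerNormal Ω x i) * (β x * v.bdryTrace x ^ 2)

/-- The jump of `β v²` along lines in the coordinate direction `i` across a face with normal `ν`:
the limit from below minus the limit from above. -/
def faceJump (v : DGSpace 𝒯 Ω p) (β : E (n + 1) → ℝ) (i : Fin (n + 1)) (ν x : E (n + 1)) : ℝ :=
  SignType.sign (ν i) * (β x * (sideTrace v.toFun ν x ^ 2 - sideTrace v.toFun (-ν) x ^ 2))

/-- The line meets the mesh skeleton and `Γ` only in finitely many points, all of them generic, and
crosses both transversally there. -/
structure IsGenericLine (𝒯 : Mesh (n + 1)) (Ω : Set (E (n + 1))) (ν : Finset (E (n + 1)) → E (n + 1))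
    (i : Fin (n + 1)) (y : E n) : Prop where
  notMem_lowSkeleton : ∀ t, linePoint i y t ∉ 𝒯.lowSkeleton
  notMem_singular : ∀ t, linePoint i y t ∉ frontier Ω \ regularBoundary Ω
  notMem_crossing : ∀ t, linePoint i y t ∉ 𝒯.crossing Ω
  bdry_finite : {t | linePoint i y t ∈ regularBoundary Ω}.Finite
  bdry_transversal : ∀ t, linePoint i y t ∈ regularBoundary Ω →
    outerNormal Ω (linePoint i y t) i ≠ 0
  face_finite : ∀ F ∈ 𝒯.interiorFaces Ω, {t | linePoint i y t ∈ simplex F ∩ Ω}.Finite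
  face_transversal : ∀ F ∈ 𝒯.interiorFaces Ω, ∀ t, linePoint i y t ∈ simplex F ∩ Ω → ν F i ≠ 0

/-- On a generic line, the one-sided limits of the broken function `β v²` exist everywhere, and
their differences are the jumps on `Γ` and on the interior faces. A point of the line is of one of
four kinds: on an interior face, in the interior of an element, on the regular part of `Γ`, or
outside the closure of `Ω`. -/
lemma exists_one_sided_limits (v : DGSpace 𝒯 Ω p) (hΩ : IsOpen Ω) (hcov : 𝒯.Covers Ω)
    {ν : Finset (E (n + 1)) → E (n + 1)} (hν : IsFaceNormal 𝒯 Ω ν) {i : Fin (n + 1)} {y : E n}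
    (hgen : IsGenericLine 𝒯 Ω ν i y) {β : E (n + 1) → ℝ} {D : 𝒯.active Ω → E (n + 1) → ℝ}
    (hder : HasLineDeriv 𝒯 Ω (regularBoundary Ω) (fun T x => v.onElement T x ^ 2 * β x) D i y)
    (t₀ : ℝ) :
    ∃ l r : ℝ,
      (∀ᶠ t in 𝓝[<] t₀,
        brokenFun 𝒯 Ω (fun T x => v.onElement T x ^ 2 * β x) (linePoint i y t) +
          ∫ s in t..t₀, brokenFun 𝒯 Ω D (linePoint i y s) = l) ∧
      (∀ᶠ t in 𝓝[>] t₀,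
        brokenFun 𝒯 Ω (fun T x => v.onElement T x ^ 2 * β x) (linePoint i y t) =
          r + ∫ s in t₀..t, brokenFun 𝒯 Ω D (linePoint i y s)) ∧
      l - r = (regularBoundary Ω).indicator (v.bdryJump β i) (linePoint i y t₀) +
        ∑ F ∈ 𝒯.interiorFaces Ω,
          (simplex F ∩ Ω).indicator (v.faceJump β i (ν F)) (linePoint i y t₀) ∧
      ((linePoint i y t₀ ∉ regularBoundary Ω ∧
          ∀ F ∈ 𝒯.interiorFaces Ω, linePoint i y t₀ ∉ simplex F ∩ Ω) →
        l = brokenFun 𝒯 Ω (fun T x => v.onElement T x ^ 2 * β x) (linePoint i y t₀) ∧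
        r = brokenFun 𝒯 Ω (fun T x => v.onElement T x ^ 2 * β x) (linePoint i y t₀)) := by
  set x := linePoint i y t₀ with hx
  have hline : ContinuousAt (fun t => linePoint i y t) t₀ := (continuous_linePoint i y).continuousAt
  have hev : ∀ {U : Set (E (n + 1))}, IsOpen U → x ∈ U →
      (∀ᶠ t in 𝓝[<] t₀, linePoint i y t ∈ U) ∧ ∀ᶠ t in 𝓝[>] t₀, linePoint i y t ∈ U :=
    fun hU hxU => ⟨nhdsWithin_le_nhds (hline.eventually_mem (hU.mem_nhds hxU)),
      nhdsWithin_le_nhds (hline.eventually_mem (hU.mem_nhds hxU))⟩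
  have hneg : ∀ w : E (n + 1), ⟪w, -unitVec i⟫ = -w i := fun w => by
    rw [inner_neg_right, inner_unitVec]
  have hbdry_notMem : ∀ {z : E (n + 1)}, z ∈ frontier Ω → z ∉ Ω := fun hz hz' => by
    rw [hΩ.frontier_eq] at hz
    exact hz.2 hz'
  by_cases hxΩ : x ∈ Ω
  · have hxreg : x ∉ regularBoundary Ω := fun h => hbdry_notMem h.1 hxΩ
    obtain ⟨hΩl, hΩr⟩ := hev hΩ hxΩ
    rw [Set.indicator_of_notMem hxreg, zero_add]
    by_cases hface : ∃ F ∈ 𝒯.interiorFaces Ω, x ∈ simplex F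
    · obtain ⟨F, hF, hxF⟩ := hface
      obtain ⟨hν1, hν2⟩ := hν F hF
      have hνi := hgen.face_transversal F hF t₀ ⟨hxF, hxΩ⟩
      have hZ := hgen.notMem_lowSkeleton t₀
      obtain ⟨P, hP, M, hM, hPin, hMin⟩ := Mesh.exists_elements_of_mem_face hF hν1 hν2 hxF hZ
      have hνν : ⟪ν F, ν F⟫ = (1 : ℝ) := by rw [real_inner_self_eq_norm_sq, hν1, one_pow]
      have htP : sideTrace v.toFun (ν F) x = v.onElement ⟨P, hP⟩ x :=
        v.sideTrace_toFun_eq ⟨P, hP⟩ (hPin _ (by rw [inner_neg_right, hνν]; norm_num))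
      have htM : sideTrace v.toFun (-ν F) x = v.onElement ⟨M, hM⟩ x :=
        v.sideTrace_toFun_eq ⟨M, hM⟩ (hMin _ (by rw [neg_neg, hνν]; norm_num))
      have hsum : ∑ F ∈ 𝒯.interiorFaces Ω,
          (simplex F ∩ Ω).indicator (v.faceJump β i (ν F)) x = v.faceJump β i (ν F) x := by
        rw [Finset.sum_eq_single F, Set.indicator_of_mem (Set.mem_inter hxF hxΩ)]
        · intro F' hF' hne
          exact Set.indicator_of_notMem
            (fun h => hne (Mesh.interiorFace_unique hF' hF h.1 hxF hZ)) _
        · exact fun h => absurd hF h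
      rw [hsum, faceJump, htP, htM]
      rcases lt_or_gt_of_ne hνi with hi | hi
      · refine ⟨_, _, hder.eventually_left ⟨M, hM⟩ (Or.inl hxΩ) (eventually_linePoint_left
          (P := (· ∈ interior (simplex M))) (hMin _ (by rw [hneg]; linarith))) hΩl,
          hder.eventually_right ⟨P, hP⟩ (Or.inl hxΩ) (eventually_linePoint_right
          (P := (· ∈ interior (simplex P))) (hPin _ (by rw [inner_unitVec]; linarith))) hΩr, ?_,
          fun h => absurd ⟨hxF, hxΩ⟩ (h.2 F hF)⟩
        rw [sign_neg hi, SignType.coe_neg_one]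
        ring
      · refine ⟨_, _, hder.eventually_left ⟨P, hP⟩ (Or.inl hxΩ) (eventually_linePoint_left
          (P := (· ∈ interior (simplex P))) (hPin _ (by rw [hneg]; linarith))) hΩl,
          hder.eventually_right ⟨M, hM⟩ (Or.inl hxΩ) (eventually_linePoint_right
          (P := (· ∈ interior (simplex M))) (hMin _ (by rw [inner_unitVec]; linarith))) hΩr, ?_,
          fun h => absurd ⟨hxF, hxΩ⟩ (h.2 F hF)⟩
        rw [sign_pos hi, SignType.coe_one]
        ring
    · rcases Mesh.mem_interior_or_mem_face hΩ hcov hxΩ (hgen.notMem_lowSkeleton t₀) with h | h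
      · obtain ⟨T, hT, hxT⟩ := h
        obtain ⟨hTl, hTr⟩ := hev isOpen_interior hxT
        refine ⟨_, _, hder.eventually_left ⟨T, hT⟩ (Or.inl hxΩ) hTl hΩl,
          hder.eventually_right ⟨T, hT⟩ (Or.inl hxΩ) hTr hΩr, ?_, fun _ => ?_⟩
        · rw [sub_self, Finset.sum_eq_zero]
          intro F hF
          exact Set.indicator_of_notMem (fun h => hface ⟨F, hF, h.1⟩) _
        · rw [brokenFun_eq ⟨T, hT⟩ hxT hxΩ]
          exact ⟨rfl, rfl⟩
      · exact absurd h hface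
  · have hsum : ∑ F ∈ 𝒯.interiorFaces Ω,
        (simplex F ∩ Ω).indicator (v.faceJump β i (ν F)) x = 0 :=
      Finset.sum_eq_zero fun F _ => Set.indicator_of_notMem (fun h => hxΩ h.2) _
    rw [hsum, add_zero]
    by_cases hxcl : x ∈ closure Ω
    · have hxf : x ∈ frontier Ω := by
        rw [hΩ.frontier_eq]
        exact ⟨hxcl, hxΩ⟩
      have hxreg : x ∈ regularBoundary Ω := by
        by_contra h
        exact hgen.notMem_singular t₀ ⟨hxf, h⟩
      have hN := isOuterNormal_outerNormal hxreg
      obtain ⟨T, hT, -, hTin⟩ := Mesh.exists_active_of_mem_regularBoundary hcov hxreg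
        (hgen.notMem_crossing t₀)
      have htr : v.bdryTrace x = v.onElement ⟨T, hT⟩ x := by
        refine v.sideTrace_toFun_eq ⟨T, hT⟩ (hTin _ ?_)
        rw [inner_neg_right, real_inner_self_eq_norm_sq, hN.norm_eq_one]
        norm_num
      have hi := hgen.bdry_transversal t₀ hxreg
      rw [Set.indicator_of_mem hxreg, bdryJump, htr]
      rcases lt_or_gt_of_ne hi with hi | hi
      · refine ⟨_, _, eventually_left_of_notMem (eventually_linePoint_left (P := (· ∉ Ω))
            (hN.eventually_notMem (by rw [hneg]; linarith))),
          hder.eventually_right ⟨T, hT⟩ (Or.inr hxreg)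
            (eventually_linePoint_right (P := (· ∈ interior (simplex T)))
              (hTin _ (by rw [inner_unitVec]; linarith)))
            (eventually_linePoint_right (P := (· ∈ Ω))
              (hN.eventually_mem (by rw [inner_unitVec]; linarith))), ?_,
          fun h => absurd hxreg h.1⟩
        rw [sign_neg hi, SignType.coe_neg_one]
        ring
      · refine ⟨_, _, hder.eventually_left ⟨T, hT⟩ (Or.inr hxreg)
            (eventually_linePoint_left (P := (· ∈ interior (simplex T)))
              (hTin _ (by rw [hneg]; linarith)))
            (eventually_linePoint_left (P := (· ∈ Ω))
              (hN.eventually_mem (by rw [hneg]; linarith))),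
          eventually_right_of_notMem (eventually_linePoint_right (P := (· ∉ Ω))
            (hN.eventually_notMem (by rw [inner_unitVec]; linarith))), ?_,
          fun h => absurd hxreg h.1⟩
        rw [sign_pos hi, SignType.coe_one]
        ring
    · have hxreg : x ∉ regularBoundary Ω := fun h => hxcl (frontier_subset_closure h.1)
      obtain ⟨hl, hr⟩ := hev isClosed_closure.isOpen_compl hxcl
      refine ⟨0, 0,
        eventually_left_of_notMem (hl.mono fun t ht h => ht (subset_closure h)),
        eventually_right_of_notMem (hr.mono fun t ht h => ht (subset_closure h)), ?_, fun _ => ?_⟩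
      · rw [Set.indicator_of_notMem hxreg, sub_zero]
      · rw [brokenFun_eq_zero hxΩ]
        exact ⟨rfl, rfl⟩

/-- The divergence theorem for the broken function `β v²` on a generic line. -/
theorem integral_line_eq (v : DGSpace 𝒯 Ω p) (hΩ : IsOpen Ω) (hbdd : Bornology.IsBounded Ω)
    (hcov : 𝒯.Covers Ω)
    {ν : Finset (E (n + 1)) → E (n + 1)} (hν : IsFaceNormal 𝒯 Ω ν) {i : Fin (n + 1)} {y : E n}
    (hgen : IsGenericLine 𝒯 Ω ν i y) {β : E (n + 1) → ℝ} {D : 𝒯.active Ω → E (n + 1) → ℝ}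
    (hder : HasLineDeriv 𝒯 Ω (regularBoundary Ω) (fun T x => v.onElement T x ^ 2 * β x) D i y)
    (hD : Integrable fun t => brokenFun 𝒯 Ω D (linePoint i y t)) :
    ∫ t, brokenFun 𝒯 Ω D (linePoint i y t) =
      lineSum i (regularBoundary Ω) (v.bdryJump β i) y +
        ∑ F ∈ 𝒯.interiorFaces Ω, lineSum i (simplex F ∩ Ω) (v.faceJump β i (ν F)) y := by
  choose l r hl hr hlr hG using exists_one_sided_limits v hΩ hcov hν hgen hder
  obtain ⟨R, hR⟩ := hbdd.exists_norm_le
  have hK : ({t | linePoint i y t ∈ regularBoundary Ω} ∪ ⋃ F ∈ 𝒯.interiorFaces Ω,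
      {t | linePoint i y t ∈ simplex F ∩ Ω}).Finite :=
    hgen.bdry_finite.union ((𝒯.interiorFaces Ω).finite_toSet.biUnion hgen.face_finite)
  rw [integral_eq_finsum_jumps (l := l) (r := r) (R := R) hD hK hl hr]
  · have hsupp : ∀ {S : Set (E (n + 1))} {g : E (n + 1) → ℝ}, {t | linePoint i y t ∈ S}.Finite →
        (Function.support fun t => S.indicator g (linePoint i y t)).Finite :=
      fun {S g} hS => hS.subset fun t ht => by_contra fun h =>
        ht (Set.indicator_of_notMem (s := S) (a := linePoint i y t) h g)
    simp_rw [hlr, lineSum]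
    rw [finsum_add_distrib (hsupp hgen.bdry_finite), finsum_sum_comm]
    · exact fun F hF => hsupp (hgen.face_finite F hF)
    · refine ((𝒯.interiorFaces Ω).finite_toSet.biUnion hgen.face_finite).subset fun t ht => ?_
      obtain ⟨F, hF, hFt⟩ := Finset.exists_ne_zero_of_sum_ne_zero ht
      exact Set.mem_biUnion hF (by_contra fun h => hFt
        (Set.indicator_of_notMem (s := simplex F ∩ Ω) (a := linePoint i y t) h _))
  · intro t ht
    refine hG t ⟨fun h => ht (Or.inl h), fun F hF h => ht (Or.inr ?_)⟩
    exact Set.mem_biUnion hF h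
  · intro t ht
    refine brokenFun_eq_zero fun h => ?_
    have h1 := PiLp.norm_apply_le (linePoint i y t) i
    rw [linePoint_same, Real.norm_eq_abs] at h1
    linarith [hR _ h]

end DGSpace

/-! ### The divergence theorem on the cut mesh, one coordinate at a time -/

lemma integrableOn_smul_of_continuous {F : Type*} [NormedAddCommGroup F] [NormedSpace ℝ F]
    {Ω : Set (E (n + 1))} (hΩ : IsOpen Ω) (hbdd : Bornology.IsBounded Ω) {ψ : E (n + 1) → ℝ}
    (hψ : Continuous ψ) {f : E (n + 1) → F} (hf : IntegrableOn f Ω) :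
    IntegrableOn (fun x => ψ x • f x) Ω := by
  obtain ⟨C, hC⟩ := hbdd.isCompact_closure.exists_bound_of_continuousOn hψ.continuousOn
  exact Integrable.bdd_smul hf C hψ.aestronglyMeasurable
    (ae_restrict_of_forall_mem hΩ.measurableSet fun x hx => hC x (subset_closure hx))

namespace IsW1Infty

variable {Ω : Set (E (n + 1))} {b : E (n + 1) → E (n + 1)}
  {Db : E (n + 1) → E (n + 1) →L[ℝ] E (n + 1)}

lemma isFiniteMeasure_restrict (hbdd : Bornology.IsBounded Ω) :
    IsFiniteMeasure (volume.restrict Ω) :=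
  ⟨by rw [Measure.restrict_apply_univ]; exact hbdd.measure_lt_top⟩

lemma integrableOn (h : IsW1Infty Ω b Db) (hbdd : Bornology.IsBounded Ω) : IntegrableOn b Ω :=
  have := isFiniteMeasure_restrict hbdd
  h.memLp.integrable le_top

lemma integrableOn_jacobian (h : IsW1Infty Ω b Db) (hbdd : Bornology.IsBounded Ω) :
    IntegrableOn Db Ω :=
  have := isFiniteMeasure_restrict hbdd
  h.memLp_jacobian.integrable le_top

lemma integrableOn_apply (h : IsW1Infty Ω b Db) (hbdd : Bornology.IsBounded Ω)
    (i : Fin (n + 1)) : IntegrableOn (fun x => b x i) Ω :=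
  (EuclideanSpace.proj (𝕜 := ℝ) i).integrable_comp (h.integrableOn hbdd)

lemma integrableOn_jacobian_apply (h : IsW1Infty Ω b Db) (hbdd : Bornology.IsBounded Ω)
    (i : Fin (n + 1)) : IntegrableOn (fun x => Db x (unitVec i) i) Ω :=
  ((EuclideanSpace.proj (𝕜 := ℝ) i).comp
    (ContinuousLinearMap.apply ℝ (E (n + 1)) (unitVec i))).integrable_comp
      (h.integrableOn_jacobian hbdd)

lemma hasWeakPartial (h : IsW1Infty Ω b Db) (hΩ : IsOpen Ω) (hbdd : Bornology.IsBounded Ω)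
    (i : Fin (n + 1)) : HasWeakPartial Ω i (fun x => b x i) fun x => Db x (unitVec i) i := by
  intro φ hφ hc hs
  have h1 := congrArg (EuclideanSpace.proj (𝕜 := ℝ) i) (h.hasWeakJacobian φ hφ hc hs (unitVec i))
  have hφ' : Continuous fun x => fderiv ℝ φ x (unitVec i) :=
    (hφ.continuous_fderiv (by simp)).clm_apply continuous_const
  have hDb : IntegrableOn (fun x => Db x (unitVec i)) Ω :=
    (ContinuousLinearMap.apply ℝ (E (n + 1)) (unitVec i)).integrable_comp
      (h.integrableOn_jacobian hbdd)
  have h2 := integrableOn_smul_of_continuous hΩ hbdd hφ' (h.integrableOn hbdd)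
  have h3 := integrableOn_smul_of_continuous hΩ hbdd hφ.continuous hDb
  rw [map_neg, ← ContinuousLinearMap.integral_comp_comm _ h2,
    ← ContinuousLinearMap.integral_comp_comm _ h3] at h1
  simpa using h1

/-- The continuous representative of `b` is bounded, up to the regular part of the boundary. -/
lemma exists_bound (h : IsW1Infty Ω b Db) (hΩ : IsOpen Ω) :
    ∃ B : ℝ, ∀ x ∈ Ω ∪ regularBoundary Ω, ‖b x‖ ≤ B := by
  have hne : eLpNormEssSup b (volume.restrict Ω) ≠ ∞ := by
    simpa using h.memLp.eLpNorm_ne_top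
  refine ⟨(eLpNormEssSup b (volume.restrict Ω)).toReal, fun x hx => ?_⟩
  by_contra hlt
  have hev : ∀ᶠ z in 𝓝[Ω ∪ regularBoundary Ω] x,
      (eLpNormEssSup b (volume.restrict Ω)).toReal < ‖b z‖ :=
    (h.continuousOn x hx).norm.eventually_const_lt (not_le.mp hlt)
  obtain ⟨U, hU, hxU, hsub⟩ := mem_nhdsWithin.mp hev
  have hxcl : x ∈ closure Ω := hx.elim (fun hx => subset_closure hx)
    fun hx => frontier_subset_closure hx.1
  have hpos : 0 < volume (U ∩ Ω) :=
    (hU.inter hΩ).measure_pos volume (mem_closure_iff.mp hxcl U hU hxU)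
  refine hpos.ne' (measure_mono_null ?_ (ae_iff.mp
    ((ae_restrict_iff' hΩ.measurableSet).mp
      (ae_le_eLpNormEssSup (f := b) (μ := volume.restrict Ω)))))
  rintro z ⟨hzU, hzΩ⟩ hz
  have h1 : (eLpNormEssSup b (volume.restrict Ω)).toReal < ‖b z‖ := hsub ⟨hzU, Or.inl hzΩ⟩
  have h3 := ENNReal.toReal_mono hne (hz hzΩ)
  rw [toReal_enorm] at h3
  linarith

end IsW1Infty

lemma ae_forall_linePoint_notMem (i : Fin (n + 1)) {Z : Set (E (n + 1))} (hZ : μHE[n] Z = 0) :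
    ∀ᵐ y : E n, ∀ t, linePoint i y t ∉ Z := by
  have h1 := euclideanHausdorffMeasure_image_le_of_lipschitzOnWith
    ((lipschitzWith_dropCoord i).lipschitzOnWith (s := Z)) n
  rw [hZ, mul_zero, EuclideanSpace.euclideanHausdorffMeasure_eq_volume] at h1
  rw [ae_iff]
  refine measure_mono_null ?_ (le_antisymm h1 zero_le)
  intro y hy
  simp only [not_forall, not_not] at hy
  obtain ⟨t, ht⟩ := hy
  exact ⟨_, ht, dropCoord_linePoint i y t⟩

/-- Fubini along the `i`-th coordinate axis. -/
lemma integral_linePoint (i : Fin (n + 1)) {h : E (n + 1) → ℝ} (hh : Integrable h) :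
    (∀ᵐ y : E n, Integrable fun t => h (linePoint i y t)) ∧
      ∫ y : E n, ∫ t, h (linePoint i y t) = ∫ x, h x := by
  have h1 := ((measurePreserving_linePoint i).integrable_comp_emb
    (measurableEmbedding_linePoint i)).mpr hh
  refine ⟨h1.prod_left_ae, ?_⟩
  rw [← (measurePreserving_linePoint i).integral_comp (measurableEmbedding_linePoint i)]
  exact (integral_prod_symm _ h1).symm

lemma measurable_coe_sign : Measurable fun r : ℝ => (SignType.sign r : ℝ) := by
  have : (fun r : ℝ => (SignType.sign r : ℝ)) =
      fun r => if 0 < r then 1 else if r < 0 then -1 else 0 := by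
    funext r
    rw [sign_apply]
    split_ifs <;> simp
  rw [this]
  exact Measurable.ite measurableSet_Ioi measurable_const
    (Measurable.ite measurableSet_Iio measurable_const measurable_const)

lemma norm_coe_sign_le (r : ℝ) : ‖(SignType.sign r : ℝ)‖ ≤ 1 := by
  rcases lt_trichotomy r 0 with h | h | h <;> simp [h]

/-- The coarea formula with the intersection points counted with the sign of the crossing. -/
lemma IsTangentSurface.coarea_sign {M : Set (E (n + 1))} {N : E (n + 1) → E (n + 1)}
    (hM : IsTangentSurface M N) (hfin : μHE[n] M < ∞) (i : Fin (n + 1)) {g : E (n + 1) → ℝ}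
    (hg : IntegrableOn g M (μHE[n] : Measure (E (n + 1)))) :
    Integrable (lineSum i M fun x => SignType.sign (N x i) * g x) ∧
      ∫ y, lineSum i M (fun x => SignType.sign (N x i) * g x) y =
        ∫ x in M, N x i * g x ∂μHE[n] := by
  have hs : AEStronglyMeasurable (fun x => (SignType.sign (N x i) : ℝ))
      ((μHE[n] : Measure (E (n + 1))).restrict M) :=
    (measurable_coe_sign.comp_aemeasurable
      ((hM.continuousOn_apply i).aemeasurable hM.measurableSet)).aestronglyMeasurable
  have h1 : IntegrableOn (fun x => SignType.sign (N x i) * g x) M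
      (μHE[n] : Measure (E (n + 1))) :=
    Integrable.bdd_mul (c := 1) hg hs (ae_of_all _ fun x => norm_coe_sign_le _)
  obtain ⟨-, h2, h3⟩ := hM.coarea hfin i h1
  refine ⟨h2, h3.trans (integral_congr_ae (ae_of_all _ fun x => ?_))⟩
  simp only
  rw [← mul_assoc, abs_mul_sign]

namespace DGSpace

variable {𝒯 : Mesh (n + 1)} {Ω : Set (E (n + 1))} {p : ℕ}

lemma contDiff_onElement (v : DGSpace 𝒯 Ω p) (T : 𝒯.active Ω) :
    ContDiff ℝ (⊤ : ℕ∞) (v.onElement T) := by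
  have h := AnalyticOnNhd.eval_continuousLinearMap' (𝕜 := ℝ) (B := ℝ)
    (fun i => EuclideanSpace.proj (𝕜 := ℝ) i) (v T : MvPolynomial (Fin (n + 1)) ℝ)
  exact contDiff_iff_contDiffAt.mpr fun x => (h x (Set.mem_univ x)).contDiffAt

lemma exists_bound_onElement (v : DGSpace 𝒯 Ω p) (hbdd : Bornology.IsBounded Ω) :
    ∃ C : ℝ, ∀ T : 𝒯.active Ω, ∀ x ∈ closure Ω, |v.onElement T x| ≤ C := by
  have h : ∀ T : 𝒯.active Ω, ∃ C : ℝ, ∀ x ∈ closure Ω, |v.onElement T x| ≤ C := fun T =>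
    hbdd.isCompact_closure.exists_bound_of_continuousOn (v.continuous_onElement T).continuousOn
  choose C hC using h
  obtain ⟨B, hB⟩ := (Set.finite_range C).bddAbove
  exact ⟨B, fun T x hx => (hC T x hx).trans (hB ⟨T, rfl⟩)⟩

lemma measurable_toFun (v : DGSpace 𝒯 Ω p) : Measurable v.toFun := by
  unfold toFun
  exact Finset.measurable_sum _ fun T _ =>
    (v.continuous_onElement T).measurable.indicator isOpen_interior.measurableSet

/-- One-sided traces on a hypersurface are square integrable against bounded continuous weights: as
pointwise limits they are measurable. -/
lemma integrableOn_sideTrace_sq (v : DGSpace 𝒯 Ω p) (hbdd : Bornology.IsBounded Ω)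
    {M : Set (E (n + 1))} (hM : MeasurableSet M) (hfin : μHE[n] M < ∞) (hMΩ : M ⊆ closure Ω)
    {N : E (n + 1) → E (n + 1)} (hN : ContinuousOn N M)
    (hT : ∀ᵐ x ∂(μHE[n] : Measure (E (n + 1))).restrict M, ∃ T : 𝒯.active Ω,
      ∀ᶠ t in 𝓝[>] (0 : ℝ), x + t • (-N x) ∈ interior (simplex (T : Finset (E (n + 1)))))
    {β : E (n + 1) → ℝ} (hβ : ContinuousOn β M) {B : ℝ} (hB : ∀ x ∈ M, |β x| ≤ B) :
    IntegrableOn (fun x => β x * sideTrace v.toFun (N x) x ^ 2) M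
      (μHE[n] : Measure (E (n + 1))) := by
  obtain ⟨C, hC⟩ := v.exists_bound_onElement hbdd
  have hNm := hN.aemeasurable (μ := (μHE[n] : Measure (E (n + 1)))) hM
  have hmeas : AEMeasurable (fun x => sideTrace v.toFun (N x) x)
      ((μHE[n] : Measure (E (n + 1))).restrict M) := by
    refine aemeasurable_of_tendsto_metrizable_ae (atTop : Filter ℕ)
      (f := fun (k : ℕ) x => v.toFun (x - (1 / ((k : ℝ) + 1)) • N x)) (fun k => ?_) ?_
    · exact v.measurable_toFun.comp_aemeasurable (aemeasurable_id.sub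
        ((measurable_const_smul (1 / ((k : ℝ) + 1))).comp_aemeasurable hNm))
    · filter_upwards [hT] with x ⟨T, hTx⟩
      rw [v.sideTrace_toFun_eq T hTx]
      have hseq : Tendsto (fun k : ℕ => 1 / ((k : ℝ) + 1)) atTop (𝓝[>] 0) :=
        tendsto_nhdsWithin_of_tendsto_nhds_of_eventually_within _
          tendsto_one_div_add_atTop_nhds_zero_nat
          (Eventually.of_forall fun k => by simp only [Set.mem_Ioi]; positivity)
      have hc : ContinuousAt (fun t : ℝ => v.onElement T (x - t • N x)) 0 :=
        ((v.continuous_onElement T).comp (by fun_prop)).continuousAt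
      have h1 : Tendsto (fun k : ℕ => v.onElement T (x - (1 / ((k : ℝ) + 1)) • N x)) atTop
          (𝓝 (v.onElement T x)) := by
        have := hc.tendsto.comp (hseq.mono_right nhdsWithin_le_nhds)
        simpa [Function.comp_def] using this
      refine h1.congr' ((hseq.eventually hTx).mono fun k hk => ?_)
      rw [smul_neg, ← sub_eq_add_neg] at hk
      exact (v.toFun_eq_of_mem_interior T hk).symm
  refine IntegrableOn.of_bound (C := B * C ^ 2) hfin
    ((hβ.aemeasurable hM).mul (hmeas.pow_const 2)).aestronglyMeasurable ?_
  filter_upwards [hT, ae_restrict_mem hM] with x ⟨T, hTx⟩ hx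
  rw [v.sideTrace_toFun_eq T hTx, Real.norm_eq_abs, abs_mul, abs_pow]
  have h1 := hC T x (hMΩ hx)
  have h2 := hB x hx
  have h3 : 0 ≤ B := (abs_nonneg _).trans h2
  gcongr

/-- Almost everywhere on `Γ` one active element fills the inner side. -/
lemma ae_regularBoundary (hΩ : IsOpen Ω) (hcov : 𝒯.Covers Ω) :
    ∀ᵐ x ∂(μHE[n] : Measure (E (n + 1))).restrict (regularBoundary Ω), ∃ T : 𝒯.active Ω,
      ∀ᶠ t in 𝓝[>] (0 : ℝ),
        x + t • (-outerNormal Ω x) ∈ interior (simplex (T : Finset (E (n + 1)))) := by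
  filter_upwards [ae_restrict_mem (measurableSet_regularBoundary hΩ),
    ae_restrict_of_ae (measure_eq_zero_iff_ae_notMem.mp
      (𝒯.euclideanHausdorffMeasure_crossing (Ω := Ω) hΩ))] with x hx hx'
  obtain ⟨T, hT, -, hTin⟩ := Mesh.exists_active_of_mem_regularBoundary hcov hx hx'
  refine ⟨⟨T, hT⟩, hTin _ ?_⟩
  rw [inner_neg_right, real_inner_self_eq_norm_sq, (isOuterNormal_outerNormal hx).norm_eq_one]
  norm_num

/-- Almost everywhere on an interior face one active element fills the side `-ν`. -/
lemma ae_face (hΩ : IsOpen Ω) {F : Finset (E (n + 1))} (hF : F ∈ 𝒯.interiorFaces Ω)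
    {ν : E (n + 1)} (hν1 : ‖ν‖ = 1) (hν : ∀ x ∈ F, ∀ y ∈ F, ⟪ν, x - y⟫ = 0) :
    ∀ᵐ x ∂(μHE[n] : Measure (E (n + 1))).restrict (simplex F ∩ Ω), ∃ T : 𝒯.active Ω,
      ∀ᶠ t in 𝓝[>] (0 : ℝ), x + t • (-ν) ∈ interior (simplex (T : Finset (E (n + 1)))) := by
  filter_upwards [ae_restrict_mem ((isClosed_simplex F).measurableSet.inter hΩ.measurableSet),
    ae_restrict_of_ae (measure_eq_zero_iff_ae_notMem.mp
      𝒯.euclideanHausdorffMeasure_lowSkeleton)] with x hx hx'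
  obtain ⟨P, hP, -, -, hPin, -⟩ := Mesh.exists_elements_of_mem_face hF hν1 hν hx.1 hx'
  refine ⟨⟨P, hP⟩, hPin _ ?_⟩
  rw [inner_neg_right, real_inner_self_eq_norm_sq, hν1]
  norm_num

end DGSpace

namespace DGSpace

variable {𝒯 : Mesh (n + 1)} {Ω : Set (E (n + 1))} {p : ℕ} (v : DGSpace 𝒯 Ω p)
  {b : E (n + 1) → E (n + 1)} {Db : E (n + 1) → E (n + 1) →L[ℝ] E (n + 1)}
  {ν : Finset (E (n + 1)) → E (n + 1)}

lemma integrableOn_bdryTrace_sq (hΩ : IsPiecewiseSmoothDomain Ω) (hb : IsW1Infty Ω b Db)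
    (hcov : 𝒯.Covers Ω) (i : Fin (n + 1)) :
    IntegrableOn (fun x => b x i * v.bdryTrace x ^ 2) (regularBoundary Ω)
      (μHE[n] : Measure (E (n + 1))) := by
  obtain ⟨B, hB⟩ := hb.exists_bound hΩ.isOpen
  have hM := isTangentSurface_regularBoundary hΩ.isOpen
  refine v.integrableOn_sideTrace_sq hΩ.isBounded hM.measurableSet
    ((measure_mono fun x hx => hx.1).trans_lt hΩ.boundary_finite)
    (fun x hx => frontier_subset_closure hx.1) hM.continuousOn
    (ae_regularBoundary hΩ.isOpen hcov) (β := fun x => b x i) ?_ (B := B) ?_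
  · exact (EuclideanSpace.proj (𝕜 := ℝ) i).continuous.comp_continuousOn
      (hb.continuousOn.mono Set.subset_union_right)
  · exact fun x hx => (PiLp.norm_apply_le (b x) i).trans (hB x (Or.inr hx))

lemma integrableOn_face_sq (hΩ : IsPiecewiseSmoothDomain Ω) (hb : IsW1Infty Ω b Db)
    (hν : IsFaceNormal 𝒯 Ω ν) {F : Finset (E (n + 1))} (hF : F ∈ 𝒯.interiorFaces Ω)
    (i : Fin (n + 1)) :
    IntegrableOn (fun x => b x i *
        (sideTrace v.toFun (ν F) x ^ 2 - sideTrace v.toFun (-ν F) x ^ 2)) (simplex F ∩ Ω)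
      (μHE[n] : Measure (E (n + 1))) := by
  obtain ⟨B, hB⟩ := hb.exists_bound hΩ.isOpen
  obtain ⟨hν1, hν2⟩ := hν F hF
  have hfin : μHE[n] (simplex F ∩ Ω) < ∞ := (measure_mono Set.inter_subset_left).trans_lt
    (Mesh.euclideanHausdorffMeasure_simplex_lt_top (Mesh.mem_interiorFaces.mp hF).1
      (Mesh.mem_interiorFaces.mp hF).2.1)
  have key : ∀ m : E (n + 1), ‖m‖ = 1 → (∀ x ∈ F, ∀ y ∈ F, ⟪m, x - y⟫ = 0) →
      IntegrableOn (fun x => b x i * sideTrace v.toFun m x ^ 2) (simplex F ∩ Ω)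
        (μHE[n] : Measure (E (n + 1))) := by
    intro m hm1 hm2
    refine v.integrableOn_sideTrace_sq hΩ.isBounded
      ((isClosed_simplex F).measurableSet.inter hΩ.isOpen.measurableSet) hfin
      (fun x hx => subset_closure hx.2) (N := fun _ => m) continuousOn_const
      (ae_face hΩ.isOpen hF hm1 hm2) (β := fun x => b x i) ?_ (B := B) ?_
    · exact (EuclideanSpace.proj (𝕜 := ℝ) i).continuous.comp_continuousOn
        (hb.continuousOn.mono fun x hx => Or.inl hx.2)
    · exact fun x hx => (PiLp.norm_apply_le (b x) i).trans (hB x (Or.inl hx.2))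
  have h1 := (key (ν F) hν1 hν2).sub (key (-ν F) (by rw [norm_neg, hν1]) fun x hx y hy => by
    rw [inner_neg_left, hν2 x hx y hy, neg_zero])
  refine h1.congr (ae_of_all _ fun x => ?_)
  simp only [Pi.sub_apply]
  ring

/-- The classical derivative in the coordinate direction `i` of `(v|_T)² b_i`. -/
def sqDeriv (v : DGSpace 𝒯 Ω p) (b : E (n + 1) → E (n + 1))
    (Db : E (n + 1) → E (n + 1) →L[ℝ] E (n + 1)) (i : Fin (n + 1)) (T : 𝒯.active Ω)
    (x : E (n + 1)) : ℝ :=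
  fderiv ℝ (fun z => v.onElement T z ^ 2) x (unitVec i) * b x i +
    v.onElement T x ^ 2 * Db x (unitVec i) i

lemma integrableOn_sqDeriv (hΩ : IsPiecewiseSmoothDomain Ω) (hb : IsW1Infty Ω b Db)
    (i : Fin (n + 1)) (T : 𝒯.active Ω) : IntegrableOn (v.sqDeriv b Db i T) Ω := by
  have hψ := (v.contDiff_onElement T).pow 2
  have hψ' : Continuous fun x => fderiv ℝ (fun z => v.onElement T z ^ 2) x (unitVec i) :=
    (hψ.continuous_fderiv (by simp)).clm_apply continuous_const
  exact (integrableOn_smul_of_continuous hΩ.isOpen hΩ.isBounded hψ'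
    (hb.integrableOn_apply hΩ.isBounded i)).add
    (integrableOn_smul_of_continuous hΩ.isOpen hΩ.isBounded hψ.continuous
    (hb.integrableOn_jacobian_apply hΩ.isBounded i))

lemma ae_hasLineDeriv (hΩ : IsPiecewiseSmoothDomain Ω) (hb : IsW1Infty Ω b Db)
    (i : Fin (n + 1)) :
    ∀ᵐ y : E n, HasLineDeriv 𝒯 Ω (regularBoundary Ω) (fun T x => v.onElement T x ^ 2 * b x i)
      (v.sqDeriv b Db i) i y := by
  refine ae_all_iff.mpr fun T => ?_
  have hψ := (v.contDiff_onElement T).pow 2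
  have hbi := hb.integrableOn_apply hΩ.isBounded i
  have hw := (hb.hasWeakPartial hΩ.isOpen hΩ.isBounded i).smooth_mul hbi
    (hb.integrableOn_jacobian_apply hΩ.isBounded i) hψ
  refine hw.ae_line hΩ.isOpen
    (integrableOn_smul_of_continuous hΩ.isOpen hΩ.isBounded hψ.continuous hbi)
    (v.integrableOn_sqDeriv hΩ hb i T) ?_
  exact hψ.continuous.continuousOn.mul
    ((EuclideanSpace.proj (𝕜 := ℝ) i).continuous.comp_continuousOn hb.continuousOn)

lemma ae_isGenericLine (hΩ : IsPiecewiseSmoothDomain Ω) (hν : IsFaceNormal 𝒯 Ω ν)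
    (i : Fin (n + 1)) : ∀ᵐ y : E n, IsGenericLine 𝒯 Ω ν i y := by
  have hface : ∀ F ∈ 𝒯.interiorFaces Ω, ∀ᵐ y : E n,
      {t | linePoint i y t ∈ simplex F ∩ Ω}.Finite ∧
        ∀ t, linePoint i y t ∈ simplex F ∩ Ω → ν F i ≠ 0 := fun F hF =>
    ((Mesh.isTangentSurface_face hΩ.isOpen (hν F hF).1 (hν F hF).2).coarea
      ((measure_mono Set.inter_subset_left).trans_lt
        (Mesh.euclideanHausdorffMeasure_simplex_lt_top (Mesh.mem_interiorFaces.mp hF).1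
          (Mesh.mem_interiorFaces.mp hF).2.1)) i (g := fun _ => 0) integrableOn_zero).1
  have hbdry := ((isTangentSurface_regularBoundary hΩ.isOpen).coarea
    ((measure_mono fun x hx => hx.1).trans_lt hΩ.boundary_finite) i (g := fun _ => 0)
    integrableOn_zero).1
  filter_upwards [ae_forall_linePoint_notMem i 𝒯.euclideanHausdorffMeasure_lowSkeleton,
    ae_forall_linePoint_notMem i hΩ.boundary_regular,
    ae_forall_linePoint_notMem i (𝒯.euclideanHausdorffMeasure_crossing hΩ.isOpen), hbdry,
    (eventually_all_finset (𝒯.interiorFaces Ω)).mpr hface] with y h1 h2 h3 h4 h5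
  exact ⟨h1, h2, h3, h4.1, h4.2, fun F hF => (h5 F hF).1, fun F hF => (h5 F hF).2⟩

/-- The divergence theorem on the cut mesh for the vector field `b_i v² e_i`. -/
theorem sum_integral_sqDeriv (hΩ : IsPiecewiseSmoothDomain Ω) (hb : IsW1Infty Ω b Db)
    (hcov : 𝒯.Covers Ω) (hν : IsFaceNormal 𝒯 Ω ν) (i : Fin (n + 1)) :
    ∑ T : 𝒯.active Ω, ∫ x in simplex (T : Finset (E (n + 1))) ∩ Ω, v.sqDeriv b Db i T x =
      (∫ x in regularBoundary Ω, outerNormal Ω x i * (b x i * v.bdryTrace x ^ 2) ∂μHE[n]) +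
        ∑ F ∈ 𝒯.interiorFaces Ω, ∫ x in simplex F ∩ Ω, ν F i * (b x i *
          (sideTrace v.toFun (ν F) x ^ 2 - sideTrace v.toFun (-ν F) x ^ 2)) ∂μHE[n] := by
  have hmeas : ∀ T : 𝒯.active Ω,
      MeasurableSet (interior (simplex (T : Finset (E (n + 1)))) ∩ Ω) :=
    fun T => (isOpen_interior.inter hΩ.isOpen).measurableSet
  have hint : ∀ T : 𝒯.active Ω, Integrable ((interior (simplex (T : Finset (E (n + 1)))) ∩
      Ω).indicator (v.sqDeriv b Db i T)) := fun T =>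
    ((v.integrableOn_sqDeriv hΩ hb i T).mono_set Set.inter_subset_right).integrable_indicator
      (hmeas T)
  have hbroken : Integrable (brokenFun 𝒯 Ω (v.sqDeriv b Db i)) :=
    integrable_finsetSum _ fun T _ => hint T
  have hleft : ∑ T : 𝒯.active Ω, ∫ x in simplex (T : Finset (E (n + 1))) ∩ Ω,
      v.sqDeriv b Db i T x = ∫ x, brokenFun 𝒯 Ω (v.sqDeriv b Db i) x := by
    unfold brokenFun
    rw [integral_finsetSum _ fun T _ => hint T]
    refine Finset.sum_congr rfl fun T _ => ?_
    rw [integral_indicator (hmeas T)]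
    refine setIntegral_congr_set (EventuallyEq.inter ?_ (ae_eq_refl _))
    exact (interior_ae_eq_of_null_frontier
      ((convex_convexHull ℝ _).addHaar_frontier volume)).symm
  obtain ⟨hline, hfubini⟩ := integral_linePoint i hbroken
  obtain ⟨hΓ1, hΓ2⟩ := (isTangentSurface_regularBoundary hΩ.isOpen).coarea_sign
    ((measure_mono fun x hx => hx.1).trans_lt hΩ.boundary_finite) i
    (v.integrableOn_bdryTrace_sq hΩ hb hcov i)
  have hF := fun F (hF : F ∈ 𝒯.interiorFaces Ω) =>
    (Mesh.isTangentSurface_face hΩ.isOpen (hν F hF).1 (hν F hF).2).coarea_sign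
      ((measure_mono Set.inter_subset_left).trans_lt
        (Mesh.euclideanHausdorffMeasure_simplex_lt_top (Mesh.mem_interiorFaces.mp hF).1
          (Mesh.mem_interiorFaces.mp hF).2.1)) i (v.integrableOn_face_sq hΩ hb hν hF i)
  have hae : ∀ᵐ y : E n, ∫ t, brokenFun 𝒯 Ω (v.sqDeriv b Db i) (linePoint i y t) =
      lineSum i (regularBoundary Ω) (v.bdryJump (fun x => b x i) i) y +
        ∑ F ∈ 𝒯.interiorFaces Ω,
          lineSum i (simplex F ∩ Ω) (v.faceJump (fun x => b x i) i (ν F)) y := by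
    filter_upwards [hline, v.ae_hasLineDeriv hΩ hb i, ae_isGenericLine hΩ hν i] with y h1 h2 h3
    exact v.integral_line_eq hΩ.isOpen hΩ.isBounded hcov hν h3 h2 h1
  rw [hleft, ← hfubini, integral_congr_ae hae]
  have hsum : Integrable fun y => ∑ F ∈ 𝒯.interiorFaces Ω,
      lineSum i (simplex F ∩ Ω) (v.faceJump (fun x => b x i) i (ν F)) y :=
    integrable_finsetSum _ fun F h => (hF F h).1
  have hbdry : Integrable (lineSum i (regularBoundary Ω) (v.bdryJump (fun x => b x i) i)) := hΓ1
  have hface : ∀ F ∈ 𝒯.interiorFaces Ω,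
      Integrable (lineSum i (simplex F ∩ Ω) (v.faceJump (fun x => b x i) i (ν F))) :=
    fun F h => (hF F h).1
  rw [integral_add hbdry hsum, integral_finsetSum _ hface]
  exact congrArg₂ _ hΓ2 (Finset.sum_congr rfl fun F h => (hF F h).2)

end DGSpace

/-! ### The energy identity and coercivity -/

lemma inner_eq_sum (x y : E (n + 1)) : ⟪x, y⟫ = ∑ i, y i * x i := by
  simp [PiLp.inner_apply]

lemma divergence_eq_sum (Db : E (n + 1) → E (n + 1) →L[ℝ] E (n + 1)) (x : E (n + 1)) :
    divergence Db x = ∑ i, Db x (unitVec i) i := by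
  rw [divergence, LinearMap.trace_eq_sum_inner _ (EuclideanSpace.basisFun (Fin (n + 1)) ℝ)]
  refine Finset.sum_congr rfl fun i _ => ?_
  rw [EuclideanSpace.basisFun_apply, real_inner_comm, inner_unitVec]
  rfl

lemma abs_divergence_le (Db : E (n + 1) → E (n + 1) →L[ℝ] E (n + 1)) (x : E (n + 1)) :
    |divergence Db x| ≤ (n + 1) * ‖Db x‖ := by
  rw [divergence_eq_sum]
  calc |∑ i, Db x (unitVec i) i| ≤ ∑ i, |Db x (unitVec i) i| := Finset.abs_sum_le_sum_abs _ _
    _ ≤ ∑ _i : Fin (n + 1), ‖Db x‖ := Finset.sum_le_sum fun i _ =>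
        (PiLp.norm_apply_le (Db x (unitVec i)) i).trans (by
          simpa using (Db x).le_opNorm (unitVec i))
    _ = (n + 1) * ‖Db x‖ := by simp

namespace DGSpace

variable {𝒯 : Mesh (n + 1)} {Ω : Set (E (n + 1))} {p : ℕ} (v : DGSpace 𝒯 Ω p)
  {b : E (n + 1) → E (n + 1)} {Db : E (n + 1) → E (n + 1) →L[ℝ] E (n + 1)}
  {c : E (n + 1) → ℝ} {ν : Finset (E (n + 1)) → E (n + 1)}

lemma sum_sqDeriv (T : 𝒯.active Ω) (x : E (n + 1)) :
    ∑ i, v.sqDeriv b Db i T x =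
      2 * (⟪b x, gradient (v.onElement T) x⟫ * v.onElement T x) +
        v.onElement T x ^ 2 * divergence Db x := by
  have hd : DifferentiableAt ℝ (v.onElement T) x :=
    (v.contDiff_onElement T).differentiable (by simp) x
  have h1 : ∀ i, fderiv ℝ (fun z => v.onElement T z ^ 2) x (unitVec i) =
      2 * v.onElement T x * gradient (v.onElement T) x i := by
    intro i
    rw [fderiv_fun_pow 2 hd, ← inner_unitVec (gradient _ x), ← fderiv_apply_eq_inner_gradient]
    simp
  simp only [sqDeriv, h1, Finset.sum_add_distrib, ← Finset.mul_sum, mul_assoc, ← inner_eq_sum,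
    ← divergence_eq_sum]
  ring

lemma integrableOn_divergence (hΩ : IsPiecewiseSmoothDomain Ω) (hb : IsW1Infty Ω b Db) :
    IntegrableOn (divergence Db) Ω := by
  have : divergence Db = fun x => ∑ i, Db x (unitVec i) i := funext (divergence_eq_sum Db)
  rw [this]
  exact integrable_finsetSum _ fun i _ => hb.integrableOn_jacobian_apply hΩ.isBounded i

lemma integrableOn_normal_mul {M : Set (E (n + 1))} {N : E (n + 1) → E (n + 1)}
    (hM : IsTangentSurface M N) (i : Fin (n + 1)) {g : E (n + 1) → ℝ}
    (hg : IntegrableOn g M (μHE[n] : Measure (E (n + 1)))) :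
    IntegrableOn (fun x => N x i * g x) M (μHE[n] : Measure (E (n + 1))) := by
  refine Integrable.bdd_mul (c := 1) hg
    ((hM.continuousOn_apply i).aemeasurable hM.measurableSet).aestronglyMeasurable ?_
  exact ae_restrict_of_forall_mem hM.measurableSet fun x hx =>
    (PiLp.norm_apply_le (N x) i).trans (hM.norm_eq_one x hx).le

lemma sum_normal_mul (x y : E (n + 1)) (s : ℝ) : ∑ i, y i * (x i * s) = ⟪x, y⟫ * s := by
  rw [inner_eq_sum, Finset.sum_mul]
  exact Finset.sum_congr rfl fun i _ => by ring

/-- The normal flux of `b v²` through `Γ` is integrable. -/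
lemma integrableOn_flux (hΩ : IsPiecewiseSmoothDomain Ω) (hb : IsW1Infty Ω b Db)
    (hcov : 𝒯.Covers Ω) :
    IntegrableOn (fun x => ⟪b x, outerNormal Ω x⟫ * v.bdryTrace x ^ 2) (regularBoundary Ω)
      (μHE[n] : Measure (E (n + 1))) := by
  simp_rw [← sum_normal_mul]
  exact integrable_finsetSum _ fun i _ => integrableOn_normal_mul
    (isTangentSurface_regularBoundary hΩ.isOpen) i (v.integrableOn_bdryTrace_sq hΩ hb hcov i)

/-- The divergence theorem on the cut mesh for the broken vector field `v² b`. -/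
theorem sum_integral_divergence (hΩ : IsPiecewiseSmoothDomain Ω) (hb : IsW1Infty Ω b Db)
    (hcov : 𝒯.Covers Ω) (hν : IsFaceNormal 𝒯 Ω ν) :
    ∑ T : 𝒯.active Ω, ∫ x in simplex (T : Finset (E (n + 1))) ∩ Ω,
        ∑ i, v.sqDeriv b Db i T x =
      (∫ x in regularBoundary Ω, ⟪b x, outerNormal Ω x⟫ * v.bdryTrace x ^ 2 ∂μHE[n]) +
        ∑ F ∈ 𝒯.interiorFaces Ω, ∫ x in simplex F ∩ Ω, ⟪b x, ν F⟫ *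
          (sideTrace v.toFun (ν F) x ^ 2 - sideTrace v.toFun (-ν F) x ^ 2) ∂μHE[n] := by
  have h1 : ∀ T : 𝒯.active Ω, ∫ x in simplex (T : Finset (E (n + 1))) ∩ Ω,
      ∑ i, v.sqDeriv b Db i T x =
        ∑ i, ∫ x in simplex (T : Finset (E (n + 1))) ∩ Ω, v.sqDeriv b Db i T x := fun T =>
    integral_finsetSum _ fun i _ =>
      (v.integrableOn_sqDeriv hΩ hb i T).mono_set Set.inter_subset_right
  simp_rw [h1]
  rw [Finset.sum_comm, Finset.sum_congr rfl fun i _ => v.sum_integral_sqDeriv hΩ hb hcov hν i,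
    Finset.sum_add_distrib, Finset.sum_comm]
  simp_rw [← sum_normal_mul]
  congr 1
  · exact (integral_finsetSum _ fun i _ => integrableOn_normal_mul
      (isTangentSurface_regularBoundary hΩ.isOpen) i
      (v.integrableOn_bdryTrace_sq hΩ hb hcov i)).symm
  · refine Finset.sum_congr rfl fun F hF => ?_
    exact (integral_finsetSum _ fun i _ => integrableOn_normal_mul
      (Mesh.isTangentSurface_face hΩ.isOpen (hν F hF).1 (hν F hF).2) i
      (v.integrableOn_face_sq hΩ hb hν hF i)).symm

/-- Half of the flux of `b v²` through `Γ`, minus its part through the inflow boundary, is half of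
the integral of the modulus of the flux. -/
lemma half_flux_sub_inflow (hΩ : IsPiecewiseSmoothDomain Ω) (hb : IsW1Infty Ω b Db)
    (hcov : 𝒯.Covers Ω) :
    1 / 2 * (∫ x in regularBoundary Ω, ⟪b x, outerNormal Ω x⟫ * v.bdryTrace x ^ 2 ∂μHE[n]) -
      ∫ x in inflow Ω b, ⟪b x, outerNormal Ω x⟫ * v.bdryTrace x * v.bdryTrace x ∂μHE[n] =
    1 / 2 * ∫ x in frontier Ω, |⟪b x, outerNormal Ω x⟫| * v.bdryTrace x ^ 2 ∂μHE[n] := by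
  have hM := isTangentSurface_regularBoundary hΩ.isOpen
  have hreg : regularBoundary Ω =ᵐ[(μHE[n] : Measure (E (n + 1)))] frontier Ω :=
    EventuallyLE.antisymm (Eventually.of_forall fun x hx => hx.1)
      (ae_le_set.mpr hΩ.boundary_regular)
  have hsub : inflow Ω b ⊆ regularBoundary Ω := by
    rintro x ⟨hx, hneg⟩
    refine ⟨hx, ?_⟩
    by_contra h
    rw [outerNormal, dif_neg h, inner_zero_right] at hneg
    exact lt_irrefl _ hneg
  have hmeas : MeasurableSet (inflow Ω b) := by
    have hcont : ContinuousOn (fun x => ⟪b x, outerNormal Ω x⟫) (regularBoundary Ω) :=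
      (hb.continuousOn.mono Set.subset_union_right).inner hM.continuousOn
    obtain ⟨U, hU, hU'⟩ := (continuousOn_iff'.mp hcont) (Set.Iio 0) isOpen_Iio
    have : inflow Ω b = U ∩ regularBoundary Ω := by
      rw [← hU']
      ext x
      exact ⟨fun h => ⟨h.2, hsub h⟩, fun h => ⟨h.2.1, h.1⟩⟩
    rw [this]
    exact hU.measurableSet.inter hM.measurableSet
  have hflux := v.integrableOn_flux hΩ hb hcov
  have hind : IntegrableOn ((inflow Ω b).indicator
      fun x => ⟪b x, outerNormal Ω x⟫ * v.bdryTrace x ^ 2) (regularBoundary Ω)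
      (μHE[n] : Measure (E (n + 1))) := hflux.indicator hmeas
  have h1 : ∫ x in frontier Ω, |⟪b x, outerNormal Ω x⟫| * v.bdryTrace x ^ 2 ∂μHE[n] =
      ∫ x in regularBoundary Ω, (⟪b x, outerNormal Ω x⟫ * v.bdryTrace x ^ 2 -
        2 * (inflow Ω b).indicator
          (fun x => ⟪b x, outerNormal Ω x⟫ * v.bdryTrace x ^ 2) x) ∂μHE[n] := by
    rw [← setIntegral_congr_set hreg]
    refine setIntegral_congr_fun hM.measurableSet fun x hx => ?_
    by_cases h : x ∈ inflow Ω b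
    · rw [Set.indicator_of_mem h, abs_of_neg h.2]
      ring
    · rw [Set.indicator_of_notMem h, abs_of_nonneg (not_lt.mp fun h' => h ⟨hx.1, h'⟩)]
      ring
  have h2 : ∫ x in inflow Ω b, ⟪b x, outerNormal Ω x⟫ * v.bdryTrace x * v.bdryTrace x ∂μHE[n] =
      ∫ x in regularBoundary Ω, (inflow Ω b).indicator
          (fun x => ⟪b x, outerNormal Ω x⟫ * v.bdryTrace x ^ 2) x ∂μHE[n] := by
    rw [setIntegral_indicator hmeas, Set.inter_eq_right.mpr hsub]
    exact integral_congr_ae (ae_of_all _ fun x => by ring)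
  rw [h1, h2, integral_sub hflux (hind.const_mul 2), integral_const_mul]
  ring

/-- The energy identity for the upwind form. On the faces, `v₊² - v₋² = 2 ⟦v⟧ {v}` makes the flux
from the divergence theorem cancel the consistency term. -/
theorem aForm_self (hΩ : IsPiecewiseSmoothDomain Ω) (hb : IsW1Infty Ω b Db)
    (hc : MemLp c ∞ (volume.restrict Ω)) (hcov : 𝒯.Covers Ω) (hν : IsFaceNormal 𝒯 Ω ν) :
    aForm b c ν v v =
      (∑ T : 𝒯.active Ω, ∫ x in simplex (T : Finset (E (n + 1))) ∩ Ω,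
        v.onElement T x ^ 2 * (c x - 1 / 2 * divergence Db x)) +
      1 / 2 * (∫ x in frontier Ω, |⟪b x, outerNormal Ω x⟫| * v.bdryTrace x ^ 2 ∂μHE[n]) +
      1 / 2 * ∑ F ∈ 𝒯.interiorFaces Ω, ∫ x in simplex F ∩ Ω,
        |⟪b x, ν F⟫| * v.jump (ν F) x ^ 2 ∂μHE[n] := by
  have hcint : IntegrableOn c Ω :=
    have := IsW1Infty.isFiniteMeasure_restrict hΩ.isBounded
    hc.integrable le_top
  have hvol : ∀ T : 𝒯.active Ω, ∫ x in simplex (T : Finset (E (n + 1))) ∩ Ω,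
      (⟪b x, gradient (v.onElement T) x⟫ + c x * v.onElement T x) * v.onElement T x =
      1 / 2 * (∫ x in simplex (T : Finset (E (n + 1))) ∩ Ω, ∑ i, v.sqDeriv b Db i T x) +
        ∫ x in simplex (T : Finset (E (n + 1))) ∩ Ω,
          v.onElement T x ^ 2 * (c x - 1 / 2 * divergence Db x) := by
    intro T
    have h1 : IntegrableOn (fun x => ∑ i, v.sqDeriv b Db i T x)
        (simplex (T : Finset (E (n + 1))) ∩ Ω) := integrable_finsetSum _ fun i _ =>
      (v.integrableOn_sqDeriv hΩ hb i T).mono_set Set.inter_subset_right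
    have h2 : IntegrableOn (fun x => v.onElement T x ^ 2 * (c x - 1 / 2 * divergence Db x))
        (simplex (T : Finset (E (n + 1))) ∩ Ω) :=
      (integrableOn_smul_of_continuous hΩ.isOpen hΩ.isBounded
        ((v.continuous_onElement T).pow 2)
        (hcint.sub ((integrableOn_divergence hΩ hb).const_mul (1 / 2)))).mono_set
          Set.inter_subset_right
    rw [← integral_const_mul, ← integral_add (h1.const_mul _) h2]
    refine integral_congr_ae (ae_of_all _ fun x => ?_)
    simp only [sum_sqDeriv]
    ring
  have hface : ∀ F ∈ 𝒯.interiorFaces Ω, ∫ x in simplex F ∩ Ω,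
      ⟪b x, ν F⟫ * v.jump (ν F) x * v.avg (ν F) x ∂μHE[n] =
      1 / 2 * ∫ x in simplex F ∩ Ω, ⟪b x, ν F⟫ *
        (sideTrace v.toFun (ν F) x ^ 2 - sideTrace v.toFun (-ν F) x ^ 2) ∂μHE[n] := by
    intro F _
    rw [← integral_const_mul]
    refine integral_congr_ae (ae_of_all _ fun x => ?_)
    simp only [jump, avg]
    ring
  have hjump : ∀ F, ∫ x in simplex F ∩ Ω,
      |⟪b x, ν F⟫| * v.jump (ν F) x * v.jump (ν F) x ∂μHE[n] =
      ∫ x in simplex F ∩ Ω, |⟪b x, ν F⟫| * v.jump (ν F) x ^ 2 ∂μHE[n] := fun F =>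
    integral_congr_ae (ae_of_all _ fun x => by ring)
  have hdiv := v.sum_integral_divergence hΩ hb hcov hν
  have hΓ := v.half_flux_sub_inflow hΩ hb hcov
  unfold aForm
  -- the surface measure `μHE[n + 1 - 1]` of the form is `μHE[n]`
  simp only [Nat.add_sub_cancel]
  simp_rw [hvol, hjump]
  rw [Finset.sum_congr rfl hface, Finset.sum_add_distrib, ← Finset.mul_sum, ← Finset.mul_sum, hdiv,
    ← hΓ]
  ring

lemma integral_toFun_sq (hΩ : IsPiecewiseSmoothDomain Ω) :
    ∫ x in Ω, v.toFun x ^ 2 =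
      ∑ T : 𝒯.active Ω, ∫ x in simplex (T : Finset (E (n + 1))) ∩ Ω, v.onElement T x ^ 2 := by
  have h1 : ∀ x ∈ Ω, v.toFun x ^ 2 = ∑ T : 𝒯.active Ω,
      (interior (simplex (T : Finset (E (n + 1))))).indicator (fun x => v.onElement T x ^ 2) x := by
    intro x hx
    have h2 : ∑ T : 𝒯.active Ω, (interior (simplex (T : Finset (E (n + 1))))).indicator
        (fun x => v.onElement T x ^ 2) x =
          brokenFun 𝒯 Ω (fun T x => v.onElement T x ^ 2) x := by
      refine Finset.sum_congr rfl fun T _ => ?_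
      by_cases hT : x ∈ interior (simplex (T : Finset (E (n + 1)))) <;>
        simp [Set.indicator, Set.mem_inter_iff, hx, hT]
    rw [h2]
    by_cases h : ∃ T : 𝒯.active Ω, x ∈ interior (simplex (T : Finset (E (n + 1))))
    · obtain ⟨T, hT⟩ := h
      rw [brokenFun_eq T hT hx, v.toFun_eq_of_mem_interior T hT]
    · push Not at h
      rw [toFun, brokenFun, Finset.sum_eq_zero, Finset.sum_eq_zero, zero_pow two_ne_zero]
      · exact fun T _ => Set.indicator_of_notMem (fun hx' => h T hx'.1) _
      · exact fun T _ => Set.indicator_of_notMem (h T) _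
  rw [setIntegral_congr_fun hΩ.isOpen.measurableSet h1, integral_finsetSum]
  · refine Finset.sum_congr rfl fun T _ => ?_
    rw [setIntegral_indicator isOpen_interior.measurableSet, Set.inter_comm]
    refine setIntegral_congr_set (EventuallyEq.inter ?_ (ae_eq_refl _))
    exact interior_ae_eq_of_null_frontier ((convex_convexHull ℝ _).addHaar_frontier volume)
  · intro T _
    have hone : IntegrableOn (fun _ : E (n + 1) => (1 : ℝ)) Ω :=
      integrableOn_const hΩ.isBounded.measure_lt_top.ne
    have := integrableOn_smul_of_continuous hΩ.isOpen hΩ.isBounded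
      ((v.continuous_onElement T).pow 2) hone
    simp only [smul_eq_mul, mul_one] at this
    exact this.indicator isOpen_interior.measurableSet

end DGSpace

lemma ae_norm_le_toReal_eLpNorm {F : Type*} [NormedAddCommGroup F] {μ : Measure (E (n + 1))}
    {f : E (n + 1) → F} (hf : MemLp f ∞ μ) : ∀ᵐ x ∂μ, ‖f x‖ ≤ (eLpNorm f ∞ μ).toReal := by
  have hne := hf.eLpNorm_ne_top
  rw [eLpNorm_exponent_top] at hne ⊢
  filter_upwards [ae_le_eLpNormEssSup (f := f) (μ := μ)] with x hx
  have := ENNReal.toReal_mono hne hx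
  rwa [toReal_enorm] at this

section Coercivity

variable {𝒯 : Mesh (n + 1)} {Ω : Set (E (n + 1))} {p : ℕ}
  {b : E (n + 1) → E (n + 1)} {Db : E (n + 1) → E (n + 1) →L[ℝ] E (n + 1)}
  {c : E (n + 1) → ℝ} {ν : Finset (E (n + 1)) → E (n + 1)}

lemma ae_c0_le (hb : IsW1Infty Ω b Db) (hc : MemLp c ∞ (volume.restrict Ω)) :
    ∀ᵐ x ∂volume.restrict Ω, c0 Ω Db c ≤ c x - 1 / 2 * divergence Db x := by
  refine ae_essInf_le ⟨-((eLpNorm c ∞ (volume.restrict Ω)).toReal +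
    (n + 1) * (eLpNorm Db ∞ (volume.restrict Ω)).toReal), ?_⟩
  rw [eventually_map]
  filter_upwards [ae_norm_le_toReal_eLpNorm hc, ae_norm_le_toReal_eLpNorm hb.memLp_jacobian]
    with x h1 h2
  have h3 := (abs_divergence_le Db x).trans (mul_le_mul_of_nonneg_left h2 (by positivity))
  rw [Real.norm_eq_abs] at h1
  linarith [(abs_le.mp h1).1, le_abs_self (divergence Db x), abs_nonneg (divergence Db x)]

/-- The dimension bounds the ratio of `c₀` and `τ_c⁻¹`. -/
lemma c0_le (hΩ : IsPiecewiseSmoothDomain Ω) (hb : IsW1Infty Ω b Db)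
    (hc : MemLp c ∞ (volume.restrict Ω)) : c0 Ω Db c ≤ (n + 1) * (tauC Ω Db c)⁻¹ := by
  have hne : (ae (volume.restrict Ω)).NeBot := by
    rw [ae_neBot, Ne, Measure.restrict_eq_zero]
    exact (hΩ.isOpen.measure_pos volume hΩ.isConnected.nonempty).ne'
  obtain ⟨x, h1, h2, h3⟩ := ((ae_norm_le_toReal_eLpNorm hc).and
    ((ae_norm_le_toReal_eLpNorm hb.memLp_jacobian).and (ae_c0_le hb hc))).exists
  rw [tauC, inv_inv]
  have h4 := abs_divergence_le Db x
  rw [Real.norm_eq_abs] at h1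
  have h5 : ((n : ℝ) + 1) * ‖Db x‖ ≤ (n + 1) * (eLpNorm Db ∞ (volume.restrict Ω)).toReal := by
    gcongr
  have h6 : (0 : ℝ) ≤ n * (eLpNorm c ∞ (volume.restrict Ω)).toReal := by positivity
  linarith [le_abs_self (c x), neg_abs_le (divergence Db x), abs_nonneg (divergence Db x)]

lemma c0_mul_tauC_le (hΩ : IsPiecewiseSmoothDomain Ω) (hb : IsW1Infty Ω b Db)
    (hc : MemLp c ∞ (volume.restrict Ω)) (h0 : 0 < c0 Ω Db c) :
    0 < tauC Ω Db c ∧ c0 Ω Db c * tauC Ω Db c ≤ n + 1 := by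
  have h1 := c0_le hΩ hb hc
  have h2 : 0 < (tauC Ω Db c)⁻¹ := pos_of_mul_pos_right (h0.trans_le h1) (by positivity)
  have h3 := inv_pos.mp h2
  refine ⟨h3, ?_⟩
  rwa [← div_eq_mul_inv, le_div_iff₀ h3] at h1

/-- Coercivity of the upwind form in the upwind norm, without ghost penalty. -/
theorem upNormSq_le_aForm (hΩ : IsPiecewiseSmoothDomain Ω) (hb : IsW1Infty Ω b Db)
    (hc : MemLp c ∞ (volume.restrict Ω)) (h0 : 0 < c0 Ω Db c) (hcov : 𝒯.Covers Ω)
    (hν : IsFaceNormal 𝒯 Ω ν) (v : DGSpace 𝒯 Ω p) :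
    c0 Ω Db c * tauC Ω Db c * upNormSq b Db c ν v ≤ (n + 1) * aForm b c ν v v := by
  obtain ⟨hτ, hle⟩ := c0_mul_tauC_le hΩ hb hc h0
  have hcint : IntegrableOn c Ω :=
    have := IsW1Infty.isFiniteMeasure_restrict hΩ.isBounded
    hc.integrable le_top
  have hvol : c0 Ω Db c * (∫ x in Ω, v.toFun x ^ 2) ≤
      ∑ T : 𝒯.active Ω, ∫ x in simplex (T : Finset (E (n + 1))) ∩ Ω,
        v.onElement T x ^ 2 * (c x - 1 / 2 * divergence Db x) := by
    rw [v.integral_toFun_sq hΩ, Finset.mul_sum]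
    refine Finset.sum_le_sum fun T _ => ?_
    rw [← integral_const_mul]
    have hcontT := (v.continuous_onElement T).pow 2
    refine integral_mono_ae ?_ ?_ ?_
    · exact (((hcontT.const_mul (c0 Ω Db c)).continuousOn).integrableOn_compact
        (isCompact_simplex _)).mono_set Set.inter_subset_left
    · exact (integrableOn_smul_of_continuous hΩ.isOpen hΩ.isBounded hcontT
        (hcint.sub ((DGSpace.integrableOn_divergence hΩ hb).const_mul (1 / 2)))).mono_set
          Set.inter_subset_right
    · filter_upwards [ae_restrict_of_ae_restrict_of_subset Set.inter_subset_right
        (ae_c0_le hb hc)] with x hx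
      rw [mul_comm]
      exact mul_le_mul_of_nonneg_left hx (sq_nonneg _)
  rw [v.aForm_self hΩ hb hc hcov hν, upNormSq]
  simp only [Nat.add_sub_cancel]
  set V := ∫ x in Ω, v.toFun x ^ 2
  set S := ∑ T : 𝒯.active Ω, ∫ x in simplex (T : Finset (E (n + 1))) ∩ Ω,
        v.onElement T x ^ 2 * (c x - 1 / 2 * divergence Db x)
  have hV : 0 ≤ V := integral_nonneg fun x => sq_nonneg _
  have hG : 0 ≤ ∫ x in frontier Ω, |⟪b x, outerNormal Ω x⟫| * v.bdryTrace x ^ 2 ∂μHE[n] :=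
    integral_nonneg fun x => mul_nonneg (abs_nonneg _) (sq_nonneg _)
  have hF : 0 ≤ ∑ F ∈ 𝒯.interiorFaces Ω, ∫ x in simplex F ∩ Ω,
      |⟪b x, ν F⟫| * v.jump (ν F) x ^ 2 ∂μHE[n] :=
    Finset.sum_nonneg fun F _ => integral_nonneg fun x => mul_nonneg (abs_nonneg _) (sq_nonneg _)
  set G := ∫ x in frontier Ω, |⟪b x, outerNormal Ω x⟫| * v.bdryTrace x ^ 2 ∂μHE[n]
  set J := ∑ F ∈ 𝒯.interiorFaces Ω, ∫ x in simplex F ∩ Ω,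
      |⟪b x, ν F⟫| * v.jump (ν F) x ^ 2 ∂μHE[n]
  have h1 : c0 Ω Db c * tauC Ω Db c * ((tauC Ω Db c)⁻¹ * V + 1 / 2 * G + 1 / 2 * J) =
      c0 Ω Db c * V + c0 Ω Db c * tauC Ω Db c * (1 / 2 * G + 1 / 2 * J) := by
    field_simp
    ring
  have h2 : c0 Ω Db c * tauC Ω Db c * (1 / 2 * G + 1 / 2 * J) ≤
      (n + 1) * (1 / 2 * G + 1 / 2 * J) := mul_le_mul_of_nonneg_right hle (by positivity)
  have h3 : 0 ≤ S := (by positivity : 0 ≤ c0 Ω Db c * V).trans hvol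
  have h4 : (0 : ℝ) ≤ n * S := by positivity
  rw [h1]
  linarith

end Coercivity

end

end CutDG

theorem mainTheorem6 (d : ℕ) (hd : d = 2 ∨ d = 3) :
    ∃ C : ℝ, 0 < C ∧
      ∀ (Ω : Set (CutDG.E d)), CutDG.IsPiecewiseSmoothDomain Ω →
      ∀ (b : CutDG.E d → CutDG.E d) (Db : CutDG.E d → CutDG.E d →L[ℝ] CutDG.E d)
        (c : CutDG.E d → ℝ),
        CutDG.IsW1Infty Ω b Db → MemLp c ∞ (volume.restrict Ω) → 0 < CutDG.c0 Ω Db c →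
      ∀ (𝒯 : CutDG.Mesh d), 𝒯.Covers Ω →
      ∀ (ν : Finset (CutDG.E d) → CutDG.E d), CutDG.IsFaceNormal 𝒯 Ω ν →
      ∀ (p : ℕ) (gc gb : LinearMap.BilinForm ℝ (CutDG.DGSpace 𝒯 Ω p)),
        gc.IsPosSemidef → gb.IsPosSemidef →
      ∀ v : CutDG.DGSpace 𝒯 Ω p,
        CutDG.c0 Ω Db c * CutDG.tauC Ω Db c * CutDG.upNormHSq b Db c ν gc gb v
            ≤ C * CutDG.AForm b c ν gc gb v v ∧
        CutDG.c0 Ω Db c * CutDG.tauC Ω Db c * CutDG.upNormSq b Db c ν v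
            ≤ C * CutDG.aForm b c ν v v := by
  obtain ⟨n, rfl⟩ : ∃ n, d = n + 1 := ⟨d - 1, by omega⟩
  -- the constant is the dimension, which bounds `c₀ τ_c`
  refine ⟨n + 1, by positivity, fun Ω hΩ b Db c hb hc h0 𝒯 hcov ν hν p gc gb hgc hgb v => ?_⟩
  have h1 := CutDG.upNormSq_le_aForm hΩ hb hc h0 hcov hν v
  refine ⟨?_, h1⟩
  have h2 : 0 ≤ gc v v + gb v v := add_nonneg (hgc.nonneg v) (hgb.nonneg v)
  have h3 := mul_le_mul_of_nonneg_right (CutDG.c0_mul_tauC_le hΩ hb hc h0).2 h2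
  rw [CutDG.upNormHSq, CutDG.AForm, mul_add _ (CutDG.upNormSq _ _ _ _ _),
    mul_add _ (CutDG.aForm _ _ _ _ _)]
  exact add_le_add h1 h3
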